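/- **Setting.** A binary tree is a leaf or a node with a left subtree, an entry and a right subtree; $|T|$ is the number of nodes of $T$, $w(T)=|T|+1$ its weight and $h(T)$ its height ($0$ for a leaf). Each entry contains a key from a total order, and a tree is a binary search tree (BST) if its keys are strictly increasing in in-order. Four balancing schemes are considered. - *AVL*: the heights of the two subtrees of every node differ by at most one. - *Red-black*: every node is red or black, no red node has a red child, and all paths from the root to a leaf contain the same number of black nodes (the root may be red). - *Weight-balanced* with a parameter $\alpha$, $\frac{2}{11}<\alpha\le 1-\frac1{\sqrt2}$: every node $T$ with left subtree $L$ satisfies $\alpha\le w(L)/w(T)\le 1-\alpha$. - *Treap*: every node carries a priority, which is no greater than the priorities of its children. Each node has an independent priority that is uniform on $[0,1]$; a key that occurs in both input treaps may sit in one node common to both (one priority) or in two different nodes (two independent priorities). The key sets are fixed independently of the priorities. **Algorithms.** For each scheme let $\mathrm{join}(L,k,R)$, for $L<k<R$, be the following sequential algorithm. - *AVL*: if $|h(L)-h(R)|\le1$, return $\mathrm{node}(L,k,R)$. If $h(L)>h(R)+1$, follow the right spine of $L$ to the first subtree $c$ with $h(c)\le h(R)+1$, replace it by $\mathrm{node}(c,k,R)$,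 and on the way back rebalance: a double rotation at the parent of the new node, single left rotations above it, wherever the right subtree has become more than one higher than the left one. The case $h(R)>h(L)+1$ is symmetric. - *Red-black*: if the black heights of $L$ and $R$ are equal, return a node with key $k$ that is red if both roots are black (leaves count as black) and black otherwise. If $L$ has the larger black height, follow its right spine to the first black $c$ with the black height of $R$, replace it by a red $\mathrm{node}(c,k,R)$, and on the way back, at every black node whose right child and that child's right child are both red, color the latter black and rotate left; finally color the root black if it and its right child are red. The other case is symmetric. - *Weight-balanced*: call two trees like if they may be siblings. If $L,R$ are like, return $\mathrm{node}(L,k,R)$. If $L$ is too heavy, follow its right spine to the first subtree $c$ like $R$, replace it by $\mathrm{node}(c,k,R)$, and on the way back, at a node with left subtree $l$ and new right subtree $T'=\mathrm{node}(l_1,k_1,r_1)$ that are not like, do a single left rotation if $l,l_1$ are like and weights $w(l)+w(l_1)$, $w(r_1)$ are like, and otherwise a double rotation. The other case is symmetric. - *Treap*: if the priority of $k$ is no greater than those of the roots of $L$ and $R$, return $\mathrm{node}(L,k,R)$. Otherwise let the root with the smaller priority be the root of the result: if it is $L=\mathrm{node}(l_1,k_1,r_1)$, return $\mathrm{node}(l_1,k_1,\mathrm{join}(r_1,k,R))$;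 if it is $R=\mathrm{node}(l_2,k_2,r_2)$, return $\mathrm{node}(\mathrm{join}(L,k,l_2),k_2,r_2)$. On top of $\mathrm{join}$: - $\mathrm{split}(T,k)$ returns (tree of smaller keys, whether $k\in T$, tree of larger keys). On a leaf it returns (leaf, false, leaf). On $\mathrm{node}(L,m,R)$ it returns $(L,\mathrm{true},R)$ if $k=m$; if $k<m$ it computes $(L_L,b,L_R)=\mathrm{split}(L,k)$ and returns $(L_L,b,\mathrm{join}(L_R,m,R))$; the case $k>m$ is symmetric. - $\mathrm{splitLast}(\mathrm{node}(L,k,R))$ returns $(L,k)$ if $R$ is a leaf; otherwise it computes $(T',k')=\mathrm{splitLast}(R)$ and returns $(\mathrm{join}(L,k,T'),k')$. - $\mathrm{join2}(L,R)$ returns $R$ if $L$ is a leaf; otherwise it computes $(L',k)=\mathrm{splitLast}(L)$ and returns $\mathrm{join}(L',k,R)$. - Union, intersection and difference of $(T_1,T_2)$: if $T_1$ is a leaf, return $T_2$, a leaf, a leaf, respectively; else if $T_2$ is a leaf, return $T_1$, a leaf, $T_1$, respectively. Otherwise let $T_2=\mathrm{node}(L_2,k_2,R_2)$, compute $(L_1,b,R_1)=\mathrm{split}(T_1,k_2)$,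 recurse in parallel on $(L_1,L_2)$ and $(R_1,R_2)$ to get $T_L,T_R$, and return: for union $\mathrm{join}(T_L,k_2,T_R)$; for intersection $\mathrm{join}(T_L,k_2,T_R)$ if $b$ is true and $\mathrm{join2}(T_L,T_R)$ if not; for difference $\mathrm{join2}(T_L,T_R)$. **Cost.** Creating or exposing a node, a rotation, a recoloring, and a test on keys, heights, weights, colors, black heights or priorities (all stored in the nodes) cost one unit. Work $W$ and span $S$ add up under sequential composition, and $W(e_1\,\|\,e_2)=W(e_1)+W(e_2)+1$, $S(e_1\,\|\,e_2)=\max(S(e_1),S(e_2))+1$. **Theorem.** For each of the four schemes (and each $\alpha$ as above for weight-balanced trees) there is a constant $C$ such that the following holds for all balanced BSTs $T_1,T_2$ of that scheme over any total order. Let $m\le n$ be the smaller and the larger of $|T_1|$ and $|T_2|$ (either tree may be the larger one). For each of union, intersection and difference of $(T_1,T_2)$, if $m\ge1$, $$W\le C\,m\log_2\!\left(\frac nm+1\right),\qquad S\le C\,\log_2(n+1)\,\log_2(m+1),$$ and if $m=0$, $W\le C$ and $S\le C$. For treaps these bounds hold for the expectations of $W$ and $S$ over the random priorities. -/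

import Mathlib

open scoped ENNReal

universe u v w

noncomputable section

namespace JoinTree

/-! ### Cost semantics: values together with the work and the span spent to compute them -/

/-- The result of a (nested fork-join) computation, with its work (total number of unit-cost
operations) and its span (number of unit-cost operations on the critical path). -/
@[ext]
structure Cost (β : Type u) where
  val : β
  work : ℕ
  span : ℕ

namespace Cost

variable {β : Type u} {γ : Type v}

/-- A value that is already available. -/
def ret (b : β) : Cost β := ⟨b, 0, 0⟩

/-- One unit-cost operation, followed by the computation `x`. -/
def tick (x : Cost β) : Cost β := ⟨x.val, x.work + 1, x.span + 1⟩

/-- Sequential composition: work and span add up. -/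
def bind (x : Cost β) (f : β → Cost γ) : Cost γ :=
  ⟨(f x.val).val, x.work + (f x.val).work, x.span + (f x.val).span⟩

/-- Parallel composition `x || y`. -/
def par (x : Cost β) (y : Cost γ) : Cost (β × γ) :=
  ⟨(x.val, y.val), x.work + y.work + 1, max x.span y.span + 1⟩

open Classical in
/-- A unit-cost test, followed by one of two computations (only the selected one is charged). -/
def test (p : Prop) (x y : Cost β) : Cost β := tick (if p then x else y)

end Cost

open Cost BinaryTree

/-! ### Binary trees

`BinaryTree.nil` is a leaf and `BinaryTree.node e l r` is the node with left subtree `l`, entry `e`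
and right subtree `r`. The size `|T|` is `BinaryTree.numNodes`, the weight `w(T) = |T| + 1` is
`BinaryTree.numLeaves`, the height (`0` for a leaf) is `BinaryTree.height`. Heights, weights, black
heights, colors and priorities are stored in the nodes of an implementation, so that a test that
reads a bounded number of them has unit cost. -/

section Generic

variable {E : Type u} {K : Type v}

/-- The in-order sequence of entries. -/
def inorder : BinaryTree E → List E
  | nil => []
  | node e l r => inorder l ++ e :: inorder r

/-- Binary search tree: the keys are in strictly increasing order. -/
def IsBST [LinearOrder K] (key : E → K) (t : BinaryTree E) : Prop :=
  ((inorder t).map key).Pairwise (· < ·)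

/-- Create a node, at unit cost. -/
def mkNode (l : BinaryTree E) (e : E) (r : BinaryTree E) : Cost (BinaryTree E) :=
  tick (ret (node e l r))

/-- Left rotation at the root, at unit cost. -/
def rotateLeft : BinaryTree E → Cost (BinaryTree E)
  | node e a (node f b c) => tick (ret (node f (node e a b) c))
  | t => tick (ret t)

/-- Right rotation at the root, at unit cost. -/
def rotateRight : BinaryTree E → Cost (BinaryTree E)
  | node f (node e a b) c => tick (ret (node e a (node f b c)))
  | t => tick (ret t)

/-! ### The algorithms that are generic in `join` -/

/-- `split T k` returns the tree of smaller keys, whether `k` occurs in `T`, and the tree of larger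
keys. The ticks are the leaf test, and `expose`. -/
def split [LinearOrder K] (key : E → K)
    (join : BinaryTree E → E → BinaryTree E → Cost (BinaryTree E)) (k : K) :
    BinaryTree E → Cost (BinaryTree E × Bool × BinaryTree E)
  | nil => tick (ret (nil, false, nil))
  | node m l r => tick <| tick <|
      test (k = key m) (ret (l, true, r)) <|
      test (k < key m)
        ((split key join k l).bind fun s =>
          (join s.2.2 m r).bind fun t => ret (s.1, s.2.1, t))
        ((split key join k r).bind fun s =>
          (join l m s.1).bind fun t => ret (t, s.2.1, s.2.2))

/-- `splitLast` of the nonempty tree `node k l r`: the tree without its last entry, and that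
entry. -/
def splitLast (join : BinaryTree E → E → BinaryTree E → Cost (BinaryTree E)) :
    E → BinaryTree E → BinaryTree E → Cost (BinaryTree E × E)
  | k, l, nil => tick <| tick <| ret (l, k)
  | k, l, node k' l' r' => tick <| tick <|
      (splitLast join k' l' r').bind fun s =>
        (join l k s.1).bind fun t => ret (t, s.2)

/-- `join` without a middle entry. -/
def join2 (join : BinaryTree E → E → BinaryTree E → Cost (BinaryTree E)) :
    BinaryTree E → BinaryTree E → Cost (BinaryTree E)
  | nil, tr => tick (ret tr)
  | node k l r, tr => tick <| (splitLast join k l r).bind fun s => join s.1 s.2 tr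

/-- Union; the first tree is split by the root of the second one. -/
def union [LinearOrder K] (key : E → K)
    (join : BinaryTree E → E → BinaryTree E → Cost (BinaryTree E)) :
    BinaryTree E → BinaryTree E → Cost (BinaryTree E)
  | nil, t₂ => tick (ret t₂)
  | node e l r, nil => tick <| tick <| ret (node e l r)
  | node e l r, node k₂ l₂ r₂ => tick <| tick <| tick <|
      (split key join (key k₂) (node e l r)).bind fun s =>
        ((union key join s.1 l₂).par (union key join s.2.2 r₂)).bind fun t =>
          join t.1 k₂ t.2

/-- Intersection. -/
def intersect [LinearOrder K] (key : E → K)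
    (join : BinaryTree E → E → BinaryTree E → Cost (BinaryTree E)) :
    BinaryTree E → BinaryTree E → Cost (BinaryTree E)
  | nil, _ => tick (ret nil)
  | node _ _ _, nil => tick <| tick <| ret nil
  | node e l r, node k₂ l₂ r₂ => tick <| tick <| tick <|
      (split key join (key k₂) (node e l r)).bind fun s =>
        ((intersect key join s.1 l₂).par (intersect key join s.2.2 r₂)).bind fun t =>
          test (s.2.1 = true) (join t.1 k₂ t.2) (join2 join t.1 t.2)

/-- Difference (the keys of the first tree that are not in the second one). -/
def difference [LinearOrder K] (key : E → K)
    (join : BinaryTree E → E → BinaryTree E → Cost (BinaryTree E)) :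
    BinaryTree E → BinaryTree E → Cost (BinaryTree E)
  | nil, _ => tick (ret nil)
  | node e l r, nil => tick <| tick <| ret (node e l r)
  | node e l r, node k₂ l₂ r₂ => tick <| tick <| tick <|
      (split key join (key k₂) (node e l r)).bind fun s =>
        ((difference key join s.1 l₂).par (difference key join s.2.2 r₂)).bind fun t =>
          join2 join t.1 t.2

/-- The three set operations. -/
inductive SetOp
  | union
  | intersect
  | difference

/-- The algorithm for a set operation, on top of a given `join`. -/
def SetOp.run [LinearOrder K] (key : E → K)
    (join : BinaryTree E → E → BinaryTree E → Cost (BinaryTree E)) :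
    SetOp → BinaryTree E → BinaryTree E → Cost (BinaryTree E)
  | .union => JoinTree.union key join
  | .intersect => JoinTree.intersect key join
  | .difference => JoinTree.difference key join

end Generic

/-! ### AVL trees -/

namespace AVL

variable {K : Type u}

/-- The heights of the two subtrees of every node differ by at most one. -/
def Balanced : BinaryTree K → Prop
  | nil => True
  | node _ l r => l.height ≤ r.height + 1 ∧ r.height ≤ l.height + 1 ∧ Balanced l ∧ Balanced r

/-- `joinRight tl k tr`, by recursion along the right spine of `tl` (never called on a leaf). -/
def joinRight (k : K) (tr : BinaryTree K) : BinaryTree K → Cost (BinaryTree K)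
  | nil => mkNode nil k tr
  | node k' l c => tick <|
      test (c.height ≤ tr.height + 1)
        ((mkNode c k tr).bind fun t' =>
          test (t'.height ≤ l.height + 1) (mkNode l k' t')
            ((rotateRight t').bind fun t'' => (mkNode l k' t'').bind rotateLeft))
        ((joinRight k tr c).bind fun t' =>
          (mkNode l k' t').bind fun t'' =>
            test (t'.height ≤ l.height + 1) (ret t'') (rotateLeft t''))

/-- The mirror image of `joinRight`, by recursion along the left spine of `tr`. -/
def joinLeft (tl : BinaryTree K) (k : K) : BinaryTree K → Cost (BinaryTree K)
  | nil => mkNode tl k nil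
  | node k' c r => tick <|
      test (c.height ≤ tl.height + 1)
        ((mkNode tl k c).bind fun t' =>
          test (t'.height ≤ r.height + 1) (mkNode t' k' r)
            ((rotateLeft t').bind fun t'' => (mkNode t'' k' r).bind rotateRight))
        ((joinLeft tl k c).bind fun t' =>
          (mkNode t' k' r).bind fun t'' =>
            test (t'.height ≤ r.height + 1) (ret t'') (rotateRight t''))

def join (tl : BinaryTree K) (k : K) (tr : BinaryTree K) : Cost (BinaryTree K) :=
  test (tr.height + 1 < tl.height) (joinRight k tr tl) <|
  test (tl.height + 1 < tr.height) (joinLeft tl k tr) (mkNode tl k tr)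

end AVL

/-! ### Red-black trees -/

namespace RB

inductive Color
  | red
  | black

variable {K : Type u}

/-- The root is a red node; leaves are black. -/
def IsRed : BinaryTree (K × Color) → Prop
  | nil => False
  | node e _ _ => e.2 = .red

/-- The number of black nodes on a downward path to a leaf (the leftmost one; under the black rule
all paths agree). -/
def blackHeight : BinaryTree (K × Color) → ℕ
  | nil => 0
  | node (_, .red) l _ => blackHeight l
  | node (_, .black) l _ => blackHeight l + 1

/-- The red rule and the black rule; the root may be red. -/
def Balanced : BinaryTree (K × Color) → Prop
  | nil => True
  | node e l r => (e.2 = .red → ¬ IsRed l ∧ ¬ IsRed r) ∧ blackHeight l = blackHeight r ∧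
      Balanced l ∧ Balanced r

/-- The same tree with a black root. -/
def blacken : BinaryTree (K × Color) → BinaryTree (K × Color)
  | nil => nil
  | node e l r => node (e.1, .black) l r

/-- Make the root black, at unit cost. -/
def setBlack (t : BinaryTree (K × Color)) : Cost (BinaryTree (K × Color)) :=
  tick (ret (blacken t))

/-- Make the right child of the right child black, at unit cost. -/
def setBlackRR : BinaryTree (K × Color) → Cost (BinaryTree (K × Color))
  | node e l (node f a b) => tick (ret (node e l (node f a (blacken b))))
  | t => tick (ret t)

/-- Make the left child of the left child black, at unit cost. -/
def setBlackLL : BinaryTree (K × Color) → Cost (BinaryTree (K × Color))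
  | node e (node f a b) r => tick (ret (node e (node f (blacken a) b) r))
  | t => tick (ret t)

/-- Follow the right spine of `tl` to a black node (or leaf) with the black height of `tr`. -/
def joinRight (k : K) (tr : BinaryTree (K × Color)) :
    BinaryTree (K × Color) → Cost (BinaryTree (K × Color))
  | nil => tick <| mkNode nil (k, .red) tr
  | node k' l r =>
      test (¬ IsRed (node k' l r) ∧ blackHeight (node k' l r) = blackHeight tr)
        (mkNode (node k' l r) (k, .red) tr) <| tick <|
        (joinRight k tr r).bind fun t =>
          (mkNode l k' t).bind fun t' =>
            test (k'.2 = .black ∧ IsRed t'.right ∧ IsRed t'.right.right)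
              ((setBlackRR t').bind rotateLeft) (ret t')

/-- The mirror image of `joinRight`. -/
def joinLeft (tl : BinaryTree (K × Color)) (k : K) :
    BinaryTree (K × Color) → Cost (BinaryTree (K × Color))
  | nil => tick <| mkNode tl (k, .red) nil
  | node k' l r =>
      test (¬ IsRed (node k' l r) ∧ blackHeight (node k' l r) = blackHeight tl)
        (mkNode tl (k, .red) (node k' l r)) <| tick <|
        (joinLeft tl k l).bind fun t =>
          (mkNode t k' r).bind fun t' =>
            test (k'.2 = .black ∧ IsRed t'.left ∧ IsRed t'.left.left)
              ((setBlackLL t').bind rotateRight) (ret t')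

/-- `join`; the color that comes with the middle key is not used. -/
def join (tl : BinaryTree (K × Color)) (k : K × Color) (tr : BinaryTree (K × Color)) :
    Cost (BinaryTree (K × Color)) :=
  test (blackHeight tr < blackHeight tl)
    ((joinRight k.1 tr tl).bind fun t' =>
      test (IsRed t' ∧ IsRed t'.right) (setBlack t') (ret t')) <|
  test (blackHeight tl < blackHeight tr)
    ((joinLeft tl k.1 tr).bind fun t' =>
      test (IsRed t' ∧ IsRed t'.left) (setBlack t') (ret t')) <|
  test (¬ IsRed tl ∧ ¬ IsRed tr) (mkNode tl (k.1, .red) tr) (mkNode tl (k.1, .black) tr)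

end RB

/-! ### Weight-balanced trees with parameter `α` -/

namespace WB

variable {K : Type u}

/-- Weights `a` and `b` are like: subtrees of these weights may be siblings. -/
def Like (α : ℝ) (a b : ℕ) : Prop :=
  α ≤ (a : ℝ) / ((a + b : ℕ) : ℝ) ∧ (a : ℝ) / ((a + b : ℕ) : ℝ) ≤ 1 - α

/-- At every node `T` with left subtree `L`, `α ≤ w(L) / w(T) ≤ 1 - α`. -/
def Balanced (α : ℝ) : BinaryTree K → Prop
  | nil => True
  | node _ l r => Like α l.numLeaves r.numLeaves ∧ Balanced α l ∧ Balanced α r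

/-- `tl` is too heavy to be a sibling of `tr`. -/
def Heavy (α : ℝ) (tl tr : BinaryTree K) : Prop :=
  tr.numLeaves < tl.numLeaves ∧ ¬ Like α tl.numLeaves tr.numLeaves

/-- Follow the right spine of `tl` to a subtree with a weight like that of `tr`. -/
def joinRight (α : ℝ) (k : K) (tr : BinaryTree K) : BinaryTree K → Cost (BinaryTree K)
  | nil => tick <| mkNode nil k tr
  | node k' l c => tick <|
      test (Like α (node k' l c).numLeaves tr.numLeaves) (mkNode (node k' l c) k tr)
        ((joinRight α k tr c).bind fun t' => tick <|
          test (Like α l.numLeaves t'.numLeaves) (mkNode l k' t') <|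
          test (Like α l.numLeaves t'.left.numLeaves ∧
              Like α (l.numLeaves + t'.left.numLeaves) t'.right.numLeaves)
            ((mkNode l k' t').bind rotateLeft)
            ((rotateRight t').bind fun t'' => (mkNode l k' t'').bind rotateLeft))

/-- The mirror image of `joinRight`. -/
def joinLeft (α : ℝ) (tl : BinaryTree K) (k : K) : BinaryTree K → Cost (BinaryTree K)
  | nil => tick <| mkNode tl k nil
  | node k' c r => tick <|
      test (Like α tl.numLeaves (node k' c r).numLeaves) (mkNode tl k (node k' c r))
        ((joinLeft α tl k c).bind fun t' => tick <|
          test (Like α t'.numLeaves r.numLeaves) (mkNode t' k' r) <|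
          test (Like α t'.right.numLeaves r.numLeaves ∧
              Like α t'.left.numLeaves (t'.right.numLeaves + r.numLeaves))
            ((mkNode t' k' r).bind rotateRight)
            ((rotateLeft t').bind fun t'' => (mkNode t'' k' r).bind rotateRight))

def join (α : ℝ) (tl : BinaryTree K) (k : K) (tr : BinaryTree K) : Cost (BinaryTree K) :=
  test (Heavy α tl tr) (joinRight α k tr tl) <|
  test (Heavy α tr tl) (joinLeft α tl k tr) (mkNode tl k tr)

end WB

/-! ### Treaps -/

namespace Treap

variable {K : Type u}

/-- The priority `p` is no greater than that at the root of the tree, if there is one. Smaller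
numbers are higher priorities. -/
def LeRoot (p : ℝ) : BinaryTree (K × ℝ) → Prop
  | nil => True
  | node e _ _ => p ≤ e.2

/-- The priority at each node is no greater than the priorities of its children. -/
def Balanced : BinaryTree (K × ℝ) → Prop
  | nil => True
  | node e l r => LeRoot e.2 l ∧ LeRoot e.2 r ∧ Balanced l ∧ Balanced r

/-- `t` is a treap with key set `A` in which the priority of the key `k` is `p k`. -/
def IsTreapOn [LinearOrder K] (A : Finset K) (p : K → ℝ) (t : BinaryTree (K × ℝ)) : Prop :=
  IsBST Prod.fst t ∧ Balanced t ∧ ∀ e : K × ℝ, e ∈ inorder t ↔ e.1 ∈ A ∧ e.2 = p e.1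

/-- The entry with the highest priority among `k` and the two roots becomes the root. -/
def join (tl : BinaryTree (K × ℝ)) (k : K × ℝ) (tr : BinaryTree (K × ℝ)) :
    Cost (BinaryTree (K × ℝ)) :=
  test (LeRoot k.2 tl ∧ LeRoot k.2 tr) (mkNode tl k tr) <|
    match tl, tr with
    | nil, nil => mkNode nil k nil
    | node k₁ l₁ r₁, nil => tick <| (join r₁ k nil).bind fun t => mkNode l₁ k₁ t
    | nil, node k₂ l₂ r₂ => tick <| (join nil k l₂).bind fun t => mkNode t k₂ r₂
    | node k₁ l₁ r₁, node k₂ l₂ r₂ => tick <| tick <|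
        test (k₁.2 ≤ k₂.2)
          ((join r₁ k (node k₂ l₂ r₂)).bind fun t => mkNode l₁ k₁ t)
          ((join (node k₁ l₁ r₁) k l₂).bind fun t => mkNode t k₂ r₂)
  termination_by tl.numNodes + tr.numNodes
  decreasing_by all_goals simp; try omega

end Treap

/-! ### The bounds -/

/-- `m log₂ (n / m + 1)` for `m` and `n` the smaller and the larger of the sizes `a` and `b`. This
number is at least `1` when `m ≥ 1`; the maximum only makes it `1` (instead of `0`) for `m = 0`. -/
def workBound (a b : ℕ) : ℝ :=
  max 1 ((min a b : ℕ) * Real.logb 2 ((max a b : ℕ) / (min a b : ℕ) + 1))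

/-- `log₂ (n + 1) log₂ (m + 1)` for sizes `m` and `n`; the maximum only matters for an empty
tree. -/
def spanBound (a b : ℕ) : ℝ :=
  max 1 (Real.logb 2 ((a : ℝ) + 1) * Real.logb 2 ((b : ℝ) + 1))

end JoinTree

end

/-!
# Work and span of join-based set operations on balanced trees

## Deterministic schemes

AVL trees, red-black trees and weight-balanced trees are instances of one notion, `IsJoinScheme`:
there is a rank (half the height, the black height up to the color of the root, the logarithm of
the weight) that drops by between `δ` and `1` from a node to its children, a join takes time
linear in the difference of the ranks of its arguments, and putting higher trees in the place of
the children of a node raises the rank by no more than it does for one of them. Hence the costs of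
the joins in a split telescope, and a split is logarithmic (`IsJoinScheme.split_spec`).

The costs of the joins in a union are less obvious: the union of `t₁` with a subtree of `t₂` may
rank lower than that subtree. It loses rank at a node only when both recursive calls insert
something, and then one of them inserts at most half of `t₁`, so that the loss is `O(log |t₁|)`
(`IsJoinScheme.union_spec`). So every recursive call costs `O(log (|t₁| + 1))` for its own part
`t₁` of the first tree (`IsJoinScheme.run_step`). As the depth of the recursion is at most the
height of `t₂`, this gives the bound on the span.

For the work, put `θ = |t₁| / |t₂|`. A subtree of rank `s` of the second tree should meet about
`x = θ 2 ^ s` entries of the first one. If it meets `a`, then the concavity of the logarithm bounds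
the cost by a term that depends on `x` alone plus `O(a min(1, 1 / x))` (`logCost_le`). The former
is summed over the nodes of `t₂` by induction on ranks (`nodeSum_le_of_one_le`,
`nodeSum_le_of_le_one`). In the latter the sizes `a` add up to at most `|t₁|` on every level, so
that it remains to sum `min(1, 1 / x)` along a path, where `x` decreases geometrically
(`pathMax_le_inv`, `pathMax_le_logb`).

## Treaps

Call `a` a record for `b` if the priority of `a` is the least one among the keys from `a` to `b`.
For fixed priorities, the cost of a recursive call with the root `b` of its second treap is linear
in the numbers of records for `b` in its part of the first treap and among the keys that are
joined (`Treap.run_step`). The part of the first treap is cut off by keys of the second one with a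
smaller priority than that of `b`, whence only joint records are counted: `b` also has the least
priority among the keys of the second treap from `a` to `b` (`Treap.run_work_le`).

If there are `i` and `j` keys of the two treaps between `a` and `b`, then the two events that make
`a` a joint record for `b` have the probabilities `1 / (i + 1)` and `1 / (j + 1)`. They are not
independent, as the treaps may share nodes, but giving one half of the shared nodes to each event
makes them so, whence the probability `4 / ((i + 1) (j + 1))` at most
(`Treap.IsUniformFamily.measure_isLeast_inter_le`). The sum of these numbers over all pairs is
`O(m log (n / m + 1))` (`Treap.sum_pairWeight_le`).

The span is bounded by the product of the largest number of records for a key and the height of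
the second treap, which is itself bounded by a number of records. On one side of a key, the
records are those of a sequence of independent uniform variables; if `k` is their number in a
sequence of length `n`, then `2 ^ k` has an expectation of at most `n + 1`
(`Treap.IsUniformFamily.lintegral_two_pow_recordCount_le`). So the largest `k` is logarithmic up
to a factor with a bounded second moment, and the second moments suffice for the product
(`Treap.run_span_le_relativeWeight`).
-/

noncomputable section

namespace JoinTree

open Cost BinaryTree

/-! ### The cost monad -/

namespace Cost

variable {β : Type u} {γ : Type v}

@[simp] lemma ret_val (b : β) : (ret b).val = b := rfl
@[simp] lemma ret_work (b : β) : (ret b).work = 0 := rfl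
@[simp] lemma ret_span (b : β) : (ret b).span = 0 := rfl
@[simp] lemma tick_val (x : Cost β) : (tick x).val = x.val := rfl
@[simp] lemma tick_work (x : Cost β) : (tick x).work = x.work + 1 := rfl
@[simp] lemma tick_span (x : Cost β) : (tick x).span = x.span + 1 := rfl
@[simp] lemma bind_val (x : Cost β) (f : β → Cost γ) : (x.bind f).val = (f x.val).val := rfl
@[simp] lemma bind_work (x : Cost β) (f : β → Cost γ) :
    (x.bind f).work = x.work + (f x.val).work := rfl
@[simp] lemma bind_span (x : Cost β) (f : β → Cost γ) :
    (x.bind f).span = x.span + (f x.val).span := rfl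
@[simp] lemma par_val (x : Cost β) (y : Cost γ) : (x.par y).val = (x.val, y.val) := rfl
@[simp] lemma par_work (x : Cost β) (y : Cost γ) : (x.par y).work = x.work + y.work + 1 := rfl
@[simp] lemma par_span (x : Cost β) (y : Cost γ) :
    (x.par y).span = max x.span y.span + 1 := rfl

lemma test_pos {p : Prop} (hp : p) (x y : Cost β) : test p x y = tick x := by
  simp [test, hp]

lemma test_neg {p : Prop} (hp : ¬ p) (x y : Cost β) : test p x y = tick y := by
  simp [test, hp]

/-- A computation without parallel composition: its span does not exceed its work. -/
def Seq (x : Cost β) : Prop := x.span ≤ x.work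

lemma Seq.ret (b : β) : Seq (ret b) := le_rfl

lemma Seq.tick {x : Cost β} (hx : Seq x) : Seq (tick x) := Nat.succ_le_succ hx

lemma Seq.bind {x : Cost β} {f : β → Cost γ} (hx : Seq x) (hf : ∀ b, Seq (f b)) :
    Seq (x.bind f) := Nat.add_le_add hx (hf _)

lemma Seq.test {p : Prop} {x y : Cost β} (hx : Seq x) (hy : Seq y) : Seq (test p x y) := by
  by_cases hp : p
  · rw [test_pos hp]; exact hx.tick
  · rw [test_neg hp]; exact hy.tick

end Cost

section Basic

variable {E : Type u} {K : Type v}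

lemma Seq.mkNode (l : BinaryTree E) (e : E) (r : BinaryTree E) : Seq (mkNode l e r) :=
  (Seq.ret _).tick

lemma Seq.rotateLeft (t : BinaryTree E) : Seq (rotateLeft t) := by
  unfold JoinTree.rotateLeft; split <;> exact (Seq.ret _).tick

lemma Seq.rotateRight (t : BinaryTree E) : Seq (rotateRight t) := by
  unfold JoinTree.rotateRight; split <;> exact (Seq.ret _).tick

@[simp] lemma mkNode_val (l : BinaryTree E) (e : E) (r : BinaryTree E) :
    (mkNode l e r).val = node e l r := rfl

@[simp] lemma mkNode_work (l : BinaryTree E) (e : E) (r : BinaryTree E) :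
    (mkNode l e r).work = 1 := rfl

@[simp] lemma rotateLeft_work (t : BinaryTree E) : (rotateLeft t).work = 1 := by
  unfold rotateLeft; split <;> rfl

@[simp] lemma rotateRight_work (t : BinaryTree E) : (rotateRight t).work = 1 := by
  unfold rotateRight; split <;> rfl

variable [LinearOrder K] {key : E → K}
  {join : BinaryTree E → E → BinaryTree E → Cost (BinaryTree E)}

lemma seq_split (hj : ∀ l e r, Seq (join l e r)) (k : K) (t : BinaryTree E) :
    Seq (split key join k t) := by
  induction t with
  | nil => exact (Seq.ret _).tick
  | node m l r ihl ihr =>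
    exact ((Seq.ret _).test ((ihl.bind fun _ => (hj _ _ _).bind fun _ => Seq.ret _).test
      (ihr.bind fun _ => (hj _ _ _).bind fun _ => Seq.ret _))).tick.tick

lemma seq_splitLast (hj : ∀ l e r, Seq (join l e r)) (e : E) (l r : BinaryTree E) :
    Seq (splitLast join e l r) := by
  induction r generalizing e l with
  | nil => exact (Seq.ret _).tick.tick
  | node m l' r' _ ih =>
    exact ((ih m l').bind fun _ => (hj _ _ _).bind fun _ => Seq.ret _).tick.tick

lemma seq_join2 (hj : ∀ l e r, Seq (join l e r)) (l r : BinaryTree E) :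
    Seq (join2 join l r) := by
  cases l with
  | nil => exact (Seq.ret _).tick
  | node e a b => exact ((seq_splitLast hj e a b).bind fun _ => hj _ _ _).tick

lemma split_nil (k : K) : split key join k nil = tick (ret (nil, false, nil)) := rfl

lemma split_eq {k : K} {m : E} (h : k = key m) (l r : BinaryTree E) :
    split key join k (node m l r) = tick (tick (tick (ret (l, true, r)))) := by
  rw [split, test_pos h]

lemma split_lt {k : K} {m : E} (h : k < key m) (l r : BinaryTree E) :
    split key join k (node m l r) = tick (tick (tick (tick
      ((split key join k l).bind fun s =>
        (join s.2.2 m r).bind fun t => ret (s.1, s.2.1, t))))) := by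
  rw [split, test_neg h.ne, test_pos h]

lemma split_gt {k : K} {m : E} (h : key m < k) (l r : BinaryTree E) :
    split key join k (node m l r) = tick (tick (tick (tick
      ((split key join k r).bind fun s =>
        (join l m s.1).bind fun t => ret (t, s.2.1, s.2.2))))) := by
  rw [split, test_neg h.ne', test_neg h.not_gt]

end Basic

/-! ### Balancing schemes with a rank function -/

/-- A balancing scheme `Bal` with a rank function `rk` for which `join` behaves well. Ranks drop by
at least `δ` and at most `1` from a node to its children, a join costs at most `c` plus `c` times
the difference in rank, its result ranks at least as high as its parts, and if the parts rank by at
most `x` higher than the children of a balanced node, then the result ranks by at most `x` higher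
than that node. -/
structure IsJoinScheme {E : Type u} (join : BinaryTree E → E → BinaryTree E → Cost (BinaryTree E))
    (Bal : BinaryTree E → Prop) (rk : BinaryTree E → ℝ) (δ c : ℝ) : Prop where
  δ_pos : 0 < δ
  c_nonneg : 0 ≤ c
  bal_nil : Bal nil
  bal_left : ∀ {e l r}, Bal (node e l r) → Bal l
  bal_right : ∀ {e l r}, Bal (node e l r) → Bal r
  rk_nil : rk nil = 0
  rk_left_ge : ∀ {e l r}, Bal (node e l r) → rk (node e l r) - 1 ≤ rk l
  rk_right_ge : ∀ {e l r}, Bal (node e l r) → rk (node e l r) - 1 ≤ rk r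
  rk_left_le : ∀ {e l r}, Bal (node e l r) → rk l ≤ rk (node e l r) - δ
  rk_right_le : ∀ {e l r}, Bal (node e l r) → rk r ≤ rk (node e l r) - δ
  bal_join : ∀ {e l r}, Bal l → Bal r → Bal (join l e r).val
  numNodes_join : ∀ {e l r}, Bal l → Bal r →
    (join l e r).val.numNodes = l.numNodes + r.numNodes + 1
  le_rk_join_left : ∀ {e l r}, Bal l → Bal r → rk l ≤ rk (join l e r).val
  le_rk_join_right : ∀ {e l r}, Bal l → Bal r → rk r ≤ rk (join l e r).val
  rk_join_le : ∀ {e l r e' l' r'} {x : ℝ}, Bal (node e l r) → Bal l' → Bal r' → 0 ≤ x →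
    rk l' ≤ rk l + x → rk r' ≤ rk r + x → rk (join l' e' r').val ≤ rk (node e l r) + x
  work_join : ∀ {e l r}, Bal l → Bal r → ((join l e r).work : ℝ) ≤ c * (1 + |rk l - rk r|)
  seq_join : ∀ l e r, Seq (join l e r)

/-- `1 + log₂ (a + 1)`, the order of the cost of one recursive call of a set operation whose first
tree has size `a`. -/
def logCost (a : ℕ) : ℝ := 1 + Real.logb 2 ((a : ℝ) + 1)

lemma logb_succ_nonneg (a : ℕ) : 0 ≤ Real.logb 2 ((a : ℝ) + 1) :=
  Real.logb_nonneg one_lt_two (by linarith [(Nat.cast_nonneg a : (0 : ℝ) ≤ a)])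

lemma logb_succ_mono {a b : ℕ} (h : a ≤ b) :
    Real.logb 2 ((a : ℝ) + 1) ≤ Real.logb 2 ((b : ℝ) + 1) :=
  Real.logb_le_logb_of_le one_lt_two (by positivity)
    (by have : (a : ℝ) ≤ b := by exact_mod_cast h
        linarith)

lemma one_le_logCost (a : ℕ) : 1 ≤ logCost a := by
  have := logb_succ_nonneg a; unfold logCost; linarith

lemma logCost_mono {a b : ℕ} (h : a ≤ b) : logCost a ≤ logCost b := by
  have := logb_succ_mono h; unfold logCost; linarith

namespace IsJoinScheme

variable {E : Type u} {K : Type v}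
  {join : BinaryTree E → E → BinaryTree E → Cost (BinaryTree E)} {Bal : BinaryTree E → Prop}
  {rk : BinaryTree E → ℝ} {δ c : ℝ}

lemma rk_nonneg (h : IsJoinScheme join Bal rk δ c) {t : BinaryTree E} (ht : Bal t) : 0 ≤ rk t := by
  induction t with
  | nil => exact h.rk_nil.ge
  | node e l r ihl _ =>
    have := h.rk_left_le ht
    have := ihl (h.bal_left ht)
    linarith [h.δ_pos]

lemma height_le (h : IsJoinScheme join Bal rk δ c) {t : BinaryTree E} (ht : Bal t) :
    δ * t.height ≤ rk t := by
  induction t with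
  | nil => simp [h.rk_nil]
  | node e l r ihl ihr =>
    have h1 := h.rk_left_le ht
    have h2 := h.rk_right_le ht
    have h3 := ihl (h.bal_left ht)
    have h4 := ihr (h.bal_right ht)
    simp only [height]
    rcases max_cases l.height r.height with ⟨h5, _⟩ | ⟨h5, _⟩ <;> rw [h5] <;> push_cast <;> linarith

lemma two_rpow_rk_le (h : IsJoinScheme join Bal rk δ c) {t : BinaryTree E} (ht : Bal t) :
    (2 : ℝ) ^ rk t ≤ t.numLeaves := by
  induction t with
  | nil => simp [h.rk_nil]
  | node e l r ihl ihr =>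
    have h1 := Real.rpow_le_rpow_of_exponent_le one_le_two (h.rk_left_ge ht)
    have h2 := Real.rpow_le_rpow_of_exponent_le one_le_two (h.rk_right_ge ht)
    have h3 := ihl (h.bal_left ht)
    have h4 := ihr (h.bal_right ht)
    rw [Real.rpow_sub_one two_ne_zero] at h1 h2
    simp only [numLeaves]
    push_cast
    linarith

lemma rk_le_logb (h : IsJoinScheme join Bal rk δ c) {t : BinaryTree E} (ht : Bal t) :
    rk t ≤ Real.logb 2 ((t.numNodes : ℝ) + 1) := by
  have h1 := h.two_rpow_rk_le ht
  rw [numLeaves_eq_numNodes_succ] at h1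
  rw [Real.le_logb_iff_rpow_le one_lt_two (by positivity)]
  exact_mod_cast h1

lemma rk_le_logb_of_le (h : IsJoinScheme join Bal rk δ c) {t : BinaryTree E} (ht : Bal t) {a : ℕ}
    (ha : t.numNodes ≤ a) : rk t ≤ Real.logb 2 ((a : ℝ) + 1) :=
  (h.rk_le_logb ht).trans (logb_succ_mono ha)

lemma height_le_logb (h : IsJoinScheme join Bal rk δ c) {t : BinaryTree E} (ht : Bal t) :
    (t.height : ℝ) ≤ δ⁻¹ * Real.logb 2 ((t.numNodes : ℝ) + 1) := by
  rw [inv_mul_eq_div, le_div_iff₀ h.δ_pos, mul_comm]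
  exact (h.height_le ht).trans (h.rk_le_logb ht)

/-- The parts of a split rank no higher than the whole. The joins on the way back up the search
path cost a constant for each level, plus what telescopes to the rank of the two results. -/
lemma split_spec [LinearOrder K] (h : IsJoinScheme join Bal rk δ c) (key : E → K) (k : K)
    {t : BinaryTree E} (ht : Bal t) :
    let s := split key join k t
    Bal s.val.1 ∧ Bal s.val.2.2 ∧ rk s.val.1 ≤ rk t ∧ rk s.val.2.2 ≤ rk t ∧
      s.val.1.numNodes + s.val.2.2.numNodes + s.val.2.1.toNat = t.numNodes ∧
      (s.work : ℝ) ≤ (4 + 2 * c) * t.height + c * (rk s.val.1 + rk s.val.2.2) + 4 := by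
  have hc := h.c_nonneg
  induction t with
  | nil =>
    simp only [split_nil, tick_val, ret_val, tick_work, ret_work, h.rk_nil]
    refine ⟨h.bal_nil, h.bal_nil, le_rfl, le_rfl, by simp, by norm_num⟩
  | node m l r ihl ihr =>
    have hl := h.bal_left ht
    have hr := h.bal_right ht
    have hl1 := h.rk_left_le ht
    have hr1 := h.rk_right_le ht
    have hl2 := h.rk_left_ge ht
    have hr2 := h.rk_right_ge ht
    have hδ := h.δ_pos
    have hhl : (l.height : ℝ) + 1 ≤ (node m l r).height := by simp
    have hhr : (r.height : ℝ) + 1 ≤ (node m l r).height := by simp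
    rcases lt_trichotomy k (key m) with hk | hk | hk
    · obtain ⟨i1, i2, i3, i4, i5, i6⟩ := ihl hl
      rw [split_lt hk]
      simp only [tick_val, bind_val, ret_val, tick_work, bind_work, ret_work]
      set s := split key join k l
      have j1 := h.bal_join (e := m) i2 hr
      have j2 := h.numNodes_join (e := m) i2 hr
      have j3 := h.le_rk_join_left (e := m) i2 hr
      have j4 := h.le_rk_join_right (e := m) i2 hr
      have j5 := h.rk_join_le (e' := m) (x := 0) ht i2 hr le_rfl (by linarith) (by linarith)
      have j6 := h.work_join (e := m) i2 hr
      have j7 : |rk s.val.2.2 - rk r| ≤ rk (join s.val.2.2 m r).val - rk s.val.2.2 + 1 := by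
        rw [abs_le]; constructor <;> linarith
      refine ⟨i1, j1, by linarith, by linarith, ?_, ?_⟩
      · rw [j2]; simp only [numNodes]; omega
      · push_cast
        have := mul_le_mul_of_nonneg_left j7 hc
        have := mul_le_mul_of_nonneg_left hhl (by linarith : 0 ≤ 4 + 2 * c)
        linarith
    · rw [split_eq hk]
      simp only [tick_val, ret_val, tick_work, ret_work]
      refine ⟨hl, hr, by linarith, by linarith, by simp, ?_⟩
      have := h.rk_nonneg hl
      have := h.rk_nonneg hr
      push_cast
      have : 0 ≤ c * (rk l + rk r) := by positivity
      have : 0 ≤ (4 + 2 * c) * ((node m l r).height : ℝ) := by positivity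
      linarith
    · obtain ⟨i1, i2, i3, i4, i5, i6⟩ := ihr hr
      rw [split_gt hk]
      simp only [tick_val, bind_val, ret_val, tick_work, bind_work, ret_work]
      set s := split key join k r
      have j1 := h.bal_join (e := m) hl i1
      have j2 := h.numNodes_join (e := m) hl i1
      have j3 := h.le_rk_join_left (e := m) hl i1
      have j4 := h.le_rk_join_right (e := m) hl i1
      have j5 := h.rk_join_le (e' := m) (x := 0) ht hl i1 le_rfl (by linarith) (by linarith)
      have j6 := h.work_join (e := m) hl i1
      have j7 : |rk l - rk s.val.1| ≤ rk (join l m s.val.1).val - rk s.val.1 + 1 := by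
        rw [abs_le]; constructor <;> linarith
      refine ⟨j1, i2, by linarith, by linarith, ?_, ?_⟩
      · rw [j2]; simp only [numNodes]; omega
      · push_cast
        have := mul_le_mul_of_nonneg_left j7 hc
        have := mul_le_mul_of_nonneg_left hhr (by linarith : 0 ≤ 4 + 2 * c)
        linarith

/-- As in a split, the costs of the joins telescope. -/
lemma splitLast_spec (h : IsJoinScheme join Bal rk δ c) {e : E} {l r : BinaryTree E}
    (ht : Bal (node e l r)) :
    let s := splitLast join e l r
    Bal s.val.1 ∧ rk s.val.1 ≤ rk (node e l r) ∧
      s.val.1.numNodes + 1 = (node e l r).numNodes ∧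
      (s.work : ℝ) ≤ (4 + 2 * c) * (node e l r).height + c * rk s.val.1 := by
  have hc := h.c_nonneg
  induction r generalizing e l with
  | nil =>
    have h1 := h.rk_nonneg (h.bal_left ht)
    have h2 := h.rk_left_le ht
    have h3 : (1 : ℝ) ≤ (node e l nil).height := by simp
    simp only [splitLast, tick_val, ret_val, tick_work, ret_work]
    refine ⟨h.bal_left ht, by linarith [h.δ_pos], by simp, ?_⟩
    have : 0 ≤ c * rk l := by positivity
    have := mul_le_mul_of_nonneg_left h3 (by linarith : 0 ≤ 4 + 2 * c)
    push_cast
    linarith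
  | node e' l' r' _ ih =>
    have hl := h.bal_left ht
    have hr := h.bal_right ht
    have hl1 := h.rk_left_le ht
    have hr1 := h.rk_right_le ht
    have hl2 := h.rk_left_ge ht
    have hr2 := h.rk_right_ge ht
    have hδ := h.δ_pos
    have hhr : ((node e' l' r').height : ℝ) + 1 ≤ (node e l (node e' l' r')).height := by
      rw [height.eq_2 e]; push_cast; gcongr; exact le_max_right _ _
    obtain ⟨i1, i2, i3, i4⟩ := ih hr
    simp only [splitLast, tick_val, bind_val, ret_val, tick_work, bind_work, ret_work]
    set s := splitLast join e' l' r'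
    have j1 := h.bal_join (e := e) hl i1
    have j2 := h.numNodes_join (e := e) hl i1
    have j3 := h.le_rk_join_left (e := e) hl i1
    have j4 := h.le_rk_join_right (e := e) hl i1
    have j5 := h.rk_join_le (e' := e) (x := 0) ht hl i1 le_rfl (by linarith) (by linarith)
    have j6 := h.work_join (e := e) hl i1
    have j7 : |rk l - rk s.val.1| ≤ rk (join l e s.val.1).val - rk s.val.1 + 1 := by
      rw [abs_le]; constructor <;> linarith
    refine ⟨j1, by linarith, ?_, ?_⟩
    · rw [j2]; simp only [numNodes] at i3 ⊢; omega
    · have := mul_le_mul_of_nonneg_left j7 hc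
      have := mul_le_mul_of_nonneg_left hhr (by linarith : 0 ≤ 4 + 2 * c)
      push_cast
      linarith

/-- The factor in the cost bounds of the recursive calls. -/
def callFactor (δ c : ℝ) : ℝ := (4 + 2 * c) * (2 + δ⁻¹)

lemma four_le_callFactor (h : IsJoinScheme join Bal rk δ c) : 4 + 2 * c ≤ callFactor δ c := by
  have := h.δ_pos
  have := h.c_nonneg
  exact le_mul_of_one_le_right (by positivity) (by linarith [inv_pos.2 h.δ_pos])

lemma split_work_le [LinearOrder K] (h : IsJoinScheme join Bal rk δ c) (key : E → K) (k : K)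
    {t : BinaryTree E} (ht : Bal t) :
    ((split key join k t).work : ℝ) ≤ callFactor δ c * logCost t.numNodes := by
  obtain ⟨-, -, h3, h4, -, h6⟩ := h.split_spec key k ht
  have h7 := h.rk_le_logb ht
  have h8 := h.height_le_logb ht
  have h9 := logb_succ_nonneg t.numNodes
  have hc := h.c_nonneg
  have hδ := inv_pos.2 h.δ_pos
  unfold callFactor logCost
  set L := Real.logb 2 ((t.numNodes : ℝ) + 1)
  have a1 := mul_le_mul_of_nonneg_left h8 (by linarith : 0 ≤ 4 + 2 * c)
  have a2 := mul_le_mul_of_nonneg_left (add_le_add (h3.trans h7) (h4.trans h7)) hc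
  have a3 : 0 ≤ (4 + 2 * c) * (1 + δ⁻¹) := by positivity
  have a4 : 0 ≤ (4 + c) * L := by positivity
  nlinarith

lemma splitLast_work_le (h : IsJoinScheme join Bal rk δ c) {e : E} {l r : BinaryTree E}
    (ht : Bal (node e l r)) {a : ℕ} (ha : (node e l r).numNodes ≤ a) :
    ((splitLast join e l r).work : ℝ) ≤ callFactor δ c * logCost a := by
  obtain ⟨-, h2, -, h4⟩ := h.splitLast_spec ht
  have h7 := h.rk_le_logb_of_le ht ha
  have h8 := h.height_le_logb ht
  have h9 := logb_succ_nonneg a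
  have h10 := logb_succ_mono ha
  have hc := h.c_nonneg
  have hδ := inv_pos.2 h.δ_pos
  unfold callFactor logCost
  set L := Real.logb 2 ((a : ℝ) + 1)
  have a1 := mul_le_mul_of_nonneg_left (h8.trans (mul_le_mul_of_nonneg_left h10 hδ.le))
    (by linarith : 0 ≤ 4 + 2 * c)
  have a2 := mul_le_mul_of_nonneg_left (h2.trans h7) hc
  have a3 : 0 ≤ (4 + 2 * c) * (2 + δ⁻¹) := by positivity
  have a4 : 0 ≤ (8 + 3 * c) * L := by positivity
  nlinarith

lemma join2_spec (h : IsJoinScheme join Bal rk δ c) {l r : BinaryTree E} (hl : Bal l) (hr : Bal r)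
    {a : ℕ} (ha : l.numNodes + r.numNodes ≤ a) :
    Bal (join2 join l r).val ∧ (join2 join l r).val.numNodes = l.numNodes + r.numNodes ∧
      ((join2 join l r).work : ℝ) ≤ 2 * callFactor δ c * logCost a := by
  have hc := h.c_nonneg
  have h4 := h.four_le_callFactor
  have h9 := logb_succ_nonneg a
  have h1 := one_le_logCost a
  cases l with
  | nil =>
    refine ⟨hr, by simp [join2], ?_⟩
    simp only [join2, tick_work, ret_work]
    push_cast
    nlinarith
  | node e l₁ r₁ =>
    obtain ⟨i1, i2, i3, -⟩ := h.splitLast_spec hl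
    have i4 := h.splitLast_work_le hl (a := a) (by omega)
    simp only [join2, tick_val, bind_val, tick_work, bind_work]
    set s := splitLast join e l₁ r₁
    have j1 := h.bal_join (e := s.val.2) i1 hr
    have j2 := h.numNodes_join (e := s.val.2) i1 hr
    have j6 := h.work_join (e := s.val.2) i1 hr
    have j7 := h.rk_le_logb_of_le i1 (a := a) (by omega)
    have j8 := h.rk_le_logb_of_le hr (a := a) (by omega)
    have j9 := h.rk_nonneg i1
    have j10 := h.rk_nonneg hr
    have j11 : |rk s.val.1 - rk r| ≤ Real.logb 2 ((a : ℝ) + 1) := by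
      rw [abs_le]; constructor <;> linarith
    refine ⟨j1, by omega, ?_⟩
    push_cast
    have := mul_le_mul_of_nonneg_left j11 hc
    have : c * (1 + Real.logb 2 ((a : ℝ) + 1)) = c * logCost a := rfl
    nlinarith

end IsJoinScheme

/-! ### One recursive call of a set operation -/

/-- By how much the union with a tree of size `a` can lower the rank. -/
def rankDeficit (a : ℕ) : ℝ := if a = 0 then 0 else 1 + Real.logb 2 a

lemma rankDeficit_le_logCost (a : ℕ) : rankDeficit a ≤ logCost a := by
  have h := one_le_logCost a
  unfold rankDeficit
  split_ifs with ha
  · linarith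
  · have : (0 : ℝ) < a := by exact_mod_cast Nat.pos_of_ne_zero ha
    have := Real.logb_le_logb_of_le one_lt_two this (by linarith : (a : ℝ) ≤ a + 1)
    unfold logCost
    linarith

lemma rankDeficit_add_one_le {a b : ℕ} (ha : a ≠ 0) (h : 2 * b ≤ a) :
    rankDeficit b + 1 ≤ rankDeficit a := by
  have h1 : (1 : ℝ) ≤ a := by exact_mod_cast Nat.pos_of_ne_zero ha
  unfold rankDeficit
  rw [if_neg ha]
  split_ifs with hb
  · linarith [Real.logb_nonneg one_lt_two h1]
  · have h2 : (0 : ℝ) < b := by exact_mod_cast Nat.pos_of_ne_zero hb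
    have h3 : (2 : ℝ) * b ≤ a := by exact_mod_cast h
    have h4 := Real.logb_le_logb_of_le one_lt_two (by positivity) h3
    rw [Real.logb_mul two_ne_zero h2.ne', Real.logb_self_eq_one one_lt_two] at h4
    linarith

namespace IsJoinScheme

variable {E : Type u} {K : Type v} [LinearOrder K]
  {join : BinaryTree E → E → BinaryTree E → Cost (BinaryTree E)} {Bal : BinaryTree E → Prop}
  {rk : BinaryTree E → ℝ} {δ c : ℝ}

/-- The union ranks at most by `rk t₁` higher than `t₂`. It may rank lower than `t₂`, although its
keys are a superset, but only where both recursive calls have changed their part of `t₂`; the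
smaller of the two parts of `t₁` has at most half of its size, so that the loss is logarithmic. -/
lemma union_spec (h : IsJoinScheme join Bal rk δ c) (key : E → K) {t₁ t₂ : BinaryTree E}
    (h₁ : Bal t₁) (h₂ : Bal t₂) :
    Bal (union key join t₁ t₂).val ∧ rk (union key join t₁ t₂).val ≤ rk t₂ + rk t₁ ∧
      rk t₂ - rankDeficit t₁.numNodes ≤ rk (union key join t₁ t₂).val := by
  induction t₂ generalizing t₁ with
  | nil =>
    cases t₁ with
    | nil => simp [union, h₁, rankDeficit, h.rk_nil]
    | node e l r =>
      have h3 := h.rk_nonneg h₁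
      refine ⟨h₁, by simp [union, h.rk_nil], ?_⟩
      simp only [union, tick_val, ret_val, h.rk_nil]
      have : 0 ≤ rankDeficit (node e l r).numNodes := by
        refine le_trans ?_ (rankDeficit_add_one_le (b := 0) (by simp) (by simp))
        simp [rankDeficit]
      linarith
  | node k₂ l₂ r₂ ihl ihr =>
    cases t₁ with
    | nil => simp [union, h₂, rankDeficit, h.rk_nil]
    | node e l r =>
      obtain ⟨i1, i2, i3, i4, i5, -⟩ := h.split_spec key (key k₂) h₁
      simp only [union, tick_val, bind_val, par_val]
      set s := split key join (key k₂) (node e l r)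
      obtain ⟨l1, l2, l3⟩ := ihl i1 (h.bal_left h₂)
      obtain ⟨r1, r2, r3⟩ := ihr i2 (h.bal_right h₂)
      have h3 := h.rk_nonneg h₁
      have h4 := h.rk_left_ge h₂
      have h5 := h.rk_right_ge h₂
      have j3 := h.le_rk_join_left (e := k₂) l1 r1
      have j4 := h.le_rk_join_right (e := k₂) l1 r1
      refine ⟨h.bal_join l1 r1, h.rk_join_le h₂ l1 r1 h3 (by linarith) (by linarith), ?_⟩
      rcases le_total s.val.1.numNodes s.val.2.2.numNodes with hle | hle
      · have := rankDeficit_add_one_le (a := (node e l r).numNodes) (b := s.val.1.numNodes)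
          (by simp) (by omega)
        linarith
      · have := rankDeficit_add_one_le (a := (node e l r).numNodes) (b := s.val.2.2.numNodes)
          (by simp) (by omega)
        linarith

lemma intersect_spec (h : IsJoinScheme join Bal rk δ c) (key : E → K) {t₁ t₂ : BinaryTree E}
    (h₁ : Bal t₁) (h₂ : Bal t₂) :
    Bal (intersect key join t₁ t₂).val ∧
      (intersect key join t₁ t₂).val.numNodes ≤ t₁.numNodes := by
  induction t₂ generalizing t₁ with
  | nil => cases t₁ <;> exact ⟨h.bal_nil, by simp [intersect]⟩
  | node k₂ l₂ r₂ ihl ihr =>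
    cases t₁ with
    | nil => exact ⟨h.bal_nil, by simp [intersect]⟩
    | node e l r =>
      obtain ⟨i1, i2, -, -, i5, -⟩ := h.split_spec key (key k₂) h₁
      simp only [intersect, tick_val, bind_val, par_val]
      set s := split key join (key k₂) (node e l r)
      obtain ⟨l1, l2⟩ := ihl i1 (h.bal_left h₂)
      obtain ⟨r1, r2⟩ := ihr i2 (h.bal_right h₂)
      by_cases hb : s.val.2.1 = true
      · rw [test_pos hb, tick_val, h.numNodes_join l1 r1]
        rw [hb, Bool.toNat_true] at i5
        exact ⟨h.bal_join l1 r1, by omega⟩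
      · obtain ⟨j1, j2, -⟩ := h.join2_spec l1 r1 le_rfl
        rw [test_neg hb, tick_val, j2]
        exact ⟨j1, by omega⟩

lemma difference_spec (h : IsJoinScheme join Bal rk δ c) (key : E → K) {t₁ t₂ : BinaryTree E}
    (h₁ : Bal t₁) (h₂ : Bal t₂) :
    Bal (difference key join t₁ t₂).val ∧
      (difference key join t₁ t₂).val.numNodes ≤ t₁.numNodes := by
  induction t₂ generalizing t₁ with
  | nil =>
    cases t₁ with
    | nil => exact ⟨h.bal_nil, by simp [difference]⟩
    | node e l r => exact ⟨h₁, by simp [difference]⟩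
  | node k₂ l₂ r₂ ihl ihr =>
    cases t₁ with
    | nil => exact ⟨h.bal_nil, by simp [difference]⟩
    | node e l r =>
      obtain ⟨i1, i2, -, -, i5, -⟩ := h.split_spec key (key k₂) h₁
      simp only [difference, tick_val, bind_val, par_val]
      set s := split key join (key k₂) (node e l r)
      obtain ⟨l1, l2⟩ := ihl i1 (h.bal_left h₂)
      obtain ⟨r1, r2⟩ := ihr i2 (h.bal_right h₂)
      obtain ⟨j1, j2, -⟩ := h.join2_spec l1 r1 le_rfl
      rw [j2]
      exact ⟨j1, by omega⟩

lemma run_nil_left (key : E → K) (op : SetOp) (t : BinaryTree E) :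
    (op.run key join nil t).work = 1 ∧ (op.run key join nil t).span = 1 := by
  cases op <;> cases t <;> exact ⟨rfl, rfl⟩

lemma run_nil_right (key : E → K) (op : SetOp) (t : BinaryTree E) :
    (op.run key join t nil).work ≤ 2 ∧ (op.run key join t nil).span ≤ 2 := by
  cases op <;> cases t <;> constructor <;>
    simp [SetOp.run, union, intersect, difference]

lemma join_work_le (h : IsJoinScheme join Bal rk δ c) {l r : BinaryTree E} {e : E} (hl : Bal l)
    (hr : Bal r) {a : ℕ} (h1 : rk l - rk r ≤ 2 * logCost a) (h2 : rk r - rk l ≤ 2 * logCost a) :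
    ((join l e r).work : ℝ) ≤ 2 * callFactor δ c * logCost a := by
  have j1 := h.work_join (e := e) hl hr
  have j2 : |rk l - rk r| ≤ 2 * logCost a := by rw [abs_le]; constructor <;> linarith
  have j3 := one_le_logCost a
  have j4 := h.four_le_callFactor
  have j5 := h.c_nonneg
  have := mul_le_mul_of_nonneg_left j2 j5
  nlinarith

/-- A call of a set operation costs `O(log |t₁|)`, apart from the two recursive calls. -/
lemma run_step (h : IsJoinScheme join Bal rk δ c) (key : E → K) (op : SetOp) {e k₂ : E}
    {l r l₂ r₂ : BinaryTree E} (h₁ : Bal (node e l r)) (h₂ : Bal (node k₂ l₂ r₂)) :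
    ∃ u₁ u₂, Bal u₁ ∧ Bal u₂ ∧ u₁.numNodes + u₂.numNodes ≤ (node e l r).numNodes ∧
      ((op.run key join (node e l r) (node k₂ l₂ r₂)).work : ℝ) ≤
        5 * callFactor δ c * logCost (node e l r).numNodes +
          ((op.run key join u₁ l₂).work + (op.run key join u₂ r₂).work) ∧
      ((op.run key join (node e l r) (node k₂ l₂ r₂)).span : ℝ) ≤
        5 * callFactor δ c * logCost (node e l r).numNodes +
          max ((op.run key join u₁ l₂).span : ℝ) (op.run key join u₂ r₂).span := by
  obtain ⟨i1, i2, i3, i4, i5, -⟩ := h.split_spec key (key k₂) h₁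
  have i6 := h.split_work_le key (key k₂) h₁
  have i7 : ((split key join (key k₂) (node e l r)).span : ℝ) ≤
      (split key join (key k₂) (node e l r)).work := Nat.cast_le.2 (seq_split h.seq_join _ _)
  have hK := h.four_le_callFactor
  have hc := h.c_nonneg
  have h3 := one_le_logCost (node e l r).numNodes
  have hb := h.bal_left h₂
  have hb' := h.bal_right h₂
  have hKf : 4 ≤ callFactor δ c * logCost (node e l r).numNodes := by nlinarith
  refine ⟨_, _, i1, i2, by omega, ?_⟩
  set a := (node e l r).numNodes
  set s := split key join (key k₂) (node e l r)
  have hsize : ∀ {t : BinaryTree E}, Bal t → t.numNodes ≤ a → 0 ≤ rk t ∧ rk t ≤ logCost a := by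
    intro t ht hta
    refine ⟨h.rk_nonneg ht, ?_⟩
    have := h.rk_le_logb_of_le ht hta
    unfold logCost
    linarith
  cases op with
  | union =>
    obtain ⟨l1, l2, l3⟩ := h.union_spec key i1 hb
    obtain ⟨r1, r2, r3⟩ := h.union_spec key i2 hb'
    simp only [SetOp.run, union, tick_work, bind_work, par_work, tick_span, bind_span, par_span,
      par_val]
    change _ ∧ _
    have c1 := h.rk_left_le h₂
    have c2 := h.rk_left_ge h₂
    have c3 := h.rk_right_le h₂
    have c4 := h.rk_right_ge h₂
    have hδ := h.δ_pos
    have d1 := (rankDeficit_le_logCost s.val.1.numNodes).trans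
      (logCost_mono (by omega : s.val.1.numNodes ≤ a))
    have d2 := (rankDeficit_le_logCost s.val.2.2.numNodes).trans
      (logCost_mono (by omega : s.val.2.2.numNodes ≤ a))
    have d3 := h.rk_le_logb_of_le i1 (a := a) (by omega)
    have d4 := h.rk_le_logb_of_le i2 (a := a) (by omega)
    have d5 : logCost a = 1 + Real.logb 2 ((a : ℝ) + 1) := rfl
    have j := h.join_work_le (e := k₂) (a := a) l1 r1 (by linarith) (by linarith)
    have j' : ((join (union key join s.val.1 l₂).val k₂ (union key join s.val.2.2 r₂).val).span :
        ℝ) ≤ (join (union key join s.val.1 l₂).val k₂ (union key join s.val.2.2 r₂).val).work := by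
      exact_mod_cast h.seq_join _ _ _
    push_cast
    constructor <;> linarith
  | intersect =>
    obtain ⟨l1, l2⟩ := h.intersect_spec key i1 hb
    obtain ⟨r1, r2⟩ := h.intersect_spec key i2 hb'
    simp only [SetOp.run, intersect, tick_work, bind_work, par_work, tick_span, bind_span,
      par_span, par_val]
    have d1 := hsize l1 (by omega)
    have d2 := hsize r1 (by omega)
    have j := h.join_work_le (e := k₂) (a := a) l1 r1 (by linarith) (by linarith)
    have j' : ((join (intersect key join s.val.1 l₂).val k₂
        (intersect key join s.val.2.2 r₂).val).span : ℝ) ≤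
        (join (intersect key join s.val.1 l₂).val k₂
          (intersect key join s.val.2.2 r₂).val).work := by
      exact_mod_cast h.seq_join _ _ _
    obtain ⟨-, -, q⟩ := h.join2_spec l1 r1 (a := a) (by omega)
    have q' : ((join2 join (intersect key join s.val.1 l₂).val
        (intersect key join s.val.2.2 r₂).val).span : ℝ) ≤
        (join2 join (intersect key join s.val.1 l₂).val
          (intersect key join s.val.2.2 r₂).val).work := by
      exact_mod_cast seq_join2 h.seq_join _ _
    by_cases hb : s.val.2.1 = true
    · rw [test_pos hb]
      simp only [tick_work, tick_span]
      push_cast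
      constructor <;> linarith
    · rw [test_neg hb]
      simp only [tick_work, tick_span]
      push_cast
      constructor <;> linarith
  | difference =>
    obtain ⟨l1, l2⟩ := h.difference_spec key i1 hb
    obtain ⟨r1, r2⟩ := h.difference_spec key i2 hb'
    simp only [SetOp.run, difference, tick_work, bind_work, par_work, tick_span, bind_span,
      par_span, par_val]
    obtain ⟨-, -, q⟩ := h.join2_spec l1 r1 (a := a) (by omega)
    have q' : ((join2 join (difference key join s.val.1 l₂).val
        (difference key join s.val.2.2 r₂).val).span : ℝ) ≤
        (join2 join (difference key join s.val.1 l₂).val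
          (difference key join s.val.2.2 r₂).val).work := by
      exact_mod_cast seq_join2 h.seq_join _ _
    push_cast
    constructor <;> linarith

/-! ### Span and work of the set operations on balanced trees -/

lemma run_span_le_height (h : IsJoinScheme join Bal rk δ c) (key : E → K) (op : SetOp)
    {t₁ t₂ : BinaryTree E} (h₁ : Bal t₁) (h₂ : Bal t₂) {a : ℕ} (ha : t₁.numNodes ≤ a) :
    ((op.run key join t₁ t₂).span : ℝ) ≤
      5 * callFactor δ c * logCost a * t₂.height + 2 := by
  have hK : 0 ≤ callFactor δ c := by linarith [h.four_le_callFactor, h.c_nonneg]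
  have hf := one_le_logCost a
  induction t₂ generalizing t₁ with
  | nil =>
    have : ((op.run key join t₁ nil).span : ℝ) ≤ 2 := by exact_mod_cast (run_nil_right key op t₁).2
    simpa using this
  | node k₂ l₂ r₂ ihl ihr =>
    cases t₁ with
    | nil =>
      rw [(run_nil_left key op _).2]
      have : 0 ≤ 5 * callFactor δ c * logCost a * ((node k₂ l₂ r₂).height : ℝ) := by positivity
      push_cast at this ⊢
      linarith
    | node e l r =>
      obtain ⟨u₁, u₂, b1, b2, b3, -, b5⟩ := h.run_step key op h₁ h₂
      have i1 := ihl b1 (h.bal_left h₂) (by omega)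
      have i2 := ihr b2 (h.bal_right h₂) (by omega)
      have hC : 0 ≤ 5 * callFactor δ c * logCost a := by positivity
      have hl : 5 * callFactor δ c * logCost a * (l₂.height : ℝ) ≤
          5 * callFactor δ c * logCost a * (max l₂.height r₂.height : ℕ) := by
        gcongr; exact le_max_left _ _
      have hr : 5 * callFactor δ c * logCost a * (r₂.height : ℝ) ≤
          5 * callFactor δ c * logCost a * (max l₂.height r₂.height : ℕ) := by
        gcongr; exact le_max_right _ _
      have hm := max_le (i1.trans (by linarith)) (i2.trans (add_le_add_left hr 2))
      have := mul_le_mul_of_nonneg_left (logCost_mono ha) (by positivity : 0 ≤ 5 * callFactor δ c)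
      rw [height, Nat.cast_add_one, mul_add]
      linarith

lemma run_span_le (h : IsJoinScheme join Bal rk δ c) (key : E → K) (op : SetOp)
    {t₁ t₂ : BinaryTree E} (h₁ : Bal t₁) (h₂ : Bal t₂) :
    ((op.run key join t₁ t₂).span : ℝ) ≤
      (10 * callFactor δ c * δ⁻¹ + 2) * spanBound t₁.numNodes t₂.numNodes := by
  have hK : 0 ≤ callFactor δ c := by linarith [h.four_le_callFactor, h.c_nonneg]
  have hδ := inv_pos.2 h.δ_pos
  have h1 : 1 ≤ spanBound t₁.numNodes t₂.numNodes := le_max_left _ _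
  have h2 : 0 ≤ 10 * callFactor δ c * δ⁻¹ := by positivity
  cases t₁ with
  | nil =>
    rw [(run_nil_left key op t₂).2]
    push_cast
    nlinarith
  | node e l r =>
    have h3 := h.run_span_le_height key op h₁ h₂ le_rfl
    have h4 := h.height_le_logb h₂
    have h5 : 1 ≤ Real.logb 2 (((node e l r).numNodes : ℝ) + 1) := by
      rw [Real.le_logb_iff_rpow_le one_lt_two (by positivity)]
      simp only [numNodes]
      push_cast
      rw [Real.rpow_one]
      linarith [(Nat.cast_nonneg l.numNodes : (0 : ℝ) ≤ _),
        (Nat.cast_nonneg r.numNodes : (0 : ℝ) ≤ _)]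
    have h6 := logb_succ_nonneg t₂.numNodes
    have h7 : Real.logb 2 (((node e l r).numNodes : ℝ) + 1) *
      Real.logb 2 ((t₂.numNodes : ℝ) + 1) ≤ spanBound (node e l r).numNodes t₂.numNodes :=
      le_max_right _ _
    have h8 : logCost (node e l r).numNodes ≤
      2 * Real.logb 2 (((node e l r).numNodes : ℝ) + 1) := by unfold logCost; linarith
    set L := Real.logb 2 (((node e l r).numNodes : ℝ) + 1)
    set L₂ := Real.logb 2 ((t₂.numNodes : ℝ) + 1)
    have h9 : 5 * callFactor δ c * logCost (node e l r).numNodes * t₂.height ≤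
        5 * callFactor δ c * (2 * L) * (δ⁻¹ * L₂) := by
      have := one_le_logCost (node e l r).numNodes
      gcongr
    have h10 := mul_le_mul_of_nonneg_left h7 h2
    linarith

end IsJoinScheme

/-! ### Summation over the recursion tree

With `θ = |t₁| / |t₂|`, a subtree of rank `s` of the second tree is expected to meet about
`x = θ 2 ^ s` entries of the first one. If it meets `a`, then `log (1 + a)` is at most
`log (1 + x) + O(a / x)`. The first term depends on the second tree alone; the second one is
summed along the paths of the recursion, where `x` decreases geometrically. -/

section Sums

variable {E : Type u} {join : BinaryTree E → E → BinaryTree E → Cost (BinaryTree E)}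
  {Bal : BinaryTree E → Prop} {rk : BinaryTree E → ℝ} {δ c θ : ℝ}

/-- The sum of `1 + log₂ (1 + x)` over all nodes with `x = θ 2 ^ rk ≥ 1`. -/
def nodeSum (rk : BinaryTree E → ℝ) (θ : ℝ) : BinaryTree E → ℝ
  | nil => 0
  | node e l r => (if 1 ≤ θ * 2 ^ rk (node e l r)
      then 1 + Real.logb 2 (1 + θ * 2 ^ rk (node e l r)) else 0) +
      (nodeSum rk θ l + nodeSum rk θ r)

/-- The maximum over all downward paths of the sum of `min 1 (1 / x)` with `x = θ 2 ^ rk`. -/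
def pathMax (rk : BinaryTree E → ℝ) (θ : ℝ) : BinaryTree E → ℝ
  | nil => 0
  | node e l r => min 1 (θ * 2 ^ rk (node e l r))⁻¹ + max (pathMax rk θ l) (pathMax rk θ r)

lemma nodeSum_nonneg (hθ : 0 < θ) (t : BinaryTree E) : 0 ≤ nodeSum rk θ t := by
  induction t with
  | nil => exact le_rfl
  | node e l r ihl ihr =>
    have : 0 ≤ Real.logb 2 (1 + θ * 2 ^ rk (node e l r)) :=
      Real.logb_nonneg one_lt_two (by linarith [(by positivity : 0 < θ * 2 ^ rk (node e l r))])
    unfold nodeSum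
    split_ifs <;> linarith

lemma pathMax_nonneg (hθ : 0 < θ) (t : BinaryTree E) : 0 ≤ pathMax rk θ t := by
  induction t with
  | nil => exact le_rfl
  | node e l r ihl _ =>
    have : 0 ≤ min 1 (θ * 2 ^ rk (node e l r))⁻¹ := by positivity
    have := le_max_left (pathMax rk θ l) (pathMax rk θ r)
    unfold pathMax
    linarith

lemma two_mul_log_two_gt : (1 : ℝ) < 2 * Real.log 2 := by
  linarith [Real.log_two_gt_d9]

lemma logb_two_one_add_le {y : ℝ} (hy : 0 ≤ y) : Real.logb 2 (1 + y) ≤ 2 * y := by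
  have h1 := Real.log_le_sub_one_of_pos (by linarith : 0 < 1 + y)
  have h2 := two_mul_log_two_gt
  rw [Real.logb, div_le_iff₀ (by linarith)]
  nlinarith

/-- The tangent bound for the cost of one call, with the contact point at `x`. -/
lemma logCost_le {x : ℝ} (hx : 0 < x) {a : ℕ} (ha : 1 ≤ a) :
    logCost a ≤ (if 1 ≤ x then 1 + Real.logb 2 (1 + x) else 0) + 3 * (a * min 1 x⁻¹) := by
  have ha' : (1 : ℝ) ≤ a := by exact_mod_cast ha
  unfold logCost
  split_ifs with h
  · rw [min_eq_right (inv_le_one_of_one_le₀ h)]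
    have h1 : Real.logb 2 ((a : ℝ) + 1) ≤ Real.logb 2 ((1 + x) * (1 + a / x)) := by
      apply Real.logb_le_logb_of_le one_lt_two (by positivity)
      have : (1 + x) * (1 + a / x) = 1 + x + a / x + a := by field_simp; ring
      rw [this]
      have : 0 < a / x := by positivity
      linarith
    rw [Real.logb_mul (by positivity) (by positivity)] at h1
    have h2 := logb_two_one_add_le (y := a / x) (by positivity)
    have h3 : (a : ℝ) / x = a * x⁻¹ := div_eq_mul_inv _ _
    have : 0 < (a : ℝ) * x⁻¹ := by positivity
    rw [← h3] at this ⊢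
    linarith
  · rw [min_eq_left ((one_le_inv₀ hx).2 (not_le.1 h).le)]
    have := logb_two_one_add_le (y := a) (by positivity)
    rw [add_comm (1 : ℝ) (a : ℝ)] at this
    linarith

/-- The parts of the first tree that occur in one level of the recursion are disjoint. Hence the
terms that depend on their sizes sum up to at most `|t₁|` times the largest sum along a path. -/
lemma IsJoinScheme.run_work_le_sum {K : Type v} [LinearOrder K]
    (h : IsJoinScheme join Bal rk δ c) (key : E → K) (op : SetOp) (hθ : 0 < θ)
    {t₁ t₂ : BinaryTree E} (h₁ : Bal t₁) (h₂ : Bal t₂) :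
    ((op.run key join t₁ t₂).work : ℝ) ≤
      6 * callFactor δ c * (nodeSum rk θ t₂ + 3 * (t₁.numNodes * pathMax rk θ t₂)) + 2 := by
  have hK : 4 ≤ callFactor δ c := by linarith [h.four_le_callFactor, h.c_nonneg]
  induction t₂ generalizing t₁ with
  | nil =>
    have : ((op.run key join t₁ nil).work : ℝ) ≤ 2 := by
      exact_mod_cast (IsJoinScheme.run_nil_right key op t₁).1
    simpa [nodeSum, pathMax] using this
  | node k₂ l₂ r₂ ihl ihr =>
    cases t₁ with
    | nil =>
      rw [(IsJoinScheme.run_nil_left key op _).1]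
      have := nodeSum_nonneg (rk := rk) hθ (node k₂ l₂ r₂)
      simp only [numNodes, Nat.cast_zero, zero_mul, mul_zero, add_zero, Nat.cast_one]
      nlinarith
    | node e l r =>
      obtain ⟨u₁, u₂, b1, b2, b3, b4, -⟩ := h.run_step key op h₁ h₂
      have i1 := ihl b1 (h.bal_left h₂)
      have i2 := ihr b2 (h.bal_right h₂)
      have i3 := logCost_le (by positivity : 0 < θ * (2 : ℝ) ^ rk (node k₂ l₂ r₂))
        (a := (node e l r).numNodes) (by simp)
      have i4 := one_le_logCost (node e l r).numNodes
      set a := (node e l r).numNodes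
      have b3' : (u₁.numNodes : ℝ) + u₂.numNodes ≤ a := by exact_mod_cast b3
      set M := max (pathMax rk θ l₂) (pathMax rk θ r₂) with hM
      have m0 : 0 ≤ M := (pathMax_nonneg hθ l₂).trans (le_max_left _ _)
      have m1 : (u₁.numNodes : ℝ) * pathMax rk θ l₂ ≤ u₁.numNodes * M := by
        gcongr; exact le_max_left _ _
      have m2 : (u₂.numNodes : ℝ) * pathMax rk θ r₂ ≤ u₂.numNodes * M := by
        gcongr; exact le_max_right _ _
      have m3 : (u₁.numNodes : ℝ) * pathMax rk θ l₂ + u₂.numNodes * pathMax rk θ r₂ ≤ a * M := by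
        nlinarith
      simp only [nodeSum, pathMax]
      rw [← hM]
      set X := min 1 (θ * 2 ^ rk (node k₂ l₂ r₂))⁻¹
      set Y := (if 1 ≤ θ * 2 ^ rk (node k₂ l₂ r₂)
        then 1 + Real.logb 2 (1 + θ * 2 ^ rk (node k₂ l₂ r₂)) else 0)
      have m4 := mul_le_mul_of_nonneg_left m3 (by linarith : 0 ≤ 18 * callFactor δ c)
      have m5 := mul_le_mul_of_nonneg_left i3 (by linarith : 0 ≤ 6 * callFactor δ c)
      have m6 : 4 ≤ callFactor δ c * logCost a := by nlinarith
      nlinarith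

end Sums

section Sums

variable {E : Type u} {join : BinaryTree E → E → BinaryTree E → Cost (BinaryTree E)}
  {Bal : BinaryTree E → Prop} {rk : BinaryTree E → ℝ} {δ c θ : ℝ}

/-- The factor by which `x` decreases from a node to its children gives this geometric sum. -/
def geomFactor (δ : ℝ) : ℝ := 1 + (2 ^ δ - 1)⁻¹

lemma geomFactor_spec (hδ : 0 < δ) :
    1 ≤ geomFactor δ ∧ 1 + geomFactor δ ≤ geomFactor δ * 2 ^ δ := by
  have h1 : 0 < (2 : ℝ) ^ δ - 1 := by linarith [Real.one_lt_rpow one_lt_two hδ]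
  have h2 := mul_inv_cancel₀ h1.ne'
  have h3 := inv_pos.2 h1
  unfold geomFactor
  constructor <;> nlinarith

lemma rpow_neg_le_of_rank_drop {x y : ℝ} (h : x ≤ y - δ) :
    (2 : ℝ) ^ δ * 2 ^ (-y) ≤ 2 ^ (-x) := by
  rw [← Real.rpow_add two_pos]
  exact Real.rpow_le_rpow_of_exponent_le one_le_two (by linarith)

lemma inv_mul_two_rpow (x : ℝ) : (θ * 2 ^ x)⁻¹ = θ⁻¹ * 2 ^ (-x) := by
  rw [mul_inv, Real.rpow_neg two_pos.le]

namespace IsJoinScheme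

/-- Along a path `1 / x` grows geometrically, so that the last node dominates the sum. -/
lemma pathMax_le_inv (h : IsJoinScheme join Bal rk δ c) (hθ : 0 < θ) {t : BinaryTree E}
    (ht : Bal t) : pathMax rk θ t ≤ θ⁻¹ * (geomFactor δ * (1 - 2 ^ (-rk t))) := by
  obtain ⟨g1, g2⟩ := geomFactor_spec h.δ_pos
  have hi := inv_pos.2 hθ
  induction t with
  | nil => simp [pathMax, h.rk_nil]
  | node e l r ihl ihr =>
    have i1 := ihl (h.bal_left ht)
    have i2 := ihr (h.bal_right ht)
    have d1 := rpow_neg_le_of_rank_drop (h.rk_left_le ht)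
    have d2 := rpow_neg_le_of_rank_drop (h.rk_right_le ht)
    have d3 : 0 < (2 : ℝ) ^ (-rk (node e l r)) := by positivity
    simp only [pathMax]
    set q := (2 : ℝ) ^ (-rk (node e l r)) with hq
    have e1 : min 1 (θ * 2 ^ rk (node e l r))⁻¹ ≤ θ⁻¹ * q := by
      rw [inv_mul_two_rpow, ← hq]; exact min_le_right _ _
    have key : ∀ y : ℝ, 2 ^ δ * q ≤ y →
        θ⁻¹ * (geomFactor δ * (1 - y)) ≤ θ⁻¹ * (geomFactor δ * (1 - q)) - θ⁻¹ * q := by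
      intro y hy
      rw [← mul_sub]
      gcongr
      nlinarith
    have := max_le (i1.trans (key _ d1)) (i2.trans (key _ d2))
    linarith

/-- The nodes with `x ≤ 1` contribute at most `1` each to the sum over a path, and there are
`O(log (1 / θ))` of them. -/
lemma pathMax_le_logb (h : IsJoinScheme join Bal rk δ c) (hθ : 0 < θ) (hθ1 : θ ≤ 1)
    {t : BinaryTree E} (ht : Bal t) :
    pathMax rk θ t ≤ δ⁻¹ * Real.logb 2 θ⁻¹ + 2 * geomFactor δ := by
  obtain ⟨g1, g2⟩ := geomFactor_spec h.δ_pos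
  have hδ := h.δ_pos
  have hi := inv_pos.2 hθ
  set L := Real.logb 2 θ⁻¹ with hL
  have hL0 : 0 ≤ L := Real.logb_nonneg one_lt_two ((one_le_inv₀ hθ).2 hθ1)
  have hθL : θ⁻¹ = 2 ^ L := (Real.rpow_logb two_pos (by norm_num) hi).symm
  suffices H : (rk t ≤ L → pathMax rk θ t ≤ δ⁻¹ * rk t) ∧
      (L < rk t → pathMax rk θ t ≤ δ⁻¹ * L + geomFactor δ * (2 - 2 ^ (L - rk t))) by
    rcases le_or_gt (rk t) L with h1 | h1
    · have := mul_le_mul_of_nonneg_left h1 (inv_pos.2 hδ).le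
      have := H.1 h1
      linarith
    · have : 0 < (2 : ℝ) ^ (L - rk t) := by positivity
      have := H.2 h1
      nlinarith
  induction t with
  | nil =>
    refine ⟨fun _ => by simp [pathMax, h.rk_nil], fun h1 => ?_⟩
    rw [h.rk_nil] at h1; linarith
  | node e l r ihl ihr =>
    have i1 := ihl (h.bal_left ht)
    have i2 := ihr (h.bal_right ht)
    have d1 := h.rk_left_le ht
    have d2 := h.rk_right_le ht
    have hd : δ⁻¹ * δ = 1 := inv_mul_cancel₀ hδ.ne'
    have hd0 := inv_pos.2 hδ
    simp only [pathMax]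
    constructor
    · intro h1
      have j1 := i1.1 (by linarith)
      have j2 := i2.1 (by linarith)
      have := max_le (j1.trans (mul_le_mul_of_nonneg_left d1 hd0.le))
        (j2.trans (mul_le_mul_of_nonneg_left d2 hd0.le))
      have := min_le_left 1 (θ * 2 ^ rk (node e l r))⁻¹
      linarith
    · intro h1
      have e1 : min 1 (θ * 2 ^ rk (node e l r))⁻¹ ≤ 2 ^ (L - rk (node e l r)) := by
        rw [inv_mul_two_rpow, hθL, ← Real.rpow_add two_pos]; exact min_le_right _ _
      have e2 : (2 : ℝ) ^ (L - rk (node e l r)) ≤ 1 :=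
        Real.rpow_le_one_of_one_le_of_nonpos one_le_two (by linarith)
      have e3 : 0 < (2 : ℝ) ^ (L - rk (node e l r)) := by positivity
      have key : ∀ s : BinaryTree E, rk s ≤ rk (node e l r) - δ →
          ((rk s ≤ L → pathMax rk θ s ≤ δ⁻¹ * rk s) ∧
          (L < rk s → pathMax rk θ s ≤ δ⁻¹ * L + geomFactor δ * (2 - 2 ^ (L - rk s)))) →
          pathMax rk θ s ≤ δ⁻¹ * L + geomFactor δ * (2 - 2 ^ (L - rk (node e l r))) -
            2 ^ (L - rk (node e l r)) := by
        intro s hs hi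
        rcases le_or_gt (rk s) L with h2 | h2
        · have := hi.1 h2
          have := mul_le_mul_of_nonneg_left h2 hd0.le
          nlinarith
        · have a1 := hi.2 h2
          have a2 : (2 : ℝ) ^ δ * 2 ^ (L - rk (node e l r)) ≤ 2 ^ (L - rk s) := by
            rw [← Real.rpow_add two_pos]
            exact Real.rpow_le_rpow_of_exponent_le one_le_two (by linarith)
          nlinarith
      have := max_le (key l d1 i1) (key r d2 i2)
      linarith

/-- Few nodes have a high rank: the sum of the ranks is linear. -/
lemma nodeSum_le_of_one_le (h : IsJoinScheme join Bal rk δ c) (hθ : 1 ≤ θ) {t : BinaryTree E}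
    (ht : Bal t) : nodeSum rk θ t ≤
      t.numNodes * (1 + Real.logb 2 (1 + θ)) + (2 * t.numLeaves - (rk t + 2)) := by
  induction t with
  | nil => simp [nodeSum, h.rk_nil]
  | node e l r ihl ihr =>
    have i1 := ihl (h.bal_left ht)
    have i2 := ihr (h.bal_right ht)
    have d1 := h.rk_left_ge ht
    have d2 := h.rk_right_ge ht
    have hr := h.rk_nonneg ht
    have e1 : (if 1 ≤ θ * 2 ^ rk (node e l r)
      then 1 + Real.logb 2 (1 + θ * 2 ^ rk (node e l r)) else 0) ≤
        1 + Real.logb 2 (1 + θ) + rk (node e l r) := by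
      have f1 : (1 : ℝ) ≤ 2 ^ rk (node e l r) := Real.one_le_rpow one_le_two hr
      rw [if_pos (by nlinarith)]
      have f2 := Real.logb_le_logb_of_le one_lt_two (by positivity)
        (by nlinarith : 1 + θ * 2 ^ rk (node e l r) ≤ (1 + θ) * 2 ^ rk (node e l r))
      rw [Real.logb_mul (by positivity) (by positivity),
        Real.logb_rpow two_pos (by norm_num)] at f2
      linarith
    simp only [nodeSum, numNodes, numLeaves]
    push_cast
    linarith

/-- The number of nodes with `x ≥ 1` is `O(θ w)`, and so is the sum of `log x` over them. -/
lemma nodeSum_le_of_le_one (h : IsJoinScheme join Bal rk δ c) (hθ : 0 < θ) {t : BinaryTree E}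
    (ht : Bal t) : nodeSum rk θ t ≤ 8 * θ * t.numLeaves := by
  set L := Real.logb 2 θ with hL
  have hθL : θ = 2 ^ L := (Real.rpow_logb two_pos (by norm_num) hθ).symm
  suffices H : (L + rk t < 0 → nodeSum rk θ t ≤ 0) ∧
      (0 ≤ L + rk t → nodeSum rk θ t ≤ 8 * θ * t.numLeaves - (L + rk t + 4)) by
    rcases lt_or_ge (L + rk t) 0 with h1 | h1
    · exact (H.1 h1).trans (by positivity)
    · linarith [H.2 h1]
  induction t with
  | nil =>
    refine ⟨fun _ => le_rfl, fun h1 => ?_⟩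
    rw [h.rk_nil] at h1 ⊢
    have h2 : 1 + L ≤ 2 * θ := by
      have h4 : Real.logb 2 (2 * θ) ≤ 2 * θ := by
        have f1 := Real.log_le_sub_one_of_pos (by positivity : 0 < θ)
        have f2 := two_mul_log_two_gt
        rw [Real.logb_mul two_ne_zero hθ.ne', Real.logb_self_eq_one one_lt_two, Real.logb]
        have f3 : Real.log θ / Real.log 2 ≤ 2 * θ - 1 := by
          have f4 : 1 ≤ θ := by
            rw [hθL]; exact Real.one_le_rpow one_le_two (by linarith)
          rw [div_le_iff₀ (by linarith)]
          nlinarith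
        linarith
      rwa [Real.logb_mul two_ne_zero hθ.ne', Real.logb_self_eq_one one_lt_two] at h4
    have f4 : 1 ≤ θ := by
      rw [hθL]; exact Real.one_le_rpow one_le_two (by linarith)
    simp only [nodeSum, numLeaves]
    push_cast
    linarith
  | node e l r ihl ihr =>
    have bl := h.bal_left ht
    have br := h.bal_right ht
    have i1 := ihl bl
    have i2 := ihr br
    have d1 := h.rk_left_ge ht
    have d2 := h.rk_right_ge ht
    have d3 := h.rk_left_le ht
    have d4 := h.rk_right_le ht
    have hδ := h.δ_pos
    have hx : θ * 2 ^ rk (node e l r) = 2 ^ (L + rk (node e l r)) := by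
      rw [Real.rpow_add two_pos, ← hθL]
    simp only [nodeSum, hx]
    constructor
    · intro h1
      rw [if_neg (not_le.2 (Real.rpow_lt_one_of_one_lt_of_neg one_lt_two h1))]
      linarith [i1.1 (by linarith), i2.1 (by linarith)]
    · intro h1
      have hp : (1 : ℝ) ≤ 2 ^ (L + rk (node e l r)) := Real.one_le_rpow one_le_two h1
      rw [if_pos hp]
      have e1 : Real.logb 2 (1 + 2 ^ (L + rk (node e l r))) ≤ 1 + (L + rk (node e l r)) := by
        have := Real.logb_le_logb_of_le one_lt_two (by positivity)
          (by linarith : 1 + (2 : ℝ) ^ (L + rk (node e l r)) ≤ 2 * 2 ^ (L + rk (node e l r)))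
        rwa [Real.logb_mul two_ne_zero (by positivity), Real.logb_self_eq_one one_lt_two,
          Real.logb_rpow two_pos (by norm_num)] at this
      -- a child whose own `x` is below `1` still has a weight of at least `1 / (2 θ)`
      have w1 : ∀ s : BinaryTree E, Bal s → rk (node e l r) - 1 ≤ rk s →
          1 ≤ 2 * θ * s.numLeaves := by
        intro s hs hs1
        have a1 := h.two_rpow_rk_le hs
        have a2 : (2 : ℝ) ^ (-1 : ℝ) ≤ 2 ^ (L + rk s) :=
          Real.rpow_le_rpow_of_exponent_le one_le_two (by linarith)
        rw [Real.rpow_add two_pos, ← hθL, Real.rpow_neg_one] at a2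
        have a3 := mul_le_mul_of_nonneg_left a1 hθ.le
        linarith
      have w2 := w1 l bl d1
      have w3 := w1 r br d2
      simp only [numLeaves]
      push_cast
      rcases lt_or_ge (L + rk l) 0 with h2 | h2 <;> rcases lt_or_ge (L + rk r) 0 with h3 | h3
      · linarith [i1.1 h2, i2.1 h3]
      · linarith [i1.1 h2, i2.2 h3]
      · linarith [i1.2 h2, i2.1 h3]
      · linarith [i1.2 h2, i2.2 h3]

end IsJoinScheme

end Sums

/-! ### The work bound -/

lemma one_le_logb_div_add_one {m n : ℕ} (hm : 1 ≤ m) (hmn : m ≤ n) :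
    1 ≤ Real.logb 2 ((n : ℝ) / m + 1) := by
  have h1 : (1 : ℝ) ≤ m := by exact_mod_cast hm
  have h2 : (m : ℝ) ≤ n := by exact_mod_cast hmn
  rw [Real.le_logb_iff_rpow_le one_lt_two (by positivity), Real.rpow_one]
  have : 1 ≤ (n : ℝ) / m := by rwa [one_le_div (by linarith)]
  linarith

lemma workBound_comm (a b : ℕ) : workBound a b = workBound b a := by
  simp only [workBound, min_comm a b, max_comm a b]

lemma one_le_workBound (a b : ℕ) : 1 ≤ workBound a b := le_max_left _ _

lemma le_workBound {m n : ℕ} (hmn : m ≤ n) :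
    (m : ℝ) * Real.logb 2 ((n : ℝ) / m + 1) ≤ workBound m n := by
  unfold workBound; rw [min_eq_left hmn, max_eq_right hmn]; exact le_max_right _ _

/-- The factor in the final work bound. -/
def workFactor (δ c : ℝ) : ℝ :=
  6 * IsJoinScheme.callFactor δ c * (16 + 3 * (δ⁻¹ + 2 * geomFactor δ)) + 2

lemma IsJoinScheme.run_work_le {E : Type u} {K : Type v} [LinearOrder K]
    {join : BinaryTree E → E → BinaryTree E → Cost (BinaryTree E)} {Bal : BinaryTree E → Prop}
    {rk : BinaryTree E → ℝ} {δ c : ℝ}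
    (h : IsJoinScheme join Bal rk δ c) (key : E → K) (op : SetOp)
    {t₁ t₂ : BinaryTree E} (h₁ : Bal t₁) (h₂ : Bal t₂) :
    ((op.run key join t₁ t₂).work : ℝ) ≤ workFactor δ c * workBound t₁.numNodes t₂.numNodes := by
  have hK : 4 ≤ callFactor δ c := by linarith [h.four_le_callFactor, h.c_nonneg]
  have hδ := inv_pos.2 h.δ_pos
  obtain ⟨hg, -⟩ := geomFactor_spec h.δ_pos
  have hw := one_le_workBound t₁.numNodes t₂.numNodes
  have hC : 2 ≤ workFactor δ c := by
    have : 0 ≤ 6 * callFactor δ c * (16 + 3 * (δ⁻¹ + 2 * geomFactor δ)) := by positivity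
    unfold workFactor; linarith
  rcases Nat.eq_zero_or_pos t₁.numNodes with ha | ha
  · cases t₁ with
    | nil =>
      rw [(run_nil_left key op t₂).1]
      push_cast
      nlinarith
    | node e l r => simp at ha
  rcases Nat.eq_zero_or_pos t₂.numNodes with hb | hb
  · cases t₂ with
    | nil =>
      have : ((op.run key join t₁ nil).work : ℝ) ≤ 2 := by
        exact_mod_cast (run_nil_right key op t₁).1
      nlinarith
    | node e l r => simp at hb
  have hl : (t₂.numLeaves : ℝ) = t₂.numNodes + 1 := by
    exact_mod_cast numLeaves_eq_numNodes_succ t₂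
  have hrk := h.rk_nonneg h₂
  set a := t₁.numNodes
  set b := t₂.numNodes
  have ha' : (1 : ℝ) ≤ a := by exact_mod_cast ha
  have hb' : (1 : ℝ) ≤ b := by exact_mod_cast hb
  have hθ : 0 < (a : ℝ) / b := by positivity
  have main := h.run_work_le_sum key op hθ h₁ h₂
  suffices H : nodeSum rk ((a : ℝ) / b) t₂ + 3 * (a * pathMax rk ((a : ℝ) / b) t₂) ≤
      (16 + 3 * (δ⁻¹ + 2 * geomFactor δ)) * workBound a b by
    have := mul_le_mul_of_nonneg_left H (by linarith : 0 ≤ 6 * callFactor δ c)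
    unfold workFactor
    linarith
  -- if `t₂` is the smaller tree, then `θ ≥ 1` and all its nodes count in `nodeSum`; otherwise
  -- `nodeSum` is `O(|t₁|)` and the logarithm comes from the upper part of the paths in `pathMax`
  rcases le_total b a with hab | hab
  · have s1 := h.nodeSum_le_of_one_le (θ := (a : ℝ) / b)
      (by rw [one_le_div (by linarith)]; exact_mod_cast hab) h₂
    have s2 := h.pathMax_le_inv hθ h₂
    have s3 := one_le_logb_div_add_one hb hab
    have s4 := le_workBound hab
    rw [workBound_comm] at s4
    have s5 : pathMax rk ((a : ℝ) / b) t₂ ≤ b / a * geomFactor δ := by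
      refine s2.trans ?_
      rw [inv_div]
      have : 0 < (2 : ℝ) ^ (-rk t₂) := by positivity
      gcongr
      nlinarith
    have s6 : a * pathMax rk ((a : ℝ) / b) t₂ ≤ b * geomFactor δ := by
      refine (mul_le_mul_of_nonneg_left s5 (by linarith)).trans (le_of_eq ?_)
      field_simp
    rw [add_comm (1 : ℝ) ((a : ℝ) / b), hl] at s1
    set G := Real.logb 2 ((a : ℝ) / b + 1)
    have s7 : (b : ℝ) ≤ b * G := le_mul_of_one_le_right (by linarith) s3
    have s8 : (b : ℝ) ≤ workBound a b := s7.trans s4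
    have s9 := mul_le_mul_of_nonneg_right s8 (by linarith : 0 ≤ geomFactor δ)
    have s10 := mul_nonneg hδ.le (by linarith : 0 ≤ workBound a b)
    have s11 := mul_nonneg (by linarith : 0 ≤ geomFactor δ) (by linarith : 0 ≤ workBound a b)
    linarith
  · have hθ1 : (a : ℝ) / b ≤ 1 := by
      rw [div_le_one (by linarith)]; exact_mod_cast hab
    have s1 := h.nodeSum_le_of_le_one hθ h₂
    have s2 := h.pathMax_le_logb hθ hθ1 h₂
    have s3 := one_le_logb_div_add_one ha hab
    have s4 := le_workBound hab
    rw [inv_div] at s2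
    have s5 : Real.logb 2 ((b : ℝ) / a) ≤ Real.logb 2 ((b : ℝ) / a + 1) :=
      Real.logb_le_logb_of_le one_lt_two (by positivity) (by linarith)
    set G := Real.logb 2 ((b : ℝ) / a + 1)
    have s6 : (a : ℝ) / b * (b + 1) ≤ 2 * a := by
      have : (a : ℝ) / b * (b + 1) = a + a / b := by field_simp
      linarith
    rw [hl] at s1
    have s7 : (a : ℝ) ≤ a * G := le_mul_of_one_le_right (by linarith) s3
    have s8 : pathMax rk ((a : ℝ) / b) t₂ ≤ (δ⁻¹ + 2 * geomFactor δ) * G := by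
      have := mul_le_mul_of_nonneg_left s5 hδ.le
      nlinarith
    have s9 : a * pathMax rk ((a : ℝ) / b) t₂ ≤ (δ⁻¹ + 2 * geomFactor δ) * workBound a b := by
      have f1 := mul_le_mul_of_nonneg_left s8 (by linarith : (0 : ℝ) ≤ a)
      have f2 := mul_le_mul_of_nonneg_left s4 (by positivity : 0 ≤ δ⁻¹ + 2 * geomFactor δ)
      linarith
    linarith

/-! ### Mirror images -/

section Mirror

variable {E : Type u}

/-- The mirror image of a tree. -/
def mirror : BinaryTree E → BinaryTree E
  | nil => nil
  | node e l r => node e (mirror r) (mirror l)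

@[simp] lemma mirror_nil : mirror (nil : BinaryTree E) = nil := rfl

@[simp] lemma mirror_node (e : E) (l r : BinaryTree E) :
    mirror (node e l r) = node e (mirror r) (mirror l) := rfl

@[simp] lemma mirror_mirror (t : BinaryTree E) : mirror (mirror t) = t := by
  induction t with
  | nil => rfl
  | node e l r ihl ihr => simp [ihl, ihr]

@[simp] lemma height_mirror (t : BinaryTree E) : (mirror t).height = t.height := by
  induction t with
  | nil => rfl
  | node e l r ihl ihr => simp [ihl, ihr, max_comm]

@[simp] lemma numNodes_mirror (t : BinaryTree E) : (mirror t).numNodes = t.numNodes := by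
  induction t with
  | nil => rfl
  | node e l r ihl ihr => simp [ihl, ihr, add_comm]

@[simp] lemma numLeaves_mirror (t : BinaryTree E) : (mirror t).numLeaves = t.numLeaves := by
  rw [numLeaves_eq_numNodes_succ, numLeaves_eq_numNodes_succ, numNodes_mirror]

@[simp] lemma left_mirror (t : BinaryTree E) : (mirror t).left = mirror t.right := by
  cases t <;> rfl

@[simp] lemma right_mirror (t : BinaryTree E) : (mirror t).right = mirror t.left := by
  cases t <;> rfl

/-- The same computation with the mirror image as its result. -/
def Cost.mirror (x : Cost (BinaryTree E)) : Cost (BinaryTree E) :=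
  ⟨JoinTree.mirror x.val, x.work, x.span⟩

@[simp] lemma Cost.mirror_val (x : Cost (BinaryTree E)) :
    x.mirror.val = JoinTree.mirror x.val := rfl
@[simp] lemma Cost.mirror_work (x : Cost (BinaryTree E)) : x.mirror.work = x.work := rfl

@[simp] lemma Cost.mirror_tick (x : Cost (BinaryTree E)) : (tick x).mirror = tick x.mirror := rfl

@[simp] lemma Cost.mirror_ret (t : BinaryTree E) : (ret t).mirror = ret (JoinTree.mirror t) := rfl

@[simp] lemma Cost.mirror_test (p : Prop) (x y : Cost (BinaryTree E)) :
    (test p x y).mirror = test p x.mirror y.mirror := by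
  by_cases hp : p
  · rw [test_pos hp, test_pos hp]; rfl
  · rw [test_neg hp, test_neg hp]; rfl

@[simp] lemma Cost.mirror_bind (x : Cost (BinaryTree E))
    (f : BinaryTree E → Cost (BinaryTree E)) :
    (x.bind f).mirror = x.mirror.bind fun t => (f (JoinTree.mirror t)).mirror := by
  simp [Cost.mirror, Cost.bind]

@[simp] lemma mirror_mkNode (l : BinaryTree E) (e : E) (r : BinaryTree E) :
    (mkNode l e r).mirror = mkNode (mirror r) e (mirror l) := rfl

@[simp] lemma mirror_rotateLeft (t : BinaryTree E) :
    (rotateLeft t).mirror = rotateRight (mirror t) := by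
  rcases t with _ | ⟨e, a, _ | ⟨f, b, c⟩⟩ <;> rfl

@[simp] lemma mirror_rotateRight (t : BinaryTree E) :
    (rotateRight t).mirror = rotateLeft (mirror t) := by
  rcases t with _ | ⟨e, _ | ⟨f, b, c⟩, a⟩ <;> rfl

end Mirror

/-! ### AVL trees -/

namespace AVL

variable {K : Type u}

lemma balanced_mirror (t : BinaryTree K) : Balanced (mirror t) ↔ Balanced t := by
  induction t with
  | nil => rfl
  | node e l r ihl ihr => simp only [mirror_node, Balanced, height_mirror, ihl, ihr]; tauto

lemma joinLeft_eq_mirror (tl : BinaryTree K) (k : K) (tr : BinaryTree K) :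
    joinLeft tl k tr = (joinRight k (mirror tl) (mirror tr)).mirror := by
  induction tr with
  | nil => simp [joinLeft, joinRight]
  | node e l r ihl _ => simp [joinLeft, joinRight, ihl]

lemma seq_joinRight (k : K) (tr tl : BinaryTree K) : Seq (joinRight k tr tl) := by
  induction tl with
  | nil => exact Seq.mkNode _ _ _
  | node e l r _ ih =>
    exact (((Seq.mkNode _ _ _).bind fun _ => (Seq.mkNode _ _ _).test
      ((Seq.rotateRight _).bind fun _ => (Seq.mkNode _ _ _).bind fun _ => Seq.rotateLeft _)).test
      (ih.bind fun _ => (Seq.mkNode _ _ _).bind fun _ =>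
        (Seq.ret _).test (Seq.rotateLeft _))).tick

lemma seq_join (l : BinaryTree K) (e : K) (r : BinaryTree K) : Seq (join l e r) := by
  refine (seq_joinRight _ _ _).test (Seq.test ?_ (Seq.mkNode _ _ _))
  rw [joinLeft_eq_mirror]
  exact seq_joinRight _ _ _

/-- If the height grows, then the root of the result leans to the right, so that a single left
rotation suffices at the next level. -/
lemma joinRight_spec (k : K) {tr tl : BinaryTree K} (hr : Balanced tr) (hl : Balanced tl)
    (h : tr.height + 1 < tl.height) :
    let s := joinRight k tr tl
    Balanced s.val ∧ s.val.numNodes = tl.numNodes + tr.numNodes + 1 ∧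
      (s.val.height = tl.height ∨
        s.val.height = tl.height + 1 ∧ s.val.left.height + 2 = s.val.height) ∧
      s.work + 5 * tr.height ≤ 5 * tl.height + 5 := by
  induction tl with
  | nil => simp at h
  | node k' l c _ ih =>
    simp only [Balanced] at hl
    obtain ⟨h1, h2, h3, h4⟩ := hl
    simp only [height] at h
    rw [joinRight]
    by_cases hc : c.height ≤ tr.height + 1
    · rw [test_pos hc]
      simp only [tick_val, tick_work, bind_val, bind_work, mkNode_val, mkNode_work]
      by_cases ht : (node k c tr).height ≤ l.height + 1
      · rw [test_pos ht]
        simp only [height] at ht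
        simp only [tick_val, mkNode_val, tick_work, mkNode_work, Balanced, numNodes, height, left]
        refine ⟨⟨by omega, by omega, h3, by omega, by omega, h4, hr⟩, by omega, ?_, ?_⟩ <;> omega
      · rw [test_neg ht]
        simp only [height] at ht
        simp only [tick_val, tick_work, bind_val, bind_work, mkNode_work,
          rotateLeft_work, rotateRight_work]
        cases c with
        | nil => simp at *; omega
        | node kc a b =>
          simp only [Balanced, height] at h4 hc ht h h1 h2 ⊢
          simp only [rotateRight, tick_val, ret_val, mkNode_val, rotateLeft, Balanced, numNodes,
            height]
          obtain ⟨h5, h6, h7, h8⟩ := h4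
          refine ⟨⟨?_, ?_, ⟨?_, ?_, h3, h7⟩, ?_, ?_, h8, hr⟩, ?_, Or.inl ?_, ?_⟩ <;> omega
    · rw [test_neg hc]
      obtain ⟨i1, i2, i3, i4⟩ := ih h4 (by omega)
      simp only [tick_val, tick_work, bind_val, bind_work, mkNode_val, mkNode_work]
      set s := joinRight k tr c
      by_cases ht : s.val.height ≤ l.height + 1
      · rw [test_pos ht]
        simp only [tick_val, ret_val, tick_work, ret_work, Balanced, numNodes, height, left]
        refine ⟨⟨by omega, by omega, h3, i1⟩, by omega, ?_, ?_⟩ <;> omega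
      · rw [test_neg ht]
        simp only [tick_val, tick_work, rotateLeft_work]
        rcases hs : s.val with _ | ⟨k₁, l₁, r₁⟩
        · rw [hs] at ht; simp at ht
        · rw [hs] at i1 i2 i3 ht
          simp only [Balanced, height, numNodes, left] at i1 i2 i3 ht
          obtain ⟨h5, h6, h7, h8⟩ := i1
          simp only [rotateLeft, tick_val, ret_val, Balanced, numNodes, height]
          refine ⟨⟨?_, ?_, ⟨?_, ?_, h3, h7⟩, h8⟩, ?_, Or.inl ?_, ?_⟩ <;> omega

lemma join_spec (k : K) {tl tr : BinaryTree K} (hl : Balanced tl) (hr : Balanced tr) :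
    let s := join tl k tr
    Balanced s.val ∧ s.val.numNodes = tl.numNodes + tr.numNodes + 1 ∧
      max tl.height tr.height ≤ s.val.height ∧ s.val.height ≤ max tl.height tr.height + 1 ∧
      s.work + 5 * min tl.height tr.height ≤ 5 * max tl.height tr.height + 7 := by
  unfold join
  by_cases h1 : tr.height + 1 < tl.height
  · rw [test_pos h1]
    obtain ⟨i1, i2, i3, i4⟩ := joinRight_spec k hr hl h1
    simp only [tick_val, tick_work]
    refine ⟨i1, i2, ?_, ?_, ?_⟩ <;> omega
  · rw [test_neg h1]
    by_cases h2 : tl.height + 1 < tr.height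
    · rw [test_pos h2, joinLeft_eq_mirror]
      obtain ⟨i1, i2, i3, i4⟩ := joinRight_spec k ((balanced_mirror tl).2 hl)
        ((balanced_mirror tr).2 hr) (by simpa using h2)
      simp only [height_mirror, numNodes_mirror] at i2 i3 i4
      simp only [tick_val, tick_work, mirror_val, mirror_work, balanced_mirror, height_mirror,
        numNodes_mirror]
      refine ⟨i1, ?_, ?_, ?_, ?_⟩ <;> omega
    · rw [test_neg h2]
      simp only [tick_val, tick_work, mkNode_val, mkNode_work, Balanced, numNodes, height]
      refine ⟨⟨by omega, by omega, hl, hr⟩, trivial, ?_, ?_, ?_⟩ <;> omega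

/-- From a node to a child the height drops by one or two, hence the rank by at most `1`. -/
lemma isJoinScheme : IsJoinScheme (join (K := K)) Balanced
    (fun t => (t.height : ℝ) / 2) (1 / 2) 10 where
  δ_pos := by norm_num
  c_nonneg := by norm_num
  bal_nil := trivial
  bal_left h := h.2.2.1
  bal_right h := h.2.2.2
  rk_nil := by simp
  rk_left_ge {e l r} h := by
    have : (node e l r).height ≤ l.height + 2 := by have := h.2.1; simp only [height]; omega
    have : ((node e l r).height : ℝ) ≤ l.height + 2 := by exact_mod_cast this
    linarith
  rk_right_ge {e l r} h := by
    have : (node e l r).height ≤ r.height + 2 := by have := h.1; simp only [height]; omega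
    have : ((node e l r).height : ℝ) ≤ r.height + 2 := by exact_mod_cast this
    linarith
  rk_left_le {e l r} _ := by
    have : l.height + 1 ≤ (node e l r).height := by simp
    have : (l.height : ℝ) + 1 ≤ (node e l r).height := by exact_mod_cast this
    linarith
  rk_right_le {e l r} _ := by
    have : r.height + 1 ≤ (node e l r).height := by simp
    have : (r.height : ℝ) + 1 ≤ (node e l r).height := by exact_mod_cast this
    linarith
  bal_join hl hr := (join_spec _ hl hr).1
  numNodes_join hl hr := (join_spec _ hl hr).2.1
  le_rk_join_left {e l r} hl hr := by
    have := (le_max_left _ _).trans (join_spec e hl hr).2.2.1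
    have : (l.height : ℝ) ≤ (join l e r).val.height := by exact_mod_cast this
    linarith
  le_rk_join_right {e l r} hl hr := by
    have := (le_max_right _ _).trans (join_spec e hl hr).2.2.1
    have : (r.height : ℝ) ≤ (join l e r).val.height := by exact_mod_cast this
    linarith
  rk_join_le {e l r e' l' r' x} _ hl hr _ h1 h2 := by
    have h3 := (join_spec e' hl hr).2.2.2.1
    have h4 : ((join l' e' r').val.height : ℝ) ≤ max (l'.height : ℝ) r'.height + 1 := by
      exact_mod_cast h3
    have h5 : (l.height : ℝ) + 1 ≤ (node e l r).height := by simp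
    have h6 : (r.height : ℝ) + 1 ≤ (node e l r).height := by simp
    rcases max_cases (l'.height : ℝ) r'.height with ⟨h7, _⟩ | ⟨h7, _⟩ <;> linarith
  work_join {e l r} hl hr := by
    have h1 := (join_spec e hl hr).2.2.2.2
    have h2 : ((join l e r).work : ℝ) + 5 * min (l.height : ℝ) r.height ≤
        5 * max (l.height : ℝ) r.height + 7 := by exact_mod_cast h1
    have h3 := max_sub_min_eq_abs (r.height : ℝ) l.height
    rw [max_comm, min_comm] at h3
    have h4 : |(l.height : ℝ) / 2 - (r.height : ℝ) / 2| = |(l.height : ℝ) - r.height| / 2 := by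
      rw [← sub_div, abs_div, abs_two]
    rw [h4]
    linarith
  seq_join := seq_join

end AVL

/-! ### Red-black trees -/

namespace RB

variable {K : Type u}

/-- Twice the black height, plus one if the root is red. -/
def rank : BinaryTree (K × Color) → ℕ
  | nil => 0
  | node (_, .red) l _ => 2 * blackHeight l + 1
  | node (_, .black) l _ => 2 * blackHeight l + 2

lemma rank_of_isRed {t : BinaryTree (K × Color)} (h : IsRed t) :
    rank t = 2 * blackHeight t + 1 := by
  rcases t with _ | ⟨⟨k, _ | _⟩, l, r⟩
  · exact h.elim
  · rfl
  · cases h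

lemma rank_of_not_isRed {t : BinaryTree (K × Color)} (h : ¬ IsRed t) :
    rank t = 2 * blackHeight t := by
  rcases t with _ | ⟨⟨k, _ | _⟩, l, r⟩
  · rfl
  · exact (h rfl).elim
  · rfl

lemma two_mul_blackHeight_le_rank (t : BinaryTree (K × Color)) : 2 * blackHeight t ≤ rank t := by
  by_cases h : IsRed t
  · rw [rank_of_isRed h]; omega
  · rw [rank_of_not_isRed h]

lemma rank_le (t : BinaryTree (K × Color)) : rank t ≤ 2 * blackHeight t + 1 := by
  by_cases h : IsRed t
  · rw [rank_of_isRed h]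
  · rw [rank_of_not_isRed h]; omega

@[simp] lemma blackHeight_red (k : K) (l r : BinaryTree (K × Color)) :
    blackHeight (node (k, .red) l r) = blackHeight l := rfl

@[simp] lemma blackHeight_black (k : K) (l r : BinaryTree (K × Color)) :
    blackHeight (node (k, .black) l r) = blackHeight l + 1 := rfl

@[simp] lemma isRed_red (k : K) (l r : BinaryTree (K × Color)) : IsRed (node (k, .red) l r) := rfl

@[simp] lemma not_isRed_black (k : K) (l r : BinaryTree (K × Color)) :
    ¬ IsRed (node (k, .black) l r) := by
  intro h; cases h

@[simp] lemma not_isRed_nil : ¬ IsRed (nil : BinaryTree (K × Color)) := id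

lemma balanced_red (k : K) (l r : BinaryTree (K × Color)) : Balanced (node (k, .red) l r) ↔
    ¬ IsRed l ∧ ¬ IsRed r ∧ blackHeight l = blackHeight r ∧ Balanced l ∧ Balanced r := by
  simp [Balanced, and_assoc]

lemma balanced_black (k : K) (l r : BinaryTree (K × Color)) : Balanced (node (k, .black) l r) ↔
    blackHeight l = blackHeight r ∧ Balanced l ∧ Balanced r := by
  simp [Balanced]

lemma balanced_blacken {t : BinaryTree (K × Color)} (h : Balanced t) : Balanced (blacken t) := by
  rcases t with _ | ⟨⟨k, _ | _⟩, l, r⟩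
  · trivial
  · exact (balanced_black _ _ _).2 ((balanced_red _ _ _).1 h).2.2
  · exact h

lemma blackHeight_blacken {t : BinaryTree (K × Color)} (h : IsRed t) :
    blackHeight (blacken t) = blackHeight t + 1 := by
  rcases t with _ | ⟨⟨k, _ | _⟩, l, r⟩
  · exact h.elim
  · rfl
  · cases h

lemma not_isRed_blacken (t : BinaryTree (K × Color)) : ¬ IsRed (blacken t) := by
  rcases t with _ | ⟨⟨k, _ | _⟩, l, r⟩ <;> simp [blacken]

@[simp] lemma numNodes_blacken (t : BinaryTree (K × Color)) :
    (blacken t).numNodes = t.numNodes := by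
  cases t <;> rfl

@[simp] lemma isRed_mirror (t : BinaryTree (K × Color)) : IsRed (mirror t) ↔ IsRed t := by
  cases t <;> rfl

lemma blackHeight_mirror {t : BinaryTree (K × Color)} (h : Balanced t) :
    blackHeight (mirror t) = blackHeight t := by
  induction t with
  | nil => rfl
  | node e l r _ ihr =>
    obtain ⟨k, _ | _⟩ := e
    · obtain ⟨-, -, h1, -, h2⟩ := (balanced_red _ _ _).1 h
      simp [ihr h2, h1]
    · obtain ⟨h1, -, h2⟩ := (balanced_black _ _ _).1 h
      simp [ihr h2, h1]

lemma balanced_mirror {t : BinaryTree (K × Color)} (h : Balanced t) : Balanced (mirror t) := by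
  induction t with
  | nil => trivial
  | node e l r ihl ihr =>
    obtain ⟨h1, h2, h3, h4⟩ := h
    refine ⟨fun he => ?_, ?_, ihr h4, ihl h3⟩
    · rw [isRed_mirror, isRed_mirror]; exact (h1 he).symm
    · rw [blackHeight_mirror h4, blackHeight_mirror h3, h2]

lemma rank_mirror {t : BinaryTree (K × Color)} (h : Balanced t) : rank (mirror t) = rank t := by
  by_cases hr : IsRed t
  · rw [rank_of_isRed hr, rank_of_isRed ((isRed_mirror t).2 hr), blackHeight_mirror h]
  · rw [rank_of_not_isRed hr, rank_of_not_isRed (mt (isRed_mirror t).1 hr), blackHeight_mirror h]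

@[simp] lemma mirror_blacken (t : BinaryTree (K × Color)) :
    mirror (blacken t) = blacken (mirror t) := by
  cases t <;> rfl

@[simp] lemma mirror_setBlackRR (t : BinaryTree (K × Color)) :
    (setBlackRR t).mirror = setBlackLL (mirror t) := by
  rcases t with _ | ⟨e, a, _ | ⟨f, b, c⟩⟩ <;> simp [setBlackRR, setBlackLL]

lemma joinLeft_eq_mirror {tl tr : BinaryTree (K × Color)} (k : K) (hl : Balanced tl)
    (hr : Balanced tr) : joinLeft tl k tr = (joinRight k (mirror tl) (mirror tr)).mirror := by
  induction tr with
  | nil => simp [joinLeft, joinRight]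
  | node e l r ihl _ =>
    have h1 := blackHeight_mirror hr
    rw [mirror_node] at h1
    have h2 : IsRed (node e (mirror r) (mirror l)) = IsRed (node e l r) := rfl
    rw [mirror_node, joinLeft, joinRight, h1, h2, blackHeight_mirror hl, ihl hr.2.2.1]
    simp [-left, -right]

lemma join_eq_mirror_of_lt {tl tr : BinaryTree (K × Color)} (k : K × Color) (hl : Balanced tl)
    (hr : Balanced tr) (h : blackHeight tl < blackHeight tr) :
    (join tl k tr).val = mirror (join (mirror tr) k (mirror tl)).val ∧
      (join tl k tr).work = (join (mirror tr) k (mirror tl)).work + 1 := by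
  have h' : blackHeight (mirror tl) < blackHeight (mirror tr) := by
    rwa [blackHeight_mirror hl, blackHeight_mirror hr]
  unfold join
  rw [test_pos h', test_neg h.not_gt, test_pos h, joinLeft_eq_mirror k.1 hl hr]
  set s := joinRight k.1 (mirror tl) (mirror tr)
  simp only [tick_val, tick_work, bind_val, bind_work, mirror_val, mirror_work, isRed_mirror,
    left_mirror]
  by_cases h2 : IsRed s.val ∧ IsRed s.val.right
  · rw [test_pos h2, test_pos h2]; simp [setBlack]
  · rw [test_neg h2, test_neg h2]; simp

lemma Seq.setBlack (t : BinaryTree (K × Color)) : Seq (setBlack t) := (Seq.ret _).tick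

lemma Seq.setBlackRR (t : BinaryTree (K × Color)) : Seq (setBlackRR t) := by
  unfold RB.setBlackRR; split <;> exact (Seq.ret _).tick

lemma Seq.setBlackLL (t : BinaryTree (K × Color)) : Seq (setBlackLL t) := by
  unfold RB.setBlackLL; split <;> exact (Seq.ret _).tick

lemma seq_joinRight (k : K) (tr tl : BinaryTree (K × Color)) : Seq (joinRight k tr tl) := by
  induction tl with
  | nil => exact (Seq.mkNode _ _ _).tick
  | node e l r _ ih =>
    exact (Seq.mkNode _ _ _).test (Seq.tick (ih.bind fun _ => (Seq.mkNode _ _ _).bind fun _ =>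
      ((Seq.setBlackRR _).bind fun _ => Seq.rotateLeft _).test (Seq.ret _)))

lemma seq_joinLeft (tl : BinaryTree (K × Color)) (k : K) (tr : BinaryTree (K × Color)) :
    Seq (joinLeft tl k tr) := by
  induction tr with
  | nil => exact (Seq.mkNode _ _ _).tick
  | node e l r ih _ =>
    exact (Seq.mkNode _ _ _).test (Seq.tick (ih.bind fun _ => (Seq.mkNode _ _ _).bind fun _ =>
      ((Seq.setBlackLL _).bind fun _ => Seq.rotateRight _).test (Seq.ret _)))

lemma seq_join (l : BinaryTree (K × Color)) (e : K × Color) (r : BinaryTree (K × Color)) :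
    Seq (join l e r) :=
  ((seq_joinRight _ _ _).bind fun _ => (Seq.setBlack _).test (Seq.ret _)).test <|
    ((seq_joinLeft _ _ _).bind fun _ => (Seq.setBlack _).test (Seq.ret _)).test <|
    (Seq.mkNode _ _ _).test (Seq.mkNode _ _ _)

/-- Balanced, except that the root and its right child may both be red, in which case the right
child may also have a red child; blackening the right child makes up for both. -/
def AlmostBalanced (t : BinaryTree (K × Color)) : Prop :=
  (¬ (IsRed t ∧ IsRed t.right) → Balanced t) ∧
    (IsRed t → IsRed t.right → ¬ IsRed t.left ∧ Balanced t.left ∧ Balanced (blacken t.right) ∧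
      blackHeight t.left = blackHeight t.right)

lemma Balanced.almostBalanced {t : BinaryTree (K × Color)} (h : Balanced t) :
    AlmostBalanced t := by
  refine ⟨fun _ => h, fun h1 h2 => ?_⟩
  rcases t with _ | ⟨⟨k, _ | _⟩, l, r⟩
  · exact h1.elim
  · exact (((balanced_red _ _ _).1 h).2.1 h2).elim
  · cases h1

/-- Below a black node a violation of the red rule is repaired at once; below a red node it is left
to the black parent of that node, and the tree becomes balanced by making the root black. -/
lemma joinRight_spec (k : K) {tr tl : BinaryTree (K × Color)} (hr : Balanced tr)
    (hl : Balanced tl) (h : blackHeight tr ≤ blackHeight tl) :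
    let s := joinRight k tr tl
    blackHeight s.val = blackHeight tl ∧ s.val.numNodes = tl.numNodes + tr.numNodes + 1 ∧
      AlmostBalanced s.val ∧
      (¬ IsRed tl ∨ blackHeight tr < blackHeight tl → Balanced (blacken s.val)) ∧
      (¬ IsRed tl → blackHeight tr < blackHeight tl → Balanced s.val) ∧
      (IsRed tl → IsRed s.val) ∧
      s.work + 6 * (2 * blackHeight tr) ≤ 6 * rank tl + 2 := by
  have base : ∀ {c : BinaryTree (K × Color)}, Balanced c → ¬ IsRed c →
      blackHeight c = blackHeight tr → AlmostBalanced (node (k, .red) c tr) ∧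
      Balanced (blacken (node (k, .red) c tr)) := by
    intro c h1 h2 h3
    refine ⟨⟨fun h4 => ?_, fun _ h5 => ⟨h2, h1, balanced_blacken hr, h3⟩⟩,
      (balanced_black _ _ _).2 ⟨h3, h1, hr⟩⟩
    rw [balanced_red]
    exact ⟨h2, fun h5 => h4 ⟨rfl, h5⟩, h3, h1, hr⟩
  induction tl with
  | nil =>
    have h0 : blackHeight (nil : BinaryTree (K × Color)) = blackHeight tr := by
      simp only [blackHeight] at h ⊢; omega
    obtain ⟨b1, b2⟩ := base hl not_isRed_nil h0
    simp only [joinRight, tick_val, mkNode_val, tick_work, mkNode_work]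
    refine ⟨rfl, by simp, b1, fun _ => b2, fun _ h' => absurd h' (by omega), fun h' => h'.elim, ?_⟩
    simp only [blackHeight] at h0
    omega
  | node e l r _ ih =>
    rw [joinRight]
    by_cases hb : ¬ IsRed (node e l r) ∧ blackHeight (node e l r) = blackHeight tr
    · obtain ⟨b1, b2⟩ := base hl hb.1 hb.2
      rw [test_pos hb]
      simp only [tick_val, mkNode_val, tick_work, mkNode_work]
      refine ⟨rfl, by simp, b1, fun _ => b2, fun _ h' => absurd h' (by omega),
        fun h' => (hb.1 h').elim, ?_⟩
      rw [rank_of_not_isRed hb.1]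
      omega
    rw [test_neg hb]
    obtain ⟨k', _ | _⟩ := e
    · obtain ⟨r1, r2, r3, r4, r5⟩ := (balanced_red _ _ _).1 hl
      obtain ⟨i1, i2, i3, i4, i5, -, i7⟩ := ih r5 (by simpa [r3] using h)
      simp only [tick_val, tick_work, bind_val, bind_work, mkNode_val, mkNode_work]
      rw [test_neg (by simp)]
      simp only [tick_val, ret_val, tick_work, ret_work]
      set s := joinRight k tr r
      have hbal : ¬ IsRed s.val → Balanced s.val := fun hs => i3.1 fun h1 => hs h1.1
      refine ⟨rfl, by simp only [numNodes]; omega, ⟨fun h1 => ?_, fun _ h2 => ?_⟩, fun h1 => ?_,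
        fun h1 => (h1 rfl).elim, fun _ => rfl, ?_⟩
      · have hs : ¬ IsRed s.val := fun hs => h1 ⟨rfl, hs⟩
        exact (balanced_red _ _ _).2 ⟨r1, hs, r3.trans i1.symm, r4, hbal hs⟩
      · exact ⟨r1, r4, i4 (Or.inl r2), r3.trans i1.symm⟩
      · have h2 : blackHeight tr < blackHeight r := by
          rcases h1 with h1 | h1
          · exact (h1 rfl).elim
          · simpa [r3] using h1
        exact (balanced_black _ _ _).2 ⟨r3.trans i1.symm, r4, i5 r2 h2⟩
      · rw [rank_of_not_isRed r2] at i7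
        rw [rank_of_isRed (by simp)]
        simp only [blackHeight_red]
        omega
    · obtain ⟨r3, r4, r5⟩ := (balanced_black _ _ _).1 hl
      have hlt : blackHeight tr < blackHeight l + 1 :=
        lt_of_le_of_ne (by simpa using h) fun h1 => hb ⟨by simp, by simpa using h1.symm⟩
      obtain ⟨i1, i2, i3, i4, i5, -, i7⟩ := ih r5 (by omega)
      simp only [tick_val, tick_work, bind_val, bind_work, mkNode_val, mkNode_work]
      set s := joinRight k tr r
      have hrank : rank r + 1 ≤ rank (node (k', Color.black) l r) := by
        rw [rank_of_not_isRed (not_isRed_black _ _ _), blackHeight_black]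
        have := rank_le r
        omega
      suffices H : ∀ t : Cost (BinaryTree (K × Color)),
          Balanced t.val → blackHeight t.val = blackHeight l + 1 →
          t.val.numNodes = l.numNodes + s.val.numNodes + 1 → t.work ≤ 3 →
          (blackHeight t.val = blackHeight (node (k', Color.black) l r) ∧
          t.val.numNodes = (node (k', Color.black) l r).numNodes + tr.numNodes + 1 ∧
          AlmostBalanced t.val ∧
          (¬ IsRed (node (k', Color.black) l r) ∨
            blackHeight tr < blackHeight (node (k', Color.black) l r) →
            Balanced (blacken t.val)) ∧
          (¬ IsRed (node (k', Color.black) l r) →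
            blackHeight tr < blackHeight (node (k', Color.black) l r) → Balanced t.val) ∧
          (IsRed (node (k', Color.black) l r) → IsRed t.val) ∧
          s.work + (1 + t.work) + 1 + 1 + 6 * (2 * blackHeight tr) ≤
            6 * rank (node (k', Color.black) l r) + 2) by
        refine H _ ?_ ?_ ?_ ?_
        all_goals
          by_cases h1 : IsRed s.val ∧ IsRed s.val.right
          · rw [test_pos (by exact ⟨trivial, h1⟩)]
            rcases hs : s.val with _ | ⟨⟨k₁, _ | _⟩, l₁, r₁⟩
            · rw [hs] at h1; exact h1.1.elim
            · rw [hs] at h1 i1 i3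
              obtain ⟨j1, j2, j3, j4⟩ := i3.2 h1.1 h1.2
              have h12 : IsRed r₁ := h1.2
              simp only [left, right, blackHeight_red] at j1 j2 j3 j4 h1 i1
              simp only [setBlackRR, rotateLeft, tick_val, bind_val, ret_val, tick_work,
                bind_work, ret_work]
              first
              | exact (balanced_red _ _ _).2 ⟨not_isRed_black _ _ _, not_isRed_blacken _,
                  by rw [blackHeight_black, blackHeight_blacken h12]; omega,
                  (balanced_black _ _ _).2 ⟨by omega, r4, j2⟩, j3⟩
              | simp; done
              | simp; omega
            · rw [hs] at h1; exact (not_isRed_black _ _ _ h1.1).elim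
          · rw [test_neg fun h2 => h1 h2.2]
            simp only [tick_val, ret_val, tick_work, ret_work]
            first
            | exact (balanced_black _ _ _).2 ⟨by omega, r4, i3.1 h1⟩
            | simp
      intro t t1 t2 t3 t4
      refine ⟨t2, ?_, Balanced.almostBalanced t1, fun _ => balanced_blacken t1, fun _ _ => t1,
        fun h1 => (not_isRed_black _ _ _ h1).elim, ?_⟩
      · simp only [numNodes]; omega
      · omega

/-- The specification of `join` in the case that the first tree has the larger black height. -/
lemma join_spec_of_lt (k : K × Color) {tl tr : BinaryTree (K × Color)} (hl : Balanced tl)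
    (hr : Balanced tr) (h : blackHeight tr < blackHeight tl) :
    let s := join tl k tr
    Balanced s.val ∧ s.val.numNodes = tl.numNodes + tr.numNodes + 1 ∧
      rank tl ≤ rank s.val ∧ rank s.val ≤ rank tl + 1 ∧
      s.work + 6 * rank tr ≤ 6 * rank tl + 11 := by
  obtain ⟨i1, i2, i3, i4, i5, i6, i7⟩ := joinRight_spec k.1 hr hl h.le
  have hrr := rank_le tr
  unfold join
  rw [test_pos h]
  simp only [tick_val, tick_work, bind_val, bind_work]
  set s := joinRight k.1 tr tl
  by_cases h1 : IsRed s.val ∧ IsRed s.val.right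
  · rw [test_pos h1]
    simp only [setBlack, tick_val, ret_val, tick_work, ret_work]
    have j1 : IsRed tl := by
      by_contra hn
      have := (Balanced.almostBalanced (i5 hn h))
      rcases hs : s.val with _ | ⟨⟨k₁, _ | _⟩, l₁, r₁⟩
      · rw [hs] at h1; exact h1.1.elim
      · have j := i5 hn h
        rw [hs] at j h1
        exact ((balanced_red _ _ _).1 j).2.1 h1.2
      · rw [hs] at h1; exact not_isRed_black _ _ _ h1.1
    have j2 := rank_of_isRed j1
    have j3 := rank_of_not_isRed (not_isRed_blacken s.val)
    rw [blackHeight_blacken h1.1, i1] at j3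
    refine ⟨i4 (Or.inr h), by simpa using i2, by omega, by omega, by omega⟩
  · rw [test_neg h1]
    simp only [tick_val, ret_val, tick_work, ret_work]
    refine ⟨i3.1 h1, i2, ?_, ?_, by omega⟩
    · by_cases j1 : IsRed tl
      · rw [rank_of_isRed j1, rank_of_isRed (i6 j1)]; omega
      · rw [rank_of_not_isRed j1, ← i1]; exact two_mul_blackHeight_le_rank _
    · have := rank_le s.val
      have := two_mul_blackHeight_le_rank tl
      omega

lemma rank_lt_of_blackHeight_lt {tl tr : BinaryTree (K × Color)}
    (h : blackHeight tr < blackHeight tl) : rank tr < rank tl := by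
  have := rank_le tr
  have := two_mul_blackHeight_le_rank tl
  omega

lemma join_spec (k : K × Color) {tl tr : BinaryTree (K × Color)} (hl : Balanced tl)
    (hr : Balanced tr) :
    let s := join tl k tr
    Balanced s.val ∧ s.val.numNodes = tl.numNodes + tr.numNodes + 1 ∧
      max (rank tl) (rank tr) ≤ rank s.val ∧ rank s.val ≤ max (rank tl) (rank tr) + 1 ∧
      s.work + 6 * min (rank tl) (rank tr) ≤ 6 * max (rank tl) (rank tr) + 12 := by
  rcases lt_trichotomy (blackHeight tl) (blackHeight tr) with h | h | h
  · have h1 := rank_lt_of_blackHeight_lt h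
    obtain ⟨e1, e2⟩ := join_eq_mirror_of_lt k hl hr h
    have hl' := balanced_mirror hl
    have hr' := balanced_mirror hr
    obtain ⟨i1, i2, i3, i4, i5⟩ := join_spec_of_lt k hr' hl'
      (by rwa [blackHeight_mirror hl, blackHeight_mirror hr])
    rw [rank_mirror hl, rank_mirror hr] at *
    simp only [numNodes_mirror] at i2
    simp only [e1, e2]
    rw [numNodes_mirror, rank_mirror i1]
    refine ⟨balanced_mirror i1, ?_, ?_, ?_, ?_⟩ <;> omega
  · have h1 := rank_le tl
    have h2 := rank_le tr
    have h3 := two_mul_blackHeight_le_rank tl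
    have h4 := two_mul_blackHeight_le_rank tr
    unfold join
    rw [test_neg (by omega), test_neg (by omega)]
    by_cases hred : ¬ IsRed tl ∧ ¬ IsRed tr
    · have h5 := rank_of_not_isRed hred.1
      have h6 := rank_of_not_isRed hred.2
      have h7 : rank (node (k.1, Color.red) tl tr) = 2 * blackHeight tl + 1 := rfl
      rw [test_pos hred]
      simp only [tick_val, mkNode_val, tick_work, mkNode_work]
      refine ⟨(balanced_red _ _ _).2 ⟨hred.1, hred.2, h, hl, hr⟩, by simp, ?_, ?_, ?_⟩ <;> omega
    · have h7 : rank (node (k.1, Color.black) tl tr) = 2 * blackHeight tl + 2 := rfl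
      have h8 : max (rank tl) (rank tr) = 2 * blackHeight tl + 1 := by
        by_cases h9 : IsRed tl
        · have := rank_of_isRed h9; omega
        · have := rank_of_isRed (not_not.1 fun h10 => hred ⟨h9, h10⟩); omega
      rw [test_neg hred]
      simp only [tick_val, mkNode_val, tick_work, mkNode_work]
      refine ⟨(balanced_black _ _ _).2 ⟨h, hl, hr⟩, by simp, ?_, ?_, ?_⟩ <;> omega
  · have h1 := rank_lt_of_blackHeight_lt h
    obtain ⟨i1, i2, i3, i4, i5⟩ := join_spec_of_lt k hl hr h
    refine ⟨i1, i2, ?_, ?_, ?_⟩ <;> omega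

lemma rank_child {e : K × Color} {l r : BinaryTree (K × Color)} (h : Balanced (node e l r)) :
    rank l + 1 ≤ rank (node e l r) ∧ rank (node e l r) ≤ rank l + 2 ∧
      rank r + 1 ≤ rank (node e l r) ∧ rank (node e l r) ≤ rank r + 2 := by
  have h1 := rank_le l
  have h2 := rank_le r
  have h3 := two_mul_blackHeight_le_rank l
  have h4 := two_mul_blackHeight_le_rank r
  obtain ⟨k, _ | _⟩ := e
  · obtain ⟨r1, r2, r3, -, -⟩ := (balanced_red _ _ _).1 h
    have h5 := rank_of_not_isRed r1
    have h6 := rank_of_not_isRed r2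
    have h7 : rank (node (k, Color.red) l r) = 2 * blackHeight l + 1 := rfl
    refine ⟨?_, ?_, ?_, ?_⟩ <;> omega
  · obtain ⟨r3, -, -⟩ := (balanced_black _ _ _).1 h
    have h7 : rank (node (k, Color.black) l r) = 2 * blackHeight l + 2 := rfl
    refine ⟨?_, ?_, ?_, ?_⟩ <;> omega

/-- From a node to a child `rank` drops by one or two, so that half of it is a rank function. -/
lemma isJoinScheme : IsJoinScheme (join (K := K)) Balanced
    (fun t => (rank t : ℝ) / 2) (1 / 2) 12 where
  δ_pos := by norm_num
  c_nonneg := by norm_num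
  bal_nil := trivial
  bal_left h := h.2.2.1
  bal_right h := h.2.2.2
  rk_nil := by simp [rank]
  rk_left_ge {e l r} h := by
    have : (rank (node e l r) : ℝ) ≤ rank l + 2 := by exact_mod_cast (rank_child h).2.1
    linarith
  rk_right_ge {e l r} h := by
    have : (rank (node e l r) : ℝ) ≤ rank r + 2 := by exact_mod_cast (rank_child h).2.2.2
    linarith
  rk_left_le {e l r} h := by
    have : (rank l : ℝ) + 1 ≤ rank (node e l r) := by exact_mod_cast (rank_child h).1
    linarith
  rk_right_le {e l r} h := by
    have : (rank r : ℝ) + 1 ≤ rank (node e l r) := by exact_mod_cast (rank_child h).2.2.1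
    linarith
  bal_join hl hr := (join_spec _ hl hr).1
  numNodes_join hl hr := (join_spec _ hl hr).2.1
  le_rk_join_left {e l r} hl hr := by
    have := (le_max_left _ _).trans (join_spec e hl hr).2.2.1
    have : (rank l : ℝ) ≤ rank (join l e r).val := by exact_mod_cast this
    linarith
  le_rk_join_right {e l r} hl hr := by
    have := (le_max_right _ _).trans (join_spec e hl hr).2.2.1
    have : (rank r : ℝ) ≤ rank (join l e r).val := by exact_mod_cast this
    linarith
  rk_join_le {e l r e' l' r' x} h hl hr _ h1 h2 := by
    have h3 := (join_spec e' hl hr).2.2.2.1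
    have h4 : (rank (join l' e' r').val : ℝ) ≤ max (rank l' : ℝ) (rank r') + 1 := by
      exact_mod_cast h3
    have h5 : (rank l : ℝ) + 1 ≤ rank (node e l r) := by exact_mod_cast (rank_child h).1
    have h6 : (rank r : ℝ) + 1 ≤ rank (node e l r) := by exact_mod_cast (rank_child h).2.2.1
    rcases max_cases (rank l' : ℝ) (rank r') with ⟨h7, _⟩ | ⟨h7, _⟩ <;> linarith
  work_join {e l r} hl hr := by
    have h1 := (join_spec e hl hr).2.2.2.2
    have h2 : ((join l e r).work : ℝ) + 6 * min (rank l : ℝ) (rank r) ≤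
        6 * max (rank l : ℝ) (rank r) + 12 := by exact_mod_cast h1
    have h3 := max_sub_min_eq_abs (rank r : ℝ) (rank l)
    rw [max_comm, min_comm] at h3
    have h4 : |(rank l : ℝ) / 2 - (rank r : ℝ) / 2| = |(rank l : ℝ) - rank r| / 2 := by
      rw [← sub_div, abs_div, abs_two]
    rw [h4]
    linarith
  seq_join := seq_join

end RB

/-! ### Weight-balanced trees -/

namespace WB

variable {K : Type u} {α : ℝ}

lemma like_comm (α : ℝ) (a b : ℕ) : Like α a b ↔ Like α b a := by
  rcases Nat.eq_zero_or_pos (a + b) with h | h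
  · obtain ⟨rfl, rfl⟩ : a = 0 ∧ b = 0 := by omega
    rfl
  · have h1 : (0 : ℝ) < ((a + b : ℕ) : ℝ) := by exact_mod_cast h
    have h2 : (a : ℝ) / ((a + b : ℕ) : ℝ) = 1 - (b : ℝ) / ((b + a : ℕ) : ℝ) := by
      rw [add_comm b a, eq_sub_iff_add_eq, ← add_div, ← Nat.cast_add, div_self h1.ne']
    unfold Like
    rw [h2]
    constructor <;> rintro ⟨h3, h4⟩ <;> constructor <;> linarith

/-- Neither of two like weights exceeds `(1 - α) / α` times the other one. -/
lemma like_iff {a b : ℕ} (h : 0 < a) :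
    Like α a b ↔ α * b ≤ (1 - α) * a ∧ α * a ≤ (1 - α) * b := by
  have h1 : (0 : ℝ) < ((a + b : ℕ) : ℝ) := by exact_mod_cast (by omega : 0 < a + b)
  unfold Like
  rw [le_div_iff₀ h1, div_le_iff₀ h1]
  push_cast
  constructor <;> rintro ⟨h3, h4⟩ <;> constructor <;> linarith

lemma balanced_mirror (t : BinaryTree K) : Balanced α (mirror t) ↔ Balanced α t := by
  induction t with
  | nil => rfl
  | node e l r ihl ihr =>
    simp only [mirror_node, Balanced, numLeaves_mirror, ihl, ihr, like_comm α r.numLeaves]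
    tauto

lemma joinLeft_eq_mirror (α : ℝ) (tl : BinaryTree K) (k : K) (tr : BinaryTree K) :
    joinLeft α tl k tr = (joinRight α k (mirror tl) (mirror tr)).mirror := by
  induction tr with
  | nil => simp [joinLeft, joinRight]
  | node e l r ihl _ =>
    simp [joinLeft, joinRight, ihl, like_comm, add_comm, -left, -right]

lemma seq_joinRight (α : ℝ) (k : K) (tr tl : BinaryTree K) : Seq (joinRight α k tr tl) := by
  induction tl with
  | nil => exact (Seq.mkNode _ _ _).tick
  | node e l r _ ih =>
    exact Seq.tick ((Seq.mkNode _ _ _).test (ih.bind fun _ => Seq.tick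
      ((Seq.mkNode _ _ _).test (((Seq.mkNode _ _ _).bind fun _ => Seq.rotateLeft _).test
        ((Seq.rotateRight _).bind fun _ => (Seq.mkNode _ _ _).bind fun _ => Seq.rotateLeft _)))))

lemma seq_join (α : ℝ) (l : BinaryTree K) (e : K) (r : BinaryTree K) : Seq (join α l e r) := by
  refine (seq_joinRight _ _ _ _).test (Seq.test ?_ (Seq.mkNode _ _ _))
  rw [joinLeft_eq_mirror]
  exact seq_joinRight _ _ _ _

/-- What is used of the condition `0 < α ≤ 1 - 1 / √2`. -/
structure Admissible (α : ℝ) : Prop where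
  pos : 0 < α
  le : α ≤ 3 / 10
  quad : 0 ≤ 1 - 4 * α + 2 * α ^ 2

lemma admissible (h1 : 2 / 11 < α) (h2 : α ≤ 1 - 1 / Real.sqrt 2) : Admissible α := by
  have h3 : 0 < Real.sqrt 2 := by positivity
  have h4 : (1 / Real.sqrt 2) ^ 2 = 1 / 2 := by rw [div_pow, Real.sq_sqrt (by norm_num)]; norm_num
  have h5 : 0 < 1 / Real.sqrt 2 := by positivity
  have h6 : 1 / 2 ≤ (1 - α) ^ 2 := by
    rw [← h4]; exact pow_le_pow_left₀ h5.le (by linarith) 2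
  exact ⟨by linarith, by nlinarith, by nlinarith⟩

section Rotations

/-! The weights at a node that has become unbalanced: `x` is the weight of its left subtree, `v` and
`t` are those of the subtrees of its right child, `y` and `z` those of the subtrees of the inner
grandchild, and `s` is the total. -/

variable {x v t s y z : ℝ}

/-- A single rotation restores the balance if the outer grandchild is heavy enough. -/
lemma single_rotation (ha : Admissible α) (hs : x + v + t = s) (hx : x < α * s)
    (hx' : α * (1 - α) * s ≤ x) (hv : α * t ≤ (1 - α) * v) (h : α * s ≤ t) (hs0 : 0 < s) :
    (α * v ≤ (1 - α) * x ∧ α * x ≤ (1 - α) * v) ∧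
      (α * t ≤ (1 - α) * (x + v) ∧ α * (x + v) ≤ (1 - α) * t) := by
  obtain ⟨a0, a1, a2⟩ := ha
  have e1 : 0 < α * s := by positivity
  subst hs
  refine ⟨⟨?_, ?_⟩, ?_, by linarith⟩
  · have : v ≤ (x + v + t) - x - α * (x + v + t) := by linarith
    have := mul_le_mul_of_nonneg_left this a0.le
    linarith
  · have f1 : α * ((x + v + t) - x) ≤ v := by linarith
    have f2 : α * ((1 - α) * (x + v + t)) ≤ v := by nlinarith
    have f3 : α * (α * (x + v + t)) ≤ (1 - α) * (α * ((1 - α) * (x + v + t))) := by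
      have : 0 ≤ (1 - α) ^ 2 - α := by nlinarith
      nlinarith [mul_nonneg e1.le this]
    nlinarith
  · have f1 : t ≤ (1 - α) * (v + t) := by linarith
    have : 0 ≤ x := le_trans (by nlinarith [mul_pos e1 (by linarith : 0 < 1 - α)]) hx'
    have : (1 - α) * (v + t) ≤ (1 - α) * (x + v + t) := by
      apply mul_le_mul_of_nonneg_left _ (by linarith); linarith
    linarith

/-- A double rotation restores the balance if the outer grandchild is not heavy enough for a
single one. -/
lemma double_rotation (ha : Admissible α) (hs : x + v + t = s) (hyz : y + z = v)
    (hx : x < α * s) (hx' : α * (1 - α) * s ≤ x) (hv : α * t ≤ (1 - α) * v)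
    (ht : α * v ≤ (1 - α) * t) (hy : α * z ≤ (1 - α) * y) (hz : α * y ≤ (1 - α) * z)
    (h : t < α * s) (hs0 : 0 < s) :
    (α * y ≤ (1 - α) * x ∧ α * x ≤ (1 - α) * y) ∧
      (α * t ≤ (1 - α) * z ∧ α * z ≤ (1 - α) * t) ∧
      (α * (z + t) ≤ (1 - α) * (x + y) ∧ α * (x + y) ≤ (1 - α) * (z + t)) := by
  obtain ⟨a0, a1, a2⟩ := ha
  have b0 : 0 < 1 - α := by linarith
  have e1 : 0 < α * s := by positivity
  subst hs hyz
  have e2 : (1 - 2 * α) * (x + (y + z) + t) ≤ (y + z) := by linarith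
  have e3 : α * (y + z) ≤ y := by linarith
  have e4 : α * (y + z) ≤ z := by linarith
  have e5 : α * (α * (x + (y + z) + t)) ≤ (1 - α) * (α * (y + z)) := by
    have : (1 - α) * (α * ((1 - 2 * α) * (x + (y + z) + t))) ≤ (1 - α) * (α * (y + z)) := by gcongr
    have : 0 ≤ α * (x + (y + z) + t) * (1 - 4 * α + 2 * α ^ 2) := by positivity
    nlinarith
  have e6 : (y + z) ≤ (1 - α) * ((x + (y + z) + t) - x) := by linarith
  have e7 : y ≤ (1 - α) * (y + z) := by linarith
  have x0 : 0 ≤ x := le_trans (by nlinarith [mul_pos e1 b0]) hx'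
  have v0 : 0 ≤ (y + z) := le_trans (by nlinarith) e2
  refine ⟨⟨?_, ?_⟩, ⟨?_, ?_⟩, ?_, ?_⟩
  · have f1 : y ≤ (1 - α) * ((1 - α) * (x + (y + z) + t)) := by
      refine e7.trans ?_
      gcongr
      refine e6.trans ?_
      gcongr
      linarith
    calc α * y ≤ α * ((1 - α) * ((1 - α) * (x + (y + z) + t))) := by gcongr
      _ = (1 - α) * (α * (1 - α) * (x + (y + z) + t)) := by ring
      _ ≤ (1 - α) * x := by gcongr
  · calc α * x ≤ α * (α * (x + (y + z) + t)) := by gcongr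
      _ ≤ (1 - α) * (α * (y + z)) := e5
      _ ≤ (1 - α) * y := by gcongr
  · calc α * t ≤ α * (α * (x + (y + z) + t)) := by gcongr
      _ ≤ (1 - α) * (α * (y + z)) := e5
      _ ≤ (1 - α) * z := by gcongr
  · have : z ≤ (y + z) := by nlinarith
    calc α * z ≤ α * (y + z) := by gcongr
      _ ≤ (1 - α) * t := ht
  · suffices α * (x + (y + z) + t) ≤ x + y by linarith
    have f1 : (1 - α) * (x + (y + z) + t) - x ≤ (y + z) := by linarith
    have f2 : α * ((1 - α) * (x + (y + z) + t) - x) ≤ y :=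
      (mul_le_mul_of_nonneg_left f1 a0.le).trans e3
    have f3 : (1 - α) * (α * (1 - α) * (x + (y + z) + t)) ≤ (1 - α) * x := by gcongr
    have f4 : 0 ≤ α * (x + (y + z) + t) * (1 - 3 * α + α ^ 2) := mul_nonneg e1.le (by nlinarith)
    nlinarith
  · suffices α * (x + (y + z) + t) ≤ z + t by linarith
    have f1 : (1 - α) * (y + z) ≤ (1 - α) * ((1 - α) * ((x + (y + z) + t) - x)) := by gcongr
    have f2 : (1 - α) * (x + (y + z) + t) ≤ (x + (y + z) + t) - x := by linarith
    have f3 : (2 * α - α ^ 2) * ((1 - α) * (x + (y + z) + t)) ≤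
        (2 * α - α ^ 2) * ((x + (y + z) + t) - x) := by
      apply mul_le_mul_of_nonneg_left f2; nlinarith
    have f4 : 0 ≤ α * (x + (y + z) + t) * (1 - 3 * α + α ^ 2) := mul_nonneg e1.le (by nlinarith)
    linarith

end Rotations

/-- The logarithm of the weight to the base `1 / α`. -/
def rank (α : ℝ) (t : BinaryTree K) : ℝ := Real.logb α⁻¹ t.numLeaves

/-- The rank drops at least by this number from a node to its children. -/
def drop (α : ℝ) : ℝ := Real.logb α⁻¹ (1 - α)⁻¹

lemma one_le_numLeaves (t : BinaryTree K) : (1 : ℝ) ≤ t.numLeaves := by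
  exact_mod_cast numLeaves_pos t

lemma Admissible.one_lt_inv (ha : Admissible α) : 1 < α⁻¹ :=
  (one_lt_inv₀ ha.pos).2 (by linarith [ha.le])

lemma drop_pos (ha : Admissible α) : 0 < drop α :=
  Real.logb_pos ha.one_lt_inv
    ((one_lt_inv₀ (by linarith [ha.le])).2 (by linarith [ha.pos]))

lemma rank_mirror (t : BinaryTree K) : rank α (mirror t) = rank α t := by
  simp [rank]

lemma le_of_balanced {e : K} {l r : BinaryTree K} (h : Balanced α (node e l r)) :
    (α * (node e l r).numLeaves ≤ l.numLeaves ∧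
      l.numLeaves ≤ (1 - α) * (node e l r).numLeaves) ∧
    (α * (node e l r).numLeaves ≤ r.numLeaves ∧
      r.numLeaves ≤ (1 - α) * (node e l r).numLeaves) := by
  obtain ⟨h1, h2⟩ := (like_iff (numLeaves_pos l)).1 h.1
  simp only [numLeaves]
  push_cast
  refine ⟨⟨?_, ?_⟩, ?_, ?_⟩ <;> linarith

lemma rank_ge_of_le (ha : Admissible α) {t t' : BinaryTree K}
    (h : α * (t.numLeaves : ℝ) ≤ t'.numLeaves) : rank α t - 1 ≤ rank α t' := by
  have h1 := one_le_numLeaves t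
  have h2 := Real.logb_le_logb_of_le ha.one_lt_inv (mul_pos ha.pos (by linarith)) h
  rw [Real.logb_mul ha.pos.ne' (by linarith), ← inv_inv α, Real.logb_inv, inv_inv α,
    Real.logb_self_eq_one ha.one_lt_inv] at h2
  unfold rank
  linarith

lemma rank_le_of_le (ha : Admissible α) {t t' : BinaryTree K}
    (h : (t'.numLeaves : ℝ) ≤ (1 - α) * t.numLeaves) : rank α t' ≤ rank α t - drop α := by
  have h1 := one_le_numLeaves t
  have h3 : 0 < 1 - α := by linarith [ha.le]
  have h2 := Real.logb_le_logb_of_le ha.one_lt_inv (by linarith [one_le_numLeaves t']) h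
  rw [Real.logb_mul h3.ne' (by linarith)] at h2
  have h4 : drop α = - Real.logb α⁻¹ (1 - α) := by unfold drop; rw [Real.logb_inv]
  rw [h4]
  unfold rank
  linarith

lemma rank_mono (ha : Admissible α) {t t' : BinaryTree K} (h : t.numLeaves ≤ t'.numLeaves) :
    rank α t ≤ rank α t' :=
  Real.logb_le_logb_of_le ha.one_lt_inv (by linarith [one_le_numLeaves t]) (by exact_mod_cast h)

/-- The new right subtree of a node with left subtree `l` outweighs the former one, `c`, by less
than `α / (1 - α)` times the weight of the node. -/
lemma joinRight_spec (ha : Admissible α) (k : K) {tr tl : BinaryTree K} (hr : Balanced α tr)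
    (hl : Balanced α tl) (h : α * (tr.numLeaves : ℝ) ≤ (1 - α) * tl.numLeaves) :
    let s := joinRight α k tr tl
    Balanced α s.val ∧ s.val.numLeaves = tl.numLeaves + tr.numLeaves ∧
      drop α * s.work ≤ 8 * (rank α tl - rank α tr) + (3 * drop α + 8) := by
  have hα := ha.pos
  have hα' := ha.le
  have hd := drop_pos ha
  have hrank : ∀ {c : BinaryTree K}, α * (tr.numLeaves : ℝ) ≤ (1 - α) * c.numLeaves →
      0 ≤ 8 * (rank α c - rank α tr) + 8 := by
    intro c hc
    have := rank_ge_of_le ha (t := tr) (t' := c) (by nlinarith [one_le_numLeaves c])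
    linarith
  induction tl with
  | nil =>
    simp only [joinRight, tick_val, mkNode_val, tick_work, mkNode_work]
    refine ⟨⟨(like_iff (numLeaves_pos _)).2 ⟨h, ?_⟩, trivial, hr⟩, rfl, ?_⟩
    · have := one_le_numLeaves tr
      simp only [numLeaves, Nat.cast_one, mul_one]
      nlinarith
    · have := hrank h
      push_cast
      linarith
  | node k' l c _ ih =>
    rw [joinRight]
    by_cases hb : Like α (node k' l c).numLeaves tr.numLeaves
    · rw [test_pos hb]
      simp only [tick_val, mkNode_val, tick_work, mkNode_work]
      refine ⟨⟨hb, hl, hr⟩, rfl, ?_⟩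
      have := hrank h
      push_cast
      linarith
    rw [test_neg hb]
    have hheavy : (1 - α) * (tr.numLeaves : ℝ) < α * (node k' l c).numLeaves := by
      by_contra hn
      exact hb ((like_iff (numLeaves_pos _)).2 ⟨h, not_lt.1 hn⟩)
    obtain ⟨⟨c1, c2⟩, c3, c4⟩ := le_of_balanced hl
    have hw := one_le_numLeaves tr
    have hlight : α * (tr.numLeaves : ℝ) ≤ (1 - α) * c.numLeaves := by
      have f1 : (1 - α) * ((1 - α) * (tr.numLeaves : ℝ)) ≤ (1 - α) * c.numLeaves :=
        mul_le_mul_of_nonneg_left (hheavy.le.trans c3) (by linarith)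
      have f2 : 0 ≤ (1 - α) * (1 - α) - α := by nlinarith
      nlinarith
    obtain ⟨i1, i2, i3⟩ := ih hl.2.2 hlight
    have hdrop := rank_le_of_le ha c4
    simp only [tick_val, tick_work, bind_val, bind_work]
    set s := joinRight α k tr c
    suffices H : ∀ t : Cost (BinaryTree K), Balanced α t.val →
        t.val.numLeaves = l.numLeaves + s.val.numLeaves → t.work ≤ 5 →
        (Balanced α t.val ∧ t.val.numLeaves = (node k' l c).numLeaves + tr.numLeaves ∧
          drop α * ((s.work + (t.work + 1) + 1 + 1 : ℕ) : ℝ) ≤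
            8 * (rank α (node k' l c) - rank α tr) + (3 * drop α + 8)) by
      by_cases hlike : Like α l.numLeaves s.val.numLeaves
      · rw [test_pos hlike]
        exact H _ ⟨hlike, hl.2.1, i1⟩ rfl (by simp)
      rw [test_neg hlike]
      rcases hs : s.val with _ | ⟨k₁, l₁, r₁⟩
      · have := numLeaves_pos c
        rw [hs] at i2; simp only [numLeaves] at i2; have := numLeaves_pos tr; omega
      rw [hs] at i1 i2 hlike H
      -- the weights involved, and what is known about them
      have w1 := one_le_numLeaves l
      have w2 := one_le_numLeaves l₁
      have w3 := one_le_numLeaves r₁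
      have n1 : ((node k' l c).numLeaves : ℝ) = l.numLeaves + c.numLeaves := by simp
      have n2 : (l₁.numLeaves : ℝ) + r₁.numLeaves = c.numLeaves + tr.numLeaves := by
        exact_mod_cast i2
      have n3 : ((node k₁ l₁ r₁).numLeaves : ℝ) = l₁.numLeaves + r₁.numLeaves := by simp
      obtain ⟨g1, g2⟩ := (like_iff (numLeaves_pos _)).1 i1.1
      have hx : (l.numLeaves : ℝ) <
          α * (l.numLeaves + l₁.numLeaves + r₁.numLeaves) := by
        by_contra hn
        refine hlike ((like_iff (numLeaves_pos _)).2 ⟨?_, ?_⟩)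
        · rw [n3]; linarith
        · rw [n3, n2]
          rw [n1] at c2
          nlinarith
      have hx' : α * (1 - α) * (l.numLeaves + l₁.numLeaves + r₁.numLeaves) ≤
          (l.numLeaves : ℝ) := by
        have : (1 - α) * (l.numLeaves + l₁.numLeaves + r₁.numLeaves : ℝ) ≤
          (node k' l c).numLeaves := by
          have e : (l.numLeaves + l₁.numLeaves + r₁.numLeaves : ℝ) =
            l.numLeaves + c.numLeaves + tr.numLeaves := by linarith
          rw [n1] at hheavy
          rw [e, n1]
          linarith
        have := mul_le_mul_of_nonneg_left this hα.le
        linarith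
      have hs0 : (0 : ℝ) < l.numLeaves + l₁.numLeaves + r₁.numLeaves := by linarith
      by_cases hsingle : Like α l.numLeaves (node k₁ l₁ r₁).left.numLeaves ∧
          Like α (l.numLeaves + (node k₁ l₁ r₁).left.numLeaves) (node k₁ l₁ r₁).right.numLeaves
      · rw [test_pos hsingle]
        refine H _ ?_ ?_ ?_
        · exact ⟨hsingle.2, ⟨hsingle.1, hl.2.1, i1.2.1⟩, i1.2.2⟩
        · simp [rotateLeft, add_assoc]
        · simp
      rw [test_neg hsingle]
      have ht : (r₁.numLeaves : ℝ) < α * (l.numLeaves + l₁.numLeaves + r₁.numLeaves) := by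
        by_contra hn
        obtain ⟨j1, j2⟩ := single_rotation ha rfl hx hx' g1 (not_lt.1 hn) hs0
        refine hsingle ⟨(like_iff (numLeaves_pos _)).2 j1, (like_iff ?_).2 ?_⟩
        · exact Nat.add_pos_left (numLeaves_pos _) _
        · push_cast; exact j2
      rcases l₁ with _ | ⟨k₂, l₂, r₂⟩
      · simp only [numLeaves, Nat.cast_one] at hx ht
        nlinarith
      have n4 : ((node k₂ l₂ r₂).numLeaves : ℝ) = l₂.numLeaves + r₂.numLeaves := by simp
      obtain ⟨g3, g4⟩ := (like_iff (numLeaves_pos _)).1 i1.2.1.1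
      obtain ⟨j1, j2, j3⟩ := double_rotation ha rfl n4.symm hx hx' g1 g2 g3 g4 ht hs0
      refine H _ ?_ ?_ ?_
      · refine ⟨(like_iff (numLeaves_pos _)).2 ?_,
          ⟨(like_iff (numLeaves_pos _)).2 j1, hl.2.1, i1.2.1.2.1⟩,
          (like_iff (numLeaves_pos _)).2 j2, i1.2.1.2.2, i1.2.2⟩
        simp only [numLeaves]
        push_cast
        exact j3
      · simp [rotateLeft, rotateRight, add_assoc]
      · simp
    intro t t1 t2 t3
    refine ⟨t1, ?_, ?_⟩
    · rw [t2, i2, numLeaves]; omega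
    · have t3' : (t.work : ℝ) ≤ 5 := by exact_mod_cast t3
      have := mul_le_mul_of_nonneg_left t3' hd.le
      push_cast
      linarith

lemma heavy_iff (ha : Admissible α) {tl tr : BinaryTree K} :
    Heavy α tl tr ↔ (1 - α) * (tr.numLeaves : ℝ) < α * tl.numLeaves := by
  have h1 := one_le_numLeaves tl
  have h2 := one_le_numLeaves tr
  have hα := ha.pos
  have hα' := ha.le
  unfold Heavy
  rw [like_iff (numLeaves_pos _), not_and_or, not_le, not_le]
  constructor
  · rintro ⟨h3, h4 | h4⟩
    · have : (tr.numLeaves : ℝ) < tl.numLeaves := by exact_mod_cast h3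
      nlinarith
    · exact h4
  · intro h3
    refine ⟨?_, Or.inr h3⟩
    have : (tr.numLeaves : ℝ) < tl.numLeaves := by nlinarith
    exact_mod_cast this

/-- The constant in the cost of a join. -/
def joinFactor (α : ℝ) : ℝ := 8 * (drop α)⁻¹ + 6

lemma join_spec (ha : Admissible α) (k : K) {tl tr : BinaryTree K} (hl : Balanced α tl)
    (hr : Balanced α tr) :
    let s := join α tl k tr
    Balanced α s.val ∧ s.val.numLeaves = tl.numLeaves + tr.numLeaves ∧
      (s.work : ℝ) ≤ joinFactor α * (1 + |rank α tl - rank α tr|) := by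
  have hα := ha.pos
  have hα' := ha.le
  have hd := drop_pos ha
  have hdi := inv_pos.2 hd
  have h1 := one_le_numLeaves tl
  have h2 := one_le_numLeaves tr
  have key : ∀ {w : ℕ} {y : ℝ}, drop α * w ≤ 8 * y + (3 * drop α + 8) → ∀ {z : ℝ}, y ≤ z → 0 ≤ z →
      ((w + 3 : ℕ) : ℝ) ≤ joinFactor α * (1 + z) := by
    intro w y hwy z hyz hz
    have f1 : (w : ℝ) ≤ (drop α)⁻¹ * (8 * z + (3 * drop α + 8)) := by
      rw [inv_mul_eq_div, le_div_iff₀ hd]; linarith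
    have f2 : (drop α)⁻¹ * drop α = 1 := inv_mul_cancel₀ hd.ne'
    unfold joinFactor
    push_cast
    nlinarith
  unfold join
  by_cases hb : Heavy α tl tr
  · obtain ⟨i1, i2, i3⟩ := joinRight_spec ha k hr hl
      (by have := (heavy_iff ha).1 hb; nlinarith)
    rw [test_pos hb]
    refine ⟨i1, i2, le_trans ?_ (key i3 (le_abs_self _) (abs_nonneg _))⟩
    exact_mod_cast (by simp : _ + 1 ≤ _ + 3)
  rw [test_neg hb]
  by_cases hb' : Heavy α tr tl
  · obtain ⟨i1, i2, i3⟩ := joinRight_spec ha k ((balanced_mirror tl).2 hl)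
      ((balanced_mirror tr).2 hr) (by
        have := (heavy_iff ha).1 hb'
        rw [numLeaves_mirror, numLeaves_mirror]
        nlinarith)
    rw [rank_mirror, rank_mirror] at i3
    rw [numLeaves_mirror, numLeaves_mirror] at i2
    rw [test_pos hb', joinLeft_eq_mirror]
    simp only [tick_val, mirror_val, tick_work, mirror_work, balanced_mirror, numLeaves_mirror]
    refine ⟨i1, by omega, le_trans ?_ (key i3 (neg_sub (rank α tl) (rank α tr) ▸ neg_le_abs _)
      (abs_nonneg _))⟩
    exact_mod_cast (by omega : _ + 1 + 1 ≤ _ + 3)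
  · rw [test_neg hb']
    have h3 := not_lt.1 (mt (heavy_iff ha).2 hb)
    have h4 := not_lt.1 (mt (heavy_iff ha).2 hb')
    refine ⟨⟨(like_iff (numLeaves_pos _)).2 ⟨h4, h3⟩, hl, hr⟩, rfl, ?_⟩
    have := abs_nonneg (rank α tl - rank α tr)
    simp only [tick_work, mkNode_work]
    push_cast
    unfold joinFactor
    nlinarith [mul_nonneg hdi.le this]

lemma isJoinScheme (ha : Admissible α) :
    IsJoinScheme (join (K := K) α) (Balanced α) (rank α) (drop α) (joinFactor α) where
  δ_pos := drop_pos ha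
  c_nonneg := by have := inv_pos.2 (drop_pos ha); unfold joinFactor; positivity
  bal_nil := trivial
  bal_left h := h.2.1
  bal_right h := h.2.2
  rk_nil := by simp [rank]
  rk_left_ge h := rank_ge_of_le ha (le_of_balanced h).1.1
  rk_right_ge h := rank_ge_of_le ha (le_of_balanced h).2.1
  rk_left_le h := rank_le_of_le ha (le_of_balanced h).1.2
  rk_right_le h := rank_le_of_le ha (le_of_balanced h).2.2
  bal_join hl hr := (join_spec ha _ hl hr).1
  numNodes_join {e l r} hl hr := by
    have := (join_spec ha e hl hr).2.1
    simp only [numLeaves_eq_numNodes_succ] at this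
    omega
  le_rk_join_left {e l r} hl hr :=
    rank_mono ha (by rw [(join_spec ha e hl hr).2.1]; exact Nat.le_add_right _ _)
  le_rk_join_right {e l r} hl hr :=
    rank_mono ha (by rw [(join_spec ha e hl hr).2.1]; exact Nat.le_add_left _ _)
  rk_join_le {e l r e' l' r' x} h hl hr hx h1 h2 := by
    have h0 : 0 < α⁻¹ := inv_pos.2 ha.pos
    have key : ∀ {t t' : BinaryTree K}, rank α t' ≤ rank α t + x →
        (t'.numLeaves : ℝ) ≤ t.numLeaves * α⁻¹ ^ x := by
      intro t t' ht
      have w1 := one_le_numLeaves t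
      have w2 := one_le_numLeaves t'
      have f1 : rank α t + x = Real.logb α⁻¹ (t.numLeaves * α⁻¹ ^ x) := by
        rw [Real.logb_mul (by linarith) (by positivity),
          Real.logb_rpow h0 ha.one_lt_inv.ne']; rfl
      rw [f1] at ht
      exact (Real.logb_le_logb ha.one_lt_inv (by linarith)
        (mul_pos (by linarith) (by positivity))).1 ht
    have w1 := one_le_numLeaves (node e l r)
    have f1 : rank α (node e l r) + x = Real.logb α⁻¹ ((node e l r).numLeaves * α⁻¹ ^ x) := by
      rw [Real.logb_mul (by linarith) (by positivity),
        Real.logb_rpow h0 ha.one_lt_inv.ne']; rfl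
    rw [f1]
    refine Real.logb_le_logb_of_le ha.one_lt_inv
      (by linarith [one_le_numLeaves (join α l' e' r').val]) ?_
    rw [(join_spec ha e' hl hr).2.1]
    simp only [numLeaves]
    push_cast
    linarith [key h1, key h2]
  work_join hl hr := (join_spec ha _ hl hr).2.2
  seq_join := seq_join α

end WB

/-! ### Treaps: structure -/

namespace Treap

variable {K : Type u}

lemma le_of_leRoot {q : ℝ} {t : BinaryTree (K × ℝ)} (ht : Balanced t) (h : LeRoot q t) :
    ∀ e ∈ inorder t, q ≤ e.2 := by
  induction t with
  | nil => simp [inorder]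
  | node e l r ihl ihr =>
    obtain ⟨h1, h2, h3, h4⟩ := ht
    have h5 : q ≤ e.2 := h
    intro f hf
    simp only [inorder, List.mem_append, List.mem_cons] at hf
    rcases hf with hf | rfl | hf
    · refine ihl h3 ?_ f hf
      cases l with
      | nil => trivial
      | node g _ _ => exact h5.trans h1
    · exact h5
    · refine ihr h4 ?_ f hf
      cases r with
      | nil => trivial
      | node g _ _ => exact h5.trans h2

lemma root_mem_inorder (e : K × ℝ) (l r : BinaryTree (K × ℝ)) : e ∈ inorder (node e l r) := by
  simp [inorder]

lemma join_of_leRoot {k : K × ℝ} {tl tr : BinaryTree (K × ℝ)} (hl : LeRoot k.2 tl)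
    (hr : LeRoot k.2 tr) : join tl k tr = tick (mkNode tl k tr) := by
  rw [join.eq_def, test_pos ⟨hl, hr⟩]

lemma seq_join (tl : BinaryTree (K × ℝ)) (k : K × ℝ) (tr : BinaryTree (K × ℝ)) :
    Seq (join tl k tr) := by
  induction hn : tl.numNodes + tr.numNodes using Nat.strong_induction_on generalizing tl tr with
  | _ n ih =>
    rw [join.eq_def]
    refine (Seq.mkNode _ _ _).test ?_
    rcases tl with _ | ⟨k₁, l₁, r₁⟩ <;> rcases tr with _ | ⟨k₂, l₂, r₂⟩ <;>
      simp only [numNodes] at hn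
    · exact Seq.mkNode _ _ _
    · exact ((ih _ (by simp only [numNodes]; omega) _ _ rfl).bind fun _ => Seq.mkNode _ _ _).tick
    · exact ((ih _ (by simp only [numNodes]; omega) _ _ rfl).bind fun _ => Seq.mkNode _ _ _).tick
    · exact (Seq.test ((ih _ (by simp only [numNodes]; omega) _ _ rfl).bind fun _ =>
        Seq.mkNode _ _ _) ((ih _ (by simp only [numNodes]; omega) _ _ rfl).bind fun _ =>
        Seq.mkNode _ _ _)).tick.tick

variable [LinearOrder K] {A B X Y : Finset K} {p q pA pB : K → ℝ}
  {t t₁ t₂ tl tr : BinaryTree (K × ℝ)}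

lemma isTreapOn_nil_iff : IsTreapOn A p nil ↔ A = ∅ := by
  constructor
  · rintro ⟨-, -, h⟩
    refine Finset.eq_empty_of_forall_notMem fun a ha => ?_
    have := (h (a, p a)).2 ⟨ha, rfl⟩
    simp [inorder] at this
  · rintro rfl
    exact ⟨by simp [IsBST, inorder], trivial, by simp [inorder]⟩

lemma IsTreapOn.congr (h : IsTreapOn A p t) (hpq : ∀ x ∈ A, p x = q x) : IsTreapOn A q t := by
  refine ⟨h.1, h.2.1, fun e => (h.2.2 e).trans ⟨?_, ?_⟩⟩
  · rintro ⟨h1, h2⟩; exact ⟨h1, h2.trans (hpq _ h1)⟩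
  · rintro ⟨h1, h2⟩; exact ⟨h1, h2.trans (hpq _ h1).symm⟩

lemma IsTreapOn.leRoot (h : IsTreapOn A p t) {x : ℝ} (hx : ∀ a ∈ A, x ≤ p a) : LeRoot x t := by
  cases t with
  | nil => trivial
  | node e l r =>
    obtain ⟨h1, h2⟩ := (h.2.2 e).1 (root_mem_inorder e l r)
    exact (hx _ h1).trans h2.symm.le

/-- Taking apart a treap at its root. -/
lemma IsTreapOn.node {e : K × ℝ} {l r : BinaryTree (K × ℝ)} (h : IsTreapOn A p (node e l r)) :
    e.1 ∈ A ∧ e = (e.1, p e.1) ∧ (∀ x ∈ A, p e.1 ≤ p x) ∧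
      IsTreapOn (A.filter (· < e.1)) p l ∧ IsTreapOn (A.filter (e.1 < ·)) p r := by
  obtain ⟨h1, h2, h3⟩ := h
  obtain ⟨h4, h5⟩ := (h3 e).1 (root_mem_inorder e l r)
  have h6 := le_of_leRoot (q := e.2) h2 (le_refl e.2)
  simp only [IsBST, inorder, List.map_append, List.map_cons, List.pairwise_append,
    List.pairwise_cons, List.mem_cons, List.mem_map] at h1
  obtain ⟨b1, ⟨b2, b3⟩, b4⟩ := h1
  refine ⟨h4, Prod.ext rfl h5, fun x hx => ?_, ⟨b1, h2.2.2.1, fun f => ?_⟩,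
    ⟨b3, h2.2.2.2, fun f => ?_⟩⟩
  · rw [← h5]; exact h6 (x, p x) ((h3 (x, p x)).2 ⟨hx, rfl⟩)
  · rw [Finset.mem_filter]
    constructor
    · intro hf
      obtain ⟨c1, c2⟩ := (h3 f).1 (by simp [inorder, hf])
      exact ⟨⟨c1, b4 _ ⟨f, hf, rfl⟩ _ (Or.inl rfl)⟩, c2⟩
    · rintro ⟨⟨c1, c2⟩, c3⟩
      have := (h3 f).2 ⟨c1, c3⟩
      simp only [inorder, List.mem_append, List.mem_cons] at this
      rcases this with hf | rfl | hf
      · exact hf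
      · exact (lt_irrefl _ c2).elim
      · exact (lt_asymm c2 (b2 _ ⟨f, hf, rfl⟩)).elim
  · rw [Finset.mem_filter]
    constructor
    · intro hf
      obtain ⟨c1, c2⟩ := (h3 f).1 (by simp [inorder, hf])
      exact ⟨⟨c1, b2 _ ⟨f, hf, rfl⟩⟩, c2⟩
    · rintro ⟨⟨c1, c2⟩, c3⟩
      have := (h3 f).2 ⟨c1, c3⟩
      simp only [inorder, List.mem_append, List.mem_cons] at this
      rcases this with hf | rfl | hf
      · exact (lt_asymm c2 (b4 _ ⟨f, hf, rfl⟩ _ (Or.inl rfl))).elim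
      · exact (lt_irrefl _ c2).elim
      · exact hf

/-- Putting together a treap from its root and its subtrees. -/
lemma IsTreapOn.mk_node {k : K} {l r : BinaryTree (K × ℝ)} (hl : IsTreapOn X p l)
    (hr : IsTreapOn Y p r) (hA : ∀ x, x ∈ A ↔ x ∈ X ∨ x = k ∨ x ∈ Y) (hX : ∀ x ∈ X, x < k)
    (hY : ∀ y ∈ Y, k < y) (hpX : ∀ x ∈ X, p k ≤ p x) (hpY : ∀ y ∈ Y, p k ≤ p y) :
    IsTreapOn A p (BinaryTree.node (k, p k) l r) := by
  have memX : ∀ e ∈ inorder l, e.1 ∈ X := fun e he => ((hl.2.2 e).1 he).1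
  have memY : ∀ e ∈ inorder r, e.1 ∈ Y := fun e he => ((hr.2.2 e).1 he).1
  refine ⟨?_, ⟨hl.leRoot hpX, hr.leRoot hpY, hl.2.1, hr.2.1⟩, fun e => ?_⟩
  · simp only [IsBST, inorder, List.map_append, List.map_cons, List.pairwise_append,
      List.pairwise_cons, List.mem_cons, List.mem_map]
    refine ⟨hl.1, ⟨?_, hr.1⟩, ?_⟩
    · rintro _ ⟨e, he, rfl⟩; exact hY _ (memY e he)
    · rintro _ ⟨e, he, rfl⟩ _ (rfl | ⟨f, hf, rfl⟩)
      · exact hX _ (memX e he)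
      · exact (hX _ (memX e he)).trans (hY _ (memY f hf))
  · simp only [inorder, List.mem_append, List.mem_cons, hl.2.2, hr.2.2, hA]
    constructor
    · rintro (⟨h1, h2⟩ | rfl | ⟨h1, h2⟩)
      · exact ⟨Or.inl h1, h2⟩
      · exact ⟨Or.inr (Or.inl rfl), rfl⟩
      · exact ⟨Or.inr (Or.inr h1), h2⟩
    · rintro ⟨h1 | h1 | h1, h2⟩
      · exact Or.inl ⟨h1, h2⟩
      · exact Or.inr (Or.inl (Prod.ext h1 (h1 ▸ h2)))
      · exact Or.inr (Or.inr ⟨h1, h2⟩)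

/-! ### Records -/

/-- `x` lies strictly between `a` and `b`. -/
def Between (a x b : K) : Prop := (a < x ∧ x < b) ∨ (b < x ∧ x < a)

open Classical in
/-- The keys `a ≠ b` of `X` whose priority is minimal among the keys of `X` from `a` to `b`. In the
treap on `X` they are the keys other than `b` on the search path of `b` and, if `b` itself is a key,
on the inner spines of its subtrees. -/
def records (X : Finset K) (p : K → ℝ) (b : K) : Finset K :=
  X.filter fun a => a ≠ b ∧ ∀ x ∈ X, Between a x b → p a ≤ p x

lemma mem_records {b a : K} : a ∈ records X p b ↔
    a ∈ X ∧ a ≠ b ∧ ∀ x ∈ X, Between a x b → p a ≤ p x := by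
  simp [records]

lemma records_subset {b : K} (hYX : Y ⊆ X) (h : ∀ a ∈ Y, ∀ x ∈ X, Between a x b → x ∈ Y) :
    records Y p b ⊆ records X p b := by
  intro a ha
  obtain ⟨h1, h2, h3⟩ := mem_records.1 ha
  exact mem_records.2 ⟨hYX h1, h2, fun x hx hb => h3 x (h a h1 x hx hb) hb⟩

/-- A key of least priority is a record. -/
lemma card_records_succ_le {b m : K} (hYX : Y ⊆ X)
    (h : ∀ a ∈ Y, ∀ x ∈ X, Between a x b → x ∈ Y) (hm : m ∈ X) (hmY : m ∉ Y) (hmb : m ≠ b)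
    (hmin : ∀ x ∈ X, p m ≤ p x) : (records Y p b).card + 1 ≤ (records X p b).card := by
  have h1 : m ∉ records Y p b := fun h => hmY (mem_records.1 h).1
  rw [← Finset.card_insert_of_notMem h1]
  refine Finset.card_le_card (Finset.insert_subset ?_ (records_subset hYX h))
  exact mem_records.2 ⟨hm, hmb, fun x hx _ => hmin x hx⟩

lemma mem_filter_lt_of_between {a x b m : K} (hb : b ≤ m) (ha : a ∈ X.filter (· < m))
    (hx : x ∈ X) (h : Between a x b) : x ∈ X.filter (· < m) := by
  rw [Finset.mem_filter] at ha ⊢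
  refine ⟨hx, ?_⟩
  rcases h with h | h
  · exact h.2.trans_le hb
  · exact h.2.trans ha.2

lemma mem_filter_gt_of_between {a x b m : K} (hb : m ≤ b) (ha : a ∈ X.filter (m < ·))
    (hx : x ∈ X) (h : Between a x b) : x ∈ X.filter (m < ·) := by
  rw [Finset.mem_filter] at ha ⊢
  refine ⟨hx, ?_⟩
  rcases h with h | h
  · exact ha.2.trans h.1
  · exact hb.trans_lt h.1

lemma card_records_filter_lt {b m : K} (hb : b < m) (hm : m ∈ X) (hmin : ∀ x ∈ X, p m ≤ p x) :
    (records (X.filter (· < m)) p b).card + 1 ≤ (records X p b).card :=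
  card_records_succ_le (Finset.filter_subset _ _)
    (fun _ ha _ hx h => mem_filter_lt_of_between hb.le ha hx h) hm (by simp) hb.ne' hmin

lemma card_records_filter_gt {b m : K} (hb : m < b) (hm : m ∈ X) (hmin : ∀ x ∈ X, p m ≤ p x) :
    (records (X.filter (m < ·)) p b).card + 1 ≤ (records X p b).card :=
  card_records_succ_le (Finset.filter_subset _ _)
    (fun _ ha _ hx h => mem_filter_gt_of_between hb.le ha hx h) hm (by simp) hb.ne hmin

/-- The height of a treap is bounded by the number of ancestors of a lowest node, all of which are
records. -/
lemma IsTreapOn.height_le (h : IsTreapOn B p t) {M : ℕ}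
    (hM : ∀ b ∈ B, (records B p b).card ≤ M) : t.height ≤ M + 1 := by
  induction t generalizing B M with
  | nil => simp
  | node e l r ihl ihr =>
    obtain ⟨h1, -, h2, h3, h4⟩ := h.node
    have hl : l.height ≤ M := by
      rcases M.eq_zero_or_pos with rfl | hM0
      · cases l with
        | nil => simp
        | node f _ _ =>
          have hf := h3.node.1
          have := card_records_filter_lt (Finset.mem_filter.1 hf).2 h1 h2
          have := hM _ (Finset.mem_filter.1 hf).1
          omega
      · have := ihl h3 (M := M - 1) fun b hb => by
          have := card_records_filter_lt (Finset.mem_filter.1 hb).2 h1 h2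
          have := hM _ (Finset.mem_filter.1 hb).1
          omega
        omega
    have hr : r.height ≤ M := by
      rcases M.eq_zero_or_pos with rfl | hM0
      · cases r with
        | nil => simp
        | node f _ _ =>
          have hf := h4.node.1
          have := card_records_filter_gt (Finset.mem_filter.1 hf).2 h1 h2
          have := hM _ (Finset.mem_filter.1 hf).1
          omega
      · have := ihr h4 (M := M - 1) fun b hb => by
          have := card_records_filter_gt (Finset.mem_filter.1 hb).2 h1 h2
          have := hM _ (Finset.mem_filter.1 hb).1
          omega
        omega
    simp only [height]
    omega

/-! ### Treaps: split, join and join2 -/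

/-- The nodes on the search path of `k` are records for `k`. The joins of a split take constant
time: the middle key is an ancestor of all keys involved, so that its priority is the least. -/
lemma split_spec (h : IsTreapOn A p t) (k : K) :
    let s := split Prod.fst join k t
    IsTreapOn (A.filter (· < k)) p s.val.1 ∧ IsTreapOn (A.filter (k < ·)) p s.val.2.2 ∧
      (s.val.2.1 = true ↔ k ∈ A) ∧ s.work ≤ 6 * (records A p k).card + 3 := by
  induction t generalizing A with
  | nil =>
    obtain rfl := isTreapOn_nil_iff.1 h
    simp only [split_nil, tick_val, ret_val, tick_work, ret_work]
    exact ⟨h, h, by simp, by omega⟩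
  | node m l r ihl ihr =>
    obtain ⟨h1, h2, h3, h4, h5⟩ := h.node
    have hm : m.2 = p m.1 := congrArg Prod.snd h2
    rcases lt_trichotomy k m.1 with hk | hk | hk
    · obtain ⟨i1, i2, i3, i4⟩ := ihl h4
      have hc := card_records_filter_lt hk h1 h3
      rw [split_lt hk]
      set s := split Prod.fst join k l
      have hj := join_of_leRoot (tl := s.val.2.2) (tr := r) (k := m)
        (i2.leRoot fun a ha => by
          rw [hm]; exact h3 a (Finset.mem_filter.1 (Finset.mem_filter.1 ha).1).1)
        (h5.leRoot fun a ha => by rw [hm]; exact h3 a (Finset.mem_filter.1 ha).1)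
      simp only [hj, tick_val, bind_val, ret_val, tick_work, bind_work, ret_work, mkNode_val,
        mkNode_work]
      refine ⟨?_, ?_, ?_, by omega⟩
      · convert i1 using 1
        ext x; simp only [Finset.mem_filter]
        exact ⟨fun h => ⟨⟨h.1, h.2.trans hk⟩, h.2⟩, fun h => ⟨h.1.1, h.2⟩⟩
      · rw [h2]
        refine i2.mk_node h5 (fun x => ?_) (fun x hx => ?_) (fun x hx => ?_) (fun x hx => ?_)
          fun x hx => ?_
        · simp only [Finset.mem_filter]
          constructor
          · rintro ⟨c1, c2⟩
            rcases lt_trichotomy x m.1 with c3 | c3 | c3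
            · exact Or.inl ⟨⟨c1, c3⟩, c2⟩
            · exact Or.inr (Or.inl c3)
            · exact Or.inr (Or.inr ⟨c1, c3⟩)
          · rintro (⟨⟨c1, c2⟩, c3⟩ | rfl | ⟨c1, c2⟩)
            · exact ⟨c1, c3⟩
            · exact ⟨h1, hk⟩
            · exact ⟨c1, hk.trans c2⟩
        · exact (Finset.mem_filter.1 (Finset.mem_filter.1 hx).1).2
        · exact (Finset.mem_filter.1 hx).2
        · exact h3 x (Finset.mem_filter.1 (Finset.mem_filter.1 hx).1).1
        · exact h3 x (Finset.mem_filter.1 hx).1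
      · rw [i3, Finset.mem_filter]; exact ⟨fun h => h.1, fun h => ⟨h, hk⟩⟩
    · rw [split_eq hk]
      simp only [tick_val, ret_val, tick_work, ret_work]
      rw [hk]
      exact ⟨h4, h5, by simp [h1], by omega⟩
    · obtain ⟨i1, i2, i3, i4⟩ := ihr h5
      have hc := card_records_filter_gt hk h1 h3
      rw [split_gt hk]
      set s := split Prod.fst join k r
      have hj := join_of_leRoot (tl := l) (tr := s.val.1) (k := m)
        (h4.leRoot fun a ha => by rw [hm]; exact h3 a (Finset.mem_filter.1 ha).1)
        (i1.leRoot fun a ha => by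
          rw [hm]; exact h3 a (Finset.mem_filter.1 (Finset.mem_filter.1 ha).1).1)
      simp only [hj, tick_val, bind_val, ret_val, tick_work, bind_work, ret_work, mkNode_val,
        mkNode_work]
      refine ⟨?_, ?_, ?_, by omega⟩
      · rw [h2]
        refine h4.mk_node i1 (fun x => ?_) (fun x hx => ?_) (fun x hx => ?_) (fun x hx => ?_)
          fun x hx => ?_
        · simp only [Finset.mem_filter]
          constructor
          · rintro ⟨c1, c2⟩
            rcases lt_trichotomy x m.1 with c3 | c3 | c3
            · exact Or.inl ⟨c1, c3⟩
            · exact Or.inr (Or.inl c3)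
            · exact Or.inr (Or.inr ⟨⟨c1, c3⟩, c2⟩)
          · rintro (⟨c1, c2⟩ | rfl | ⟨⟨c1, c2⟩, c3⟩)
            · exact ⟨c1, c2.trans hk⟩
            · exact ⟨h1, hk⟩
            · exact ⟨c1, c3⟩
        · exact (Finset.mem_filter.1 hx).2
        · exact (Finset.mem_filter.1 (Finset.mem_filter.1 hx).1).2
        · exact h3 x (Finset.mem_filter.1 hx).1
        · exact h3 x (Finset.mem_filter.1 (Finset.mem_filter.1 hx).1).1
      · convert i2 using 1
        ext x; simp only [Finset.mem_filter]
        exact ⟨fun h => ⟨⟨h.1, hk.trans h.2⟩, h.2⟩, fun h => ⟨h.1.1, h.2⟩⟩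
      · rw [i3, Finset.mem_filter]; exact ⟨fun h => h.1, fun h => ⟨h, hk⟩⟩

/-- The records with a priority below that of `b`. -/
def lowRecords (X : Finset K) (p : K → ℝ) (b : K) : Finset K :=
  (records X p b).filter fun a => p a < p b

lemma mem_lowRecords {a b : K} : a ∈ lowRecords X p b ↔ a ∈ records X p b ∧ p a < p b := by
  simp [lowRecords]

lemma card_lowRecords_succ_le {b m : K} (hYX : Y ⊆ X)
    (h : ∀ a ∈ Y, ∀ x ∈ X, Between a x b → x ∈ Y) (hm : m ∈ X) (hmY : m ∉ Y) (hmb : p m < p b)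
    (hmin : ∀ x ∈ X, p m ≤ p x) : (lowRecords Y p b).card + 1 ≤ (lowRecords X p b).card := by
  have h1 : m ∉ lowRecords Y p b := fun h => hmY (mem_records.1 (mem_lowRecords.1 h).1).1
  rw [← Finset.card_insert_of_notMem h1]
  refine Finset.card_le_card (Finset.insert_subset ?_ fun a ha => ?_)
  · refine mem_lowRecords.2 ⟨mem_records.2 ⟨hm, ?_, fun x hx _ => hmin x hx⟩, hmb⟩
    rintro rfl; exact lt_irrefl _ hmb
  · obtain ⟨h2, h3⟩ := mem_lowRecords.1 ha
    exact mem_lowRecords.2 ⟨records_subset hYX h h2, h3⟩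

/-- A join passes the nodes with a priority below that of the middle key on the inner spines of both
trees, which are the records of that key. -/
lemma join_spec {k : K} (hl : IsTreapOn X p tl) (hr : IsTreapOn Y p tr) (hX : ∀ x ∈ X, x < k)
    (hY : ∀ y ∈ Y, k < y) :
    IsTreapOn (insert k (X ∪ Y)) p (join tl (k, p k) tr).val ∧
      (join tl (k, p k) tr).work ≤ 5 * (lowRecords (X ∪ Y) p k).card + 2 := by
  induction hn : tl.numNodes + tr.numNodes using Nat.strong_induction_on
    generalizing tl tr X Y with
  | _ n ih =>
  -- the root of the first tree becomes the root of the result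
  have goLeft : ∀ (k₁ : K × ℝ) (l₁ r₁ : BinaryTree (K × ℝ)), tl = BinaryTree.node k₁ l₁ r₁ →
      k₁.2 < p k → (∀ y ∈ Y, k₁.2 ≤ p y) →
      IsTreapOn (insert k (X ∪ Y)) p (BinaryTree.node k₁ l₁ (join r₁ (k, p k) tr).val) ∧
      (join r₁ (k, p k) tr).work + 5 ≤ 5 * (lowRecords (X ∪ Y) p k).card + 2 := by
    rintro k₁ l₁ r₁ rfl hlt hmin
    obtain ⟨h1, h2, h3, h4, h5⟩ := hl.node
    have hm : k₁.2 = p k₁.1 := congrArg Prod.snd h2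
    have hk := hX _ h1
    rw [hm] at hlt hmin
    obtain ⟨i1, i2⟩ := ih _ (by simp only [numNodes] at hn; omega) h5 hr
      (fun x hx => hX x (Finset.mem_filter.1 hx).1) hY rfl
    constructor
    · rw [h2]
      refine h4.mk_node i1 (fun x => ?_) (fun x hx => ?_) (fun x hx => ?_) (fun x hx => ?_)
        fun x hx => ?_
      · simp only [Finset.mem_filter, Finset.mem_insert, Finset.mem_union]
        constructor
        · rintro (c | c | c)
          · exact Or.inr (Or.inr (Or.inl c))
          · rcases lt_trichotomy x k₁.1 with c3 | c3 | c3
            · exact Or.inl ⟨c, c3⟩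
            · exact Or.inr (Or.inl c3)
            · exact Or.inr (Or.inr (Or.inr (Or.inl ⟨c, c3⟩)))
          · exact Or.inr (Or.inr (Or.inr (Or.inr c)))
        · rintro (c | rfl | c | c | c)
          · exact Or.inr (Or.inl c.1)
          · exact Or.inr (Or.inl h1)
          · exact Or.inl c
          · exact Or.inr (Or.inl c.1)
          · exact Or.inr (Or.inr c)
      · exact (Finset.mem_filter.1 hx).2
      · simp only [Finset.mem_filter, Finset.mem_insert, Finset.mem_union] at hx
        rcases hx with rfl | c | c
        · exact hk
        · exact c.2
        · exact hk.trans (hY _ c)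
      · exact h3 x (Finset.mem_filter.1 hx).1
      · simp only [Finset.mem_filter, Finset.mem_insert, Finset.mem_union] at hx
        rcases hx with rfl | c | c
        · exact hlt.le
        · exact h3 x c.1
        · exact hmin x c
    · have : (lowRecords (X.filter (k₁.1 < ·) ∪ Y) p k).card + 1 ≤
          (lowRecords (X ∪ Y) p k).card := by
        refine card_lowRecords_succ_le (m := k₁.1)
          (Finset.union_subset_union_left (Finset.filter_subset _ _)) (fun a ha x hx hb => ?_)
          (Finset.mem_union_left _ h1) (fun hc => ?_) hlt (fun x hx => ?_)
        · simp only [Finset.mem_filter, Finset.mem_union] at ha hx ⊢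
          rcases hx with hx | hx
          · left
            refine ⟨hx, ?_⟩
            rcases hb with hb | hb
            · rcases ha with ha | ha
              · exact ha.2.trans hb.1
              · exact hk.trans ((hY _ ha).trans hb.1)
            · exact hk.trans hb.1
          · exact Or.inr hx
        · simp only [Finset.mem_filter, Finset.mem_union, lt_irrefl, and_false, false_or] at hc
          exact lt_asymm hk (hY _ hc)
        · rcases Finset.mem_union.1 hx with hx | hx
          · exact h3 x hx
          · exact hmin x hx
      omega
  -- the root of the second tree becomes the root of the result
  have goRight : ∀ (k₂ : K × ℝ) (l₂ r₂ : BinaryTree (K × ℝ)), tr = BinaryTree.node k₂ l₂ r₂ →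
      k₂.2 < p k → (∀ x ∈ X, k₂.2 ≤ p x) →
      IsTreapOn (insert k (X ∪ Y)) p (BinaryTree.node k₂ (join tl (k, p k) l₂).val r₂) ∧
      (join tl (k, p k) l₂).work + 5 ≤ 5 * (lowRecords (X ∪ Y) p k).card + 2 := by
    rintro k₂ l₂ r₂ rfl hlt hmin
    obtain ⟨h1, h2, h3, h4, h5⟩ := hr.node
    have hm : k₂.2 = p k₂.1 := congrArg Prod.snd h2
    have hk := hY _ h1
    rw [hm] at hlt hmin
    obtain ⟨i1, i2⟩ := ih _ (by simp only [numNodes] at hn; omega) hl h4 hX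
      (fun x hx => hY x (Finset.mem_filter.1 hx).1) rfl
    constructor
    · rw [h2]
      refine i1.mk_node h5 (fun x => ?_) (fun x hx => ?_) (fun x hx => ?_) (fun x hx => ?_)
        fun x hx => ?_
      · simp only [Finset.mem_filter, Finset.mem_insert, Finset.mem_union]
        constructor
        · rintro (c | c | c)
          · exact Or.inl (Or.inl c)
          · exact Or.inl (Or.inr (Or.inl c))
          · rcases lt_trichotomy x k₂.1 with c3 | c3 | c3
            · exact Or.inl (Or.inr (Or.inr ⟨c, c3⟩))
            · exact Or.inr (Or.inl c3)
            · exact Or.inr (Or.inr ⟨c, c3⟩)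
        · rintro ((c | c | c) | rfl | c)
          · exact Or.inl c
          · exact Or.inr (Or.inl c)
          · exact Or.inr (Or.inr c.1)
          · exact Or.inr (Or.inr h1)
          · exact Or.inr (Or.inr c.1)
      · simp only [Finset.mem_filter, Finset.mem_insert, Finset.mem_union] at hx
        rcases hx with rfl | c | c
        · exact hk
        · exact (hX _ c).trans hk
        · exact c.2
      · exact (Finset.mem_filter.1 hx).2
      · simp only [Finset.mem_filter, Finset.mem_insert, Finset.mem_union] at hx
        rcases hx with rfl | c | c
        · exact hlt.le
        · exact hmin x c
        · exact h3 x c.1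
      · exact h3 x (Finset.mem_filter.1 hx).1
    · have : (lowRecords (X ∪ Y.filter (· < k₂.1)) p k).card + 1 ≤
          (lowRecords (X ∪ Y) p k).card := by
        refine card_lowRecords_succ_le (m := k₂.1)
          (Finset.union_subset_union_right (Finset.filter_subset _ _)) (fun a ha x hx hb => ?_)
          (Finset.mem_union_right _ h1) (fun hc => ?_) hlt (fun x hx => ?_)
        · simp only [Finset.mem_filter, Finset.mem_union] at ha hx ⊢
          rcases hx with hx | hx
          · exact Or.inl hx
          · right
            refine ⟨hx, ?_⟩
            rcases hb with hb | hb
            · exact hb.2.trans hk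
            · rcases ha with ha | ha
              · exact hb.2.trans ((hX _ ha).trans hk)
              · exact hb.2.trans ha.2
        · simp only [Finset.mem_filter, Finset.mem_union, lt_irrefl, and_false, or_false] at hc
          exact lt_asymm hk (hX _ hc)
        · rcases Finset.mem_union.1 hx with hx | hx
          · exact hmin x hx
          · exact h3 x hx
      omega
  by_cases hroot : LeRoot (p k) tl ∧ LeRoot (p k) tr
  · have minX := le_of_leRoot hl.2.1 hroot.1
    have minY := le_of_leRoot hr.2.1 hroot.2
    rw [join_of_leRoot (k := (k, p k)) hroot.1 hroot.2]
    refine ⟨hl.mk_node hr (fun x => ?_) hX hY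
      (fun x hx => minX (x, p x) ((hl.2.2 _).2 ⟨hx, rfl⟩))
      fun y hy => minY (y, p y) ((hr.2.2 _).2 ⟨hy, rfl⟩), ?_⟩
    · simp only [Finset.mem_insert, Finset.mem_union]; tauto
    · simp
  rw [join.eq_def, test_neg hroot]
  rcases tl with _ | ⟨k₁, l₁, r₁⟩ <;> rcases tr with _ | ⟨k₂, l₂, r₂⟩
  · exact absurd ⟨trivial, trivial⟩ hroot
  · have hlt : k₂.2 < p k := not_le.1 fun h => hroot ⟨trivial, h⟩
    obtain ⟨g1, g2⟩ := goRight k₂ l₂ r₂ rfl hlt (by rw [isTreapOn_nil_iff.1 hl]; simp)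
    simp only [tick_val, tick_work, bind_val, bind_work, mkNode_val, mkNode_work]
    exact ⟨g1, by omega⟩
  · have hlt : k₁.2 < p k := not_le.1 fun h => hroot ⟨h, trivial⟩
    obtain ⟨g1, g2⟩ := goLeft k₁ l₁ r₁ rfl hlt (by rw [isTreapOn_nil_iff.1 hr]; simp)
    simp only [tick_val, tick_work, bind_val, bind_work, mkNode_val, mkNode_work]
    exact ⟨g1, by omega⟩
  · have m1 : k₁.2 = p k₁.1 := congrArg Prod.snd hl.node.2.1
    have m2 : k₂.2 = p k₂.1 := congrArg Prod.snd hr.node.2.1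
    simp only [tick_val, tick_work]
    by_cases h12 : k₁.2 ≤ k₂.2
    · have hlt : k₁.2 < p k := by
        by_contra hn
        exact hroot ⟨not_lt.1 hn, (not_lt.1 hn).trans h12⟩
      obtain ⟨g1, g2⟩ := goLeft k₁ l₁ r₁ rfl hlt fun y hy =>
        (h12.trans m2.le).trans (hr.node.2.2.1 y hy)
      rw [test_pos h12]
      simp only [tick_val, tick_work, bind_val, bind_work, mkNode_val, mkNode_work]
      exact ⟨g1, by omega⟩
    · have h21 := (not_le.1 h12).le
      have hlt : k₂.2 < p k := by
        by_contra hn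
        exact hroot ⟨(not_lt.1 hn).trans h21, not_lt.1 hn⟩
      obtain ⟨g1, g2⟩ := goRight k₂ l₂ r₂ rfl hlt fun x hx =>
        (h21.trans m1.le).trans (hl.node.2.2.1 x hx)
      rw [test_neg h12]
      simp only [tick_val, tick_work, bind_val, bind_work, mkNode_val, mkNode_work]
      exact ⟨g1, by omega⟩

end Treap

namespace Treap

variable {K : Type u} [LinearOrder K] {A B X Y : Finset K} {p q pA pB : K → ℝ}
  {t t₁ t₂ tl tr : BinaryTree (K × ℝ)}

/-- The nodes on the right spine are records for every key `k` above the tree. -/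
lemma splitLast_spec {e : K × ℝ} {l r : BinaryTree (K × ℝ)}
    (h : IsTreapOn X p (node e l r)) {k : K} (hk : ∀ x ∈ X, x < k) :
    let s := splitLast join e l r
    ∃ M ∈ X, (∀ x ∈ X, x ≤ M) ∧ s.val.2 = (M, p M) ∧ IsTreapOn (X.erase M) p s.val.1 ∧
      s.work ≤ 4 * (records X p k).card := by
  induction r generalizing e l X with
  | nil =>
    obtain ⟨h1, h2, h3, h4, h5⟩ := h.node
    have hle : ∀ x ∈ X, x ≤ e.1 := fun x hx => by
      by_contra hn
      have := isTreapOn_nil_iff.1 h5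
      exact Finset.notMem_empty x (this ▸ Finset.mem_filter.2 ⟨hx, not_le.1 hn⟩)
    simp only [splitLast, tick_val, ret_val, tick_work, ret_work]
    refine ⟨e.1, h1, hle, h2, ?_, ?_⟩
    · convert h4 using 1
      ext x
      rw [Finset.mem_erase, Finset.mem_filter]
      exact ⟨fun h => ⟨h.2, lt_of_le_of_ne (hle x h.2) h.1⟩, fun h => ⟨h.2.ne, h.1⟩⟩
    · have : 0 < (records X p k).card := Finset.card_pos.2
        ⟨e.1, mem_records.2 ⟨h1, (hk _ h1).ne, fun x hx _ => h3 x hx⟩⟩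
      omega
  | node e' l' r' _ ih =>
    obtain ⟨h1, h2, h3, h4, h5⟩ := h.node
    have he : e.2 = p e.1 := congrArg Prod.snd h2
    obtain ⟨M, m1, m2, m3, m4, m5⟩ := ih h5 fun x hx => hk x (Finset.mem_filter.1 hx).1
    have hc := card_records_filter_gt (hk _ h1) h1 h3
    have hM := Finset.mem_filter.1 m1
    simp only [splitLast, tick_val, ret_val, tick_work, ret_work, bind_val, bind_work]
    set s := splitLast join e' l' r'
    have hj := join_of_leRoot (tl := l) (tr := s.val.1) (k := e)
      (h4.leRoot fun a ha => by rw [he]; exact h3 a (Finset.mem_filter.1 ha).1)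
      (m4.leRoot fun a ha => by
        rw [he]; exact h3 a (Finset.mem_filter.1 (Finset.mem_of_mem_erase ha)).1)
    rw [hj]
    simp only [tick_val, tick_work, mkNode_val, mkNode_work]
    refine ⟨M, hM.1, fun x hx => ?_, m3, ?_, by omega⟩
    · rcases le_or_gt x e.1 with hx' | hx'
      · exact hx'.trans hM.2.le
      · exact m2 x (Finset.mem_filter.2 ⟨hx, hx'⟩)
    · rw [h2]
      refine h4.mk_node m4 (fun x => ?_) (fun x hx => ?_) (fun x hx => ?_) (fun x hx => ?_)
        fun x hx => ?_
      · simp only [Finset.mem_erase, Finset.mem_filter]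
        constructor
        · rintro ⟨c1, c2⟩
          rcases lt_trichotomy x e.1 with c3 | c3 | c3
          · exact Or.inl ⟨c2, c3⟩
          · exact Or.inr (Or.inl c3)
          · exact Or.inr (Or.inr ⟨c1, c2, c3⟩)
        · rintro (⟨c1, c2⟩ | rfl | ⟨c1, c2, c3⟩)
          · exact ⟨(c2.trans hM.2).ne, c1⟩
          · exact ⟨hM.2.ne, h1⟩
          · exact ⟨c1, c2⟩
      · exact (Finset.mem_filter.1 hx).2
      · exact (Finset.mem_filter.1 (Finset.mem_of_mem_erase hx)).2
      · exact h3 x (Finset.mem_filter.1 hx).1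
      · exact h3 x (Finset.mem_filter.1 (Finset.mem_of_mem_erase hx)).1

lemma join2_spec {k : K} (hl : IsTreapOn X p tl) (hr : IsTreapOn Y p tr) (hX : ∀ x ∈ X, x < k)
    (hY : ∀ y ∈ Y, k < y) :
    IsTreapOn (X ∪ Y) p (join2 join tl tr).val ∧
      (join2 join tl tr).work ≤ 9 * (records (X ∪ Y) p k).card + 3 := by
  cases tl with
  | nil =>
    rw [isTreapOn_nil_iff.1 hl, Finset.empty_union]
    exact ⟨hr, by simp [join2]⟩
  | node e l r =>
    obtain ⟨M, m1, m2, m3, m4, m5⟩ := splitLast_spec hl hX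
    have hMk := hX M m1
    simp only [join2, tick_val, tick_work, bind_val, bind_work]
    set s := splitLast join e l r
    obtain ⟨j1, j2⟩ := join_spec (k := M) m4 hr
      (fun x hx => lt_of_le_of_ne (m2 x (Finset.mem_of_mem_erase hx)) (Finset.ne_of_mem_erase hx))
      (fun y hy => hMk.trans (hY y hy))
    rw [m3]
    constructor
    · convert j1 using 1
      rw [← Finset.insert_union, Finset.insert_erase m1]
    · have c1 : (records X p k).card ≤ (records (X ∪ Y) p k).card := by
        refine Finset.card_le_card (records_subset Finset.subset_union_left
          fun a ha x hx hb => ?_)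
        rcases Finset.mem_union.1 hx with hx | hx
        · exact hx
        · have := hX a ha
          have := hY x hx
          rcases hb with hb | hb
          · exact (lt_asymm hb.2 this).elim
          · exact (lt_asymm (hb.1.trans hb.2) (hX a ha)).elim
      have c2 : (lowRecords (X.erase M ∪ Y) p M).card ≤ (records (X ∪ Y) p k).card := by
        refine Finset.card_le_card fun a ha => ?_
        obtain ⟨h1, h2⟩ := mem_lowRecords.1 ha
        obtain ⟨h3, h4, h5⟩ := mem_records.1 h1
        have haXY : a ∈ X ∪ Y := Finset.union_subset_union_left (Finset.erase_subset _ _) h3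
        have hak : a ≠ k := by
          rintro rfl
          rcases Finset.mem_union.1 haXY with h | h
          · exact lt_irrefl _ (hX _ h)
          · exact lt_irrefl _ (hY _ h)
        refine mem_records.2 ⟨haXY, hak, fun x hx hb => ?_⟩
        by_cases hxM : x = M
        · rw [hxM]; exact h2.le
        have hx' : x ∈ X.erase M ∪ Y := by
          rw [Finset.mem_union, Finset.mem_erase]
          exact (Finset.mem_union.1 hx).imp_left fun h => ⟨hxM, h⟩
        refine h5 x hx' ?_
        rcases hb with hb | hb
        · rcases Finset.mem_union.1 hx with hx | hx
          · exact Or.inl ⟨hb.1, lt_of_le_of_ne (m2 x hx) hxM⟩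
          · exact (lt_asymm hb.2 (hY x hx)).elim
        · exact Or.inr ⟨hMk.trans hb.1, hb.2⟩
      omega

/-! ### Treaps: the set operations -/

/-- The priorities in the union: a common key keeps its node of the second treap. -/
def unionPriority (B : Finset K) (pA pB : K → ℝ) (k : K) : ℝ := if k ∈ B then pB k else pA k

lemma union_filter_split {k : K} (hk : k ∈ X ∪ Y) :
    insert k (X.filter (· < k) ∪ Y.filter (· < k) ∪ (X.filter (k < ·) ∪ Y.filter (k < ·))) =
      X ∪ Y := by
  ext x
  simp only [Finset.mem_insert, Finset.mem_union, Finset.mem_filter]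
  rw [Finset.mem_union] at hk
  constructor
  · rintro (rfl | (c | c) | c | c)
    · exact hk
    · exact Or.inl c.1
    · exact Or.inr c.1
    · exact Or.inl c.1
    · exact Or.inr c.1
  · intro h
    rcases lt_trichotomy x k with c | c | c
    · exact Or.inr (Or.inl (h.imp (⟨·, c⟩) (⟨·, c⟩)))
    · exact Or.inl c
    · exact Or.inr (Or.inr (h.imp (⟨·, c⟩) (⟨·, c⟩)))

lemma unionPriority_filter_lt {k x : K} (hx : x < k) :
    unionPriority (B.filter (· < k)) pA pB x = unionPriority B pA pB x := by
  simp [unionPriority, hx]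

lemma unionPriority_filter_gt {k x : K} (hx : k < x) :
    unionPriority (B.filter (k < ·)) pA pB x = unionPriority B pA pB x := by
  simp [unionPriority, hx]

lemma lt_of_mem_union_filter {k x : K} (hx : x ∈ X.filter (· < k) ∪ Y.filter (· < k)) : x < k := by
  rcases Finset.mem_union.1 hx with h | h <;> exact (Finset.mem_filter.1 h).2

lemma gt_of_mem_union_filter {k x : K} (hx : x ∈ X.filter (k < ·) ∪ Y.filter (k < ·)) : k < x := by
  rcases Finset.mem_union.1 hx with h | h <;> exact (Finset.mem_filter.1 h).2

lemma union_spec (h₁ : IsTreapOn A pA t₁) (h₂ : IsTreapOn B pB t₂) :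
    IsTreapOn (A ∪ B) (unionPriority B pA pB) (union Prod.fst join t₁ t₂).val := by
  induction t₂ generalizing A B t₁ with
  | nil =>
    obtain rfl := isTreapOn_nil_iff.1 h₂
    rw [Finset.union_empty]
    cases t₁ with
    | nil => exact h₁.congr fun _ _ => by simp [unionPriority]
    | node e l r => exact h₁.congr fun _ _ => by simp [unionPriority]
  | node k₂ l₂ r₂ ihl ihr =>
    cases t₁ with
    | nil =>
      obtain rfl := isTreapOn_nil_iff.1 h₁
      rw [Finset.empty_union]
      exact h₂.congr fun _ hx => by simp [unionPriority, hx]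
    | node e l r =>
      obtain ⟨b1, b2, b3, b4, b5⟩ := h₂.node
      obtain ⟨i1, i2, -, -⟩ := split_spec h₁ k₂.1
      simp only [union, tick_val, bind_val, par_val]
      have l1 := (ihl i1 b4).congr (q := unionPriority B pA pB)
        fun x hx => unionPriority_filter_lt (lt_of_mem_union_filter hx)
      have r1 := (ihr i2 b5).congr (q := unionPriority B pA pB)
        fun x hx => unionPriority_filter_gt (gt_of_mem_union_filter hx)
      have hk : k₂ = (k₂.1, unionPriority B pA pB k₂.1) := by
        rw [unionPriority, if_pos b1]; exact b2
      have := (join_spec (k := k₂.1) l1 r1 (fun x hx => lt_of_mem_union_filter hx)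
        fun x hx => gt_of_mem_union_filter hx).1
      rw [← hk, union_filter_split (Finset.mem_union_right _ b1)] at this
      exact this

lemma inter_filter_split (k : K) :
    X.filter (· < k) ∩ Y.filter (· < k) ∪ X.filter (k < ·) ∩ Y.filter (k < ·) =
      (X ∩ Y).erase k := by
  ext x
  simp only [Finset.mem_erase, Finset.mem_union, Finset.mem_inter, Finset.mem_filter]
  rw [← lt_or_lt_iff_ne]
  tauto

lemma sdiff_filter_split {k : K} (hk : k ∈ Y) :
    X.filter (· < k) \ Y.filter (· < k) ∪ X.filter (k < ·) \ Y.filter (k < ·) = X \ Y := by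
  ext x
  simp only [Finset.mem_union, Finset.mem_sdiff, Finset.mem_filter]
  have : x ∉ Y → x < k ∨ k < x := fun h => lt_or_lt_iff_ne.2 fun h' => h (h' ▸ hk)
  tauto

lemma lt_of_mem_inter_filter {k x : K} (hx : x ∈ X.filter (· < k) ∩ Y) : x < k :=
  (Finset.mem_filter.1 (Finset.mem_inter.1 hx).1).2

lemma gt_of_mem_inter_filter {k x : K} (hx : x ∈ X.filter (k < ·) ∩ Y) : k < x :=
  (Finset.mem_filter.1 (Finset.mem_inter.1 hx).1).2

lemma lt_of_mem_sdiff_filter {k x : K} (hx : x ∈ X.filter (· < k) \ Y) : x < k :=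
  (Finset.mem_filter.1 (Finset.mem_sdiff.1 hx).1).2

lemma gt_of_mem_sdiff_filter {k x : K} (hx : x ∈ X.filter (k < ·) \ Y) : k < x :=
  (Finset.mem_filter.1 (Finset.mem_sdiff.1 hx).1).2

lemma intersect_spec (h₁ : IsTreapOn A pA t₁) (h₂ : IsTreapOn B pB t₂) :
    IsTreapOn (A ∩ B) pB (intersect Prod.fst join t₁ t₂).val := by
  induction t₂ generalizing A B t₁ with
  | nil =>
    obtain rfl := isTreapOn_nil_iff.1 h₂
    rw [Finset.inter_empty]
    cases t₁ <;> exact isTreapOn_nil_iff.2 rfl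
  | node k₂ l₂ r₂ ihl ihr =>
    cases t₁ with
    | nil =>
      obtain rfl := isTreapOn_nil_iff.1 h₁
      rw [Finset.empty_inter]
      exact isTreapOn_nil_iff.2 rfl
    | node e l r =>
      obtain ⟨b1, b2, b3, b4, b5⟩ := h₂.node
      obtain ⟨i1, i2, i3, -⟩ := split_spec h₁ k₂.1
      simp only [intersect, tick_val, bind_val, par_val]
      set s := split Prod.fst join k₂.1 (node e l r)
      have l1 := ihl i1 b4
      have r1 := ihr i2 b5
      by_cases hb : s.val.2.1 = true
      · rw [test_pos hb, tick_val]
        have := (join_spec (k := k₂.1) l1 r1 (fun x hx => lt_of_mem_inter_filter hx)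
          fun x hx => gt_of_mem_inter_filter hx).1
        rwa [← b2, inter_filter_split, Finset.insert_erase (Finset.mem_inter.2 ⟨i3.1 hb, b1⟩)]
          at this
      · rw [test_neg hb, tick_val]
        have := (join2_spec (k := k₂.1) l1 r1 (fun x hx => lt_of_mem_inter_filter hx)
          fun x hx => gt_of_mem_inter_filter hx).1
        rwa [inter_filter_split, Finset.erase_eq_of_notMem fun h =>
          hb (i3.2 (Finset.mem_inter.1 h).1)] at this

lemma difference_spec (h₁ : IsTreapOn A pA t₁) (h₂ : IsTreapOn B pB t₂) :
    IsTreapOn (A \ B) pA (difference Prod.fst join t₁ t₂).val := by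
  induction t₂ generalizing A B t₁ with
  | nil =>
    obtain rfl := isTreapOn_nil_iff.1 h₂
    rw [Finset.sdiff_empty]
    cases t₁ <;> exact h₁
  | node k₂ l₂ r₂ ihl ihr =>
    cases t₁ with
    | nil =>
      obtain rfl := isTreapOn_nil_iff.1 h₁
      rw [Finset.empty_sdiff]
      exact isTreapOn_nil_iff.2 rfl
    | node e l r =>
      obtain ⟨b1, b2, b3, b4, b5⟩ := h₂.node
      obtain ⟨i1, i2, -, -⟩ := split_spec h₁ k₂.1
      simp only [difference, tick_val, bind_val, par_val]
      have := (join2_spec (k := k₂.1) (ihl i1 b4) (ihr i2 b5)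
        (fun x hx => lt_of_mem_sdiff_filter hx) fun x hx => gt_of_mem_sdiff_filter hx).1
      rwa [sdiff_filter_split b1] at this

/-- The keys that govern the cost of the joins of a set operation. For the intersection and the
difference these are the keys of the result. For the union they are the keys of the result that sit
in nodes of the first treap: no node of the second one has a smaller priority than its root, which
is the middle key of the join. -/
def joinKeys (A B : Finset K) : SetOp → Finset K
  | .union => A \ B
  | .intersect => A ∩ B
  | .difference => A \ B

/-- The priorities of the keys in `joinKeys`. -/
def joinPriority (pA pB : K → ℝ) : SetOp → K → ℝ
  | .union => pA
  | .intersect => pB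
  | .difference => pA

lemma joinKeys_filter (op : SetOp) (P : K → Prop) [DecidablePred P] :
    joinKeys (A.filter P) (B.filter P) op = (joinKeys A B op).filter P := by
  cases op <;> ext x <;>
    simp only [joinKeys, Finset.mem_sdiff, Finset.mem_inter, Finset.mem_filter] <;> tauto

lemma joinKeys_subset (op : SetOp) : joinKeys A B op ⊆ A := by
  cases op
  · exact Finset.sdiff_subset
  · exact Finset.inter_subset_left
  · exact Finset.sdiff_subset

/-- Apart from the recursive calls, the cost of a call is bounded by the numbers of records for the
root of the second treap. -/
lemma run_step (op : SetOp) {e k₂ : K × ℝ} {l r l₂ r₂ : BinaryTree (K × ℝ)}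
    (h₁ : IsTreapOn A pA (node e l r)) (h₂ : IsTreapOn B pB (node k₂ l₂ r₂)) :
    ∃ u₁ u₂, IsTreapOn (A.filter (· < k₂.1)) pA u₁ ∧ IsTreapOn (A.filter (k₂.1 < ·)) pA u₂ ∧
      (op.run Prod.fst join (node e l r) (node k₂ l₂ r₂)).work ≤
        6 * (records A pA k₂.1).card +
          9 * (records (joinKeys A B op) (joinPriority pA pB op) k₂.1).card + 11 +
          ((op.run Prod.fst join u₁ l₂).work + (op.run Prod.fst join u₂ r₂).work) ∧
      (op.run Prod.fst join (node e l r) (node k₂ l₂ r₂)).span ≤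
        6 * (records A pA k₂.1).card +
          9 * (records (joinKeys A B op) (joinPriority pA pB op) k₂.1).card + 11 +
          max (op.run Prod.fst join u₁ l₂).span (op.run Prod.fst join u₂ r₂).span := by
  obtain ⟨b1, b2, b3, b4, b5⟩ := h₂.node
  obtain ⟨i1, i2, i3, i4⟩ := split_spec h₁ k₂.1
  have i5 := seq_split (key := Prod.fst) seq_join k₂.1 (node e l r)
  refine ⟨_, _, i1, i2, ?_⟩
  unfold Cost.Seq at i5
  cases op with
  | union =>
    simp only [SetOp.run, union, tick_work, bind_work, par_work, tick_span, bind_span, par_span,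
      par_val, joinKeys, joinPriority]
    set s := split Prod.fst join k₂.1 (node e l r)
    have l1 := (union_spec i1 b4).congr (q := unionPriority B pA pB)
      fun x hx => unionPriority_filter_lt (lt_of_mem_union_filter hx)
    have r1 := (union_spec i2 b5).congr (q := unionPriority B pA pB)
      fun x hx => unionPriority_filter_gt (gt_of_mem_union_filter hx)
    have hk : k₂ = (k₂.1, unionPriority B pA pB k₂.1) := by
      rw [unionPriority, if_pos b1]; exact b2
    have j := (join_spec (k := k₂.1) l1 r1 (fun x hx => lt_of_mem_union_filter hx)
      fun x hx => gt_of_mem_union_filter hx).2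
    rw [← hk] at j
    have hsub : lowRecords (A.filter (· < k₂.1) ∪ B.filter (· < k₂.1) ∪
        (A.filter (k₂.1 < ·) ∪ B.filter (k₂.1 < ·))) (unionPriority B pA pB) k₂.1 ⊆
        records (A \ B) pA k₂.1 := by
      intro a ha
      obtain ⟨c1, c2⟩ := mem_lowRecords.1 ha
      obtain ⟨c3, c4, c5⟩ := mem_records.1 c1
      have c6 : a ∈ A ∪ B := by
        rw [← union_filter_split (Finset.mem_union_right A b1)]
        exact Finset.mem_insert_of_mem c3
      have c7 : a ∉ B := fun hB => by
        simp only [unionPriority, if_pos hB, if_pos b1] at c2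
        exact (b3 a hB).not_gt c2
      have c8 : a ∈ A := (Finset.mem_union.1 c6).resolve_right c7
      refine mem_records.2 ⟨Finset.mem_sdiff.2 ⟨c8, c7⟩, c4, fun x hx hb => ?_⟩
      obtain ⟨x1, x2⟩ := Finset.mem_sdiff.1 hx
      have x3 : x ≠ k₂.1 := fun h => x2 (h ▸ b1)
      have := Finset.mem_of_mem_insert_of_ne
        ((union_filter_split (Finset.mem_union_right A b1)).symm ▸ Finset.mem_union_left B x1) x3
      have := c5 x this hb
      simpa only [unionPriority, if_neg c7, if_neg x2] using this
    have := Finset.card_le_card hsub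
    have j' := seq_join (union Prod.fst join s.val.1 l₂).val k₂
      (union Prod.fst join s.val.2.2 r₂).val
    unfold Cost.Seq at j'
    constructor <;> omega
  | intersect =>
    simp only [SetOp.run, intersect, tick_work, bind_work, par_work, tick_span, bind_span,
      par_span, par_val, joinKeys, joinPriority]
    set s := split Prod.fst join k₂.1 (node e l r)
    have l1 := intersect_spec i1 b4
    have r1 := intersect_spec i2 b5
    have hsub : records (A.filter (· < k₂.1) ∩ B.filter (· < k₂.1) ∪
        A.filter (k₂.1 < ·) ∩ B.filter (k₂.1 < ·)) pB k₂.1 ⊆ records (A ∩ B) pB k₂.1 := by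
      rw [inter_filter_split]
      refine records_subset (Finset.erase_subset _ _) fun a _ x hx hb =>
        Finset.mem_erase.2 ⟨?_, hx⟩
      rcases hb with hb | hb
      · exact hb.2.ne
      · exact hb.1.ne'
    have hc := Finset.card_le_card hsub
    by_cases hb : s.val.2.1 = true
    · have j := (join_spec (k := k₂.1) l1 r1 (fun x hx => lt_of_mem_inter_filter hx)
        fun x hx => gt_of_mem_inter_filter hx).2
      rw [← b2] at j
      have hlow := Finset.card_le_card (Finset.filter_subset (fun a => pB a < pB k₂.1)
        (records (A.filter (· < k₂.1) ∩ B.filter (· < k₂.1) ∪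
          A.filter (k₂.1 < ·) ∩ B.filter (k₂.1 < ·)) pB k₂.1))
      have j' := seq_join (intersect Prod.fst join s.val.1 l₂).val k₂
        (intersect Prod.fst join s.val.2.2 r₂).val
      unfold Cost.Seq at j'
      unfold lowRecords at j
      rw [test_pos hb]
      simp only [tick_work, tick_span]
      constructor <;> omega
    · have j := (join2_spec (k := k₂.1) l1 r1 (fun x hx => lt_of_mem_inter_filter hx)
        fun x hx => gt_of_mem_inter_filter hx).2
      have j' := seq_join2 (join := join) seq_join (intersect Prod.fst join s.val.1 l₂).val
        (intersect Prod.fst join s.val.2.2 r₂).val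
      unfold Cost.Seq at j'
      rw [test_neg hb]
      simp only [tick_work, tick_span]
      constructor <;> omega
  | difference =>
    simp only [SetOp.run, difference, tick_work, bind_work, par_work, tick_span, bind_span,
      par_span, par_val, joinKeys, joinPriority]
    set s := split Prod.fst join k₂.1 (node e l r)
    have j := (join2_spec (k := k₂.1) (difference_spec i1 b4) (difference_spec i2 b5)
      (fun x hx => lt_of_mem_sdiff_filter hx) fun x hx => gt_of_mem_sdiff_filter hx).2
    rw [sdiff_filter_split b1] at j
    have j' := seq_join2 (join := join) seq_join (difference Prod.fst join s.val.1 l₂).val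
      (difference Prod.fst join s.val.2.2 r₂).val
    unfold Cost.Seq at j'
    constructor <;> omega

lemma run_nil_left (op : SetOp) (t : BinaryTree (K × ℝ)) :
    (op.run Prod.fst join nil t).work = 1 ∧ (op.run Prod.fst join nil t).span = 1 := by
  cases op <;> cases t <;> exact ⟨rfl, rfl⟩

lemma run_nil_right (op : SetOp) (t : BinaryTree (K × ℝ)) :
    (op.run Prod.fst join t nil).work ≤ 2 ∧ (op.run Prod.fst join t nil).span ≤ 2 := by
  cases op <;> cases t <;> constructor <;>
    simp [SetOp.run, union, intersect, difference]

open Classical in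
/-- The records `a` for `b` such that in addition `b` has the least priority among the keys of `Y`
between them. If `b` is the root of a subtree of the treap on `Y`, then they are the records for
`b` that a set operation meets when it reaches that subtree. -/
def jointRecords (X : Finset K) (p : K → ℝ) (Y : Finset K) (q : K → ℝ) (b : K) : Finset K :=
  (records X p b).filter fun a => ∀ y ∈ Y, Between a y b → q b ≤ q y

lemma mem_jointRecords {a b : K} : a ∈ jointRecords X p Y q b ↔
    a ∈ records X p b ∧ ∀ y ∈ Y, Between a y b → q b ≤ q y := by
  simp [jointRecords]

/-- The number of pairs of a key `b` of `Y` and a joint record for `b`. -/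
def jointCount (X : Finset K) (p : K → ℝ) (Y : Finset K) (q : K → ℝ) : ℕ :=
  ∑ b ∈ Y, (jointRecords X p Y q b).card

/-- All records for the key `k` of least priority are joint records. The other joint records on
either side of `k` are counted separately. -/
lemma jointCount_split {k : K} (hk : k ∈ Y) (hmin : ∀ y ∈ Y, q k ≤ q y) :
    (records X p k).card + (jointCount (X.filter (· < k)) p (Y.filter (· < k)) q +
      jointCount (X.filter (k < ·)) p (Y.filter (k < ·)) q) ≤ jointCount X p Y q := by
  have hY : Y = insert k (Y.filter (· < k) ∪ Y.filter (k < ·)) := by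
    ext y
    simp only [Finset.mem_insert, Finset.mem_union, Finset.mem_filter]
    constructor
    · intro h
      rcases lt_trichotomy y k with c | c | c
      · exact Or.inr (Or.inl ⟨h, c⟩)
      · exact Or.inl c
      · exact Or.inr (Or.inr ⟨h, c⟩)
    · rintro (rfl | h | h)
      · exact hk
      · exact h.1
      · exact h.1
  have hd : Disjoint (Y.filter (· < k)) (Y.filter (k < ·)) :=
    Finset.disjoint_left.2 fun x h1 h2 =>
      lt_asymm (Finset.mem_filter.1 h1).2 (Finset.mem_filter.1 h2).2
  have hsum : jointCount X p Y q = (jointRecords X p Y q k).card +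
      (∑ b ∈ Y.filter (· < k), (jointRecords X p Y q b).card +
        ∑ b ∈ Y.filter (k < ·), (jointRecords X p Y q b).card) := by
    unfold jointCount
    conv_lhs => rw [hY]
    rw [Finset.sum_insert (by simp), Finset.sum_union hd, ← hY]
  rw [hsum]
  refine add_le_add (Finset.card_le_card fun a ha => ?_) (add_le_add
    (Finset.sum_le_sum fun b hb => Finset.card_le_card fun a ha => ?_)
    (Finset.sum_le_sum fun b hb => Finset.card_le_card fun a ha => ?_))
  · exact mem_jointRecords.2 ⟨ha, fun y hy _ => hmin y hy⟩
  · obtain ⟨h1, h2⟩ := mem_jointRecords.1 ha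
    have hb' := (Finset.mem_filter.1 hb).2
    have ha' := (Finset.mem_filter.1 (mem_records.1 h1).1).2
    refine mem_jointRecords.2 ⟨records_subset (Finset.filter_subset _ _)
      (fun _ ha _ hx h => mem_filter_lt_of_between hb'.le ha hx h) h1, fun y hy hyb =>
      h2 y (Finset.mem_filter.2 ⟨hy, ?_⟩) hyb⟩
    rcases hyb with h | h
    · exact h.2.trans hb'
    · exact h.2.trans ha'
  · obtain ⟨h1, h2⟩ := mem_jointRecords.1 ha
    have hb' := (Finset.mem_filter.1 hb).2
    have ha' := (Finset.mem_filter.1 (mem_records.1 h1).1).2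
    refine mem_jointRecords.2 ⟨records_subset (Finset.filter_subset _ _)
      (fun _ ha _ hx h => mem_filter_gt_of_between hb'.le ha hx h) h1, fun y hy hyb =>
      h2 y (Finset.mem_filter.2 ⟨hy, ?_⟩) hyb⟩
    rcases hyb with h | h
    · exact ha'.trans h.1
    · exact hb'.trans h.1

lemma card_inter_split {k : K} : (A.filter (· < k) ∩ B.filter (· < k)).card +
    (A.filter (k < ·) ∩ B.filter (k < ·)).card + (if k ∈ A ∩ B then 1 else 0) = (A ∩ B).card := by
  rw [← Finset.card_union_of_disjoint, inter_filter_split]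
  · split_ifs with h
    · rw [Finset.card_erase_add_one h]
    · rw [Finset.erase_eq_of_notMem h, add_zero]
  · exact Finset.disjoint_left.2 fun x h1 h2 =>
      lt_asymm (lt_of_mem_inter_filter h1) (gt_of_mem_inter_filter h2)

/-- The work of a set operation is bounded by the number of joint records. -/
lemma run_work_le (op : SetOp) (h₁ : IsTreapOn A pA t₁) (h₂ : IsTreapOn B pB t₂) :
    (op.run Prod.fst join t₁ t₂).work ≤
      20 * (jointCount A pA B pB +
        jointCount (joinKeys A B op) (joinPriority pA pB op) B pB + (A ∩ B).card) + 2 := by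
  induction t₂ generalizing A B t₁ with
  | nil => exact (run_nil_right op t₁).1.trans (by omega)
  | node k₂ l₂ r₂ ihl ihr =>
    cases t₁ with
    | nil => rw [(run_nil_left op _).1]; omega
    | node e l r =>
      obtain ⟨b1, b2, b3, b4, b5⟩ := h₂.node
      obtain ⟨a1, a2, a3, -, -⟩ := h₁.node
      obtain ⟨u₁, u₂, i1, i2, i3, -⟩ := run_step op h₁ h₂
      have j1 := ihl i1 b4
      have j2 := ihr i2 b5
      rw [joinKeys_filter] at j1 j2
      have n1 := jointCount_split (X := A) (p := pA) b1 b3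
      have n2 := jointCount_split (X := joinKeys A B op) (p := joinPriority pA pB op) b1 b3
      have n3 := card_inter_split (A := A) (B := B) (k := k₂.1)
      -- the root of the first treap is a record for `k₂`, unless both keys agree
      have n4 : 1 ≤ (records A pA k₂.1).card + (if k₂.1 ∈ A ∩ B then 1 else 0) := by
        by_cases hk : e.1 = k₂.1
        · rw [if_pos (Finset.mem_inter.2 ⟨hk ▸ a1, b1⟩)]; omega
        · have : 0 < (records A pA k₂.1).card := Finset.card_pos.2
            ⟨e.1, mem_records.2 ⟨a1, hk, fun x hx _ => a3 x hx⟩⟩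
          omega
      omega

/-- The number of levels of the recursion is at most the height of the second treap. -/
lemma run_span_le (op : SetOp) {M₁ M₂ : ℕ} (h₁ : IsTreapOn A pA t₁) (h₂ : IsTreapOn B pB t₂)
    (hM₁ : ∀ b ∈ B, (records A pA b).card ≤ M₁)
    (hM₂ : ∀ b ∈ B, (records (joinKeys A B op) (joinPriority pA pB op) b).card ≤ M₂) :
    (op.run Prod.fst join t₁ t₂).span ≤ (6 * M₁ + 9 * M₂ + 11) * t₂.height + 2 := by
  induction t₂ generalizing A B t₁ with
  | nil => exact (run_nil_right op t₁).2.trans (by omega)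
  | node k₂ l₂ r₂ ihl ihr =>
    cases t₁ with
    | nil => rw [(run_nil_left op _).2]; omega
    | node e l r =>
      obtain ⟨b1, b2, b3, b4, b5⟩ := h₂.node
      obtain ⟨u₁, u₂, i1, i2, -, i3⟩ := run_step op h₁ h₂
      have j1 := ihl i1 b4
        (fun b hb => (Finset.card_le_card (records_subset (Finset.filter_subset _ _)
          fun _ ha _ hx h => mem_filter_lt_of_between (Finset.mem_filter.1 hb).2.le ha hx h)).trans
          (hM₁ b (Finset.mem_filter.1 hb).1))
        (fun b hb => by
          rw [joinKeys_filter]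
          exact (Finset.card_le_card (records_subset (Finset.filter_subset _ _)
            fun _ ha _ hx h => mem_filter_lt_of_between (Finset.mem_filter.1 hb).2.le ha hx
              h)).trans (hM₂ b (Finset.mem_filter.1 hb).1))
      have j2 := ihr i2 b5
        (fun b hb => (Finset.card_le_card (records_subset (Finset.filter_subset _ _)
          fun _ ha _ hx h => mem_filter_gt_of_between (Finset.mem_filter.1 hb).2.le ha hx h)).trans
          (hM₁ b (Finset.mem_filter.1 hb).1))
        (fun b hb => by
          rw [joinKeys_filter]
          exact (Finset.card_le_card (records_subset (Finset.filter_subset _ _)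
            fun _ ha _ hx h => mem_filter_gt_of_between (Finset.mem_filter.1 hb).2.le ha hx
              h)).trans (hM₂ b (Finset.mem_filter.1 hb).1))
      have m1 := hM₁ _ b1
      have m2 := hM₂ _ b1
      have e1 : (6 * M₁ + 9 * M₂ + 11) * l₂.height ≤
          (6 * M₁ + 9 * M₂ + 11) * max l₂.height r₂.height :=
        Nat.mul_le_mul_left _ (le_max_left _ _)
      have e2 : (6 * M₁ + 9 * M₂ + 11) * r₂.height ≤
          (6 * M₁ + 9 * M₂ + 11) * max l₂.height r₂.height :=
        Nat.mul_le_mul_left _ (le_max_right _ _)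
      simp only [height]
      rw [mul_add, mul_one]
      omega

end Treap

/-! ### Treaps: sums over pairs of keys -/

namespace Treap

section Sums

variable {K : Type u} [LinearOrder K] {X Y : Finset K}

lemma Between.symm {a x b : K} (h : Between a x b) : Between b x a := Or.symm h

instance (a x b : K) : Decidable (Between a x b) :=
  inferInstanceAs (Decidable ((a < x ∧ x < b) ∨ (b < x ∧ x < a)))

/-- The number of keys of `X` strictly between `a` and `b`. -/
def gap (X : Finset K) (a b : K) : ℕ := (X.filter fun x => Between a x b).card

lemma gap_comm (X : Finset K) (a b : K) : gap X a b = gap X b a := by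
  unfold gap
  congr 1
  exact Finset.filter_congr fun x _ => ⟨Between.symm, Between.symm⟩

lemma gap_lt_card {a b : K} (ha : a ∈ X) : gap X a b < X.card := by
  refine Finset.card_lt_card (Finset.filter_ssubset.2 ⟨a, ha, ?_⟩)
  rintro (⟨h, -⟩ | ⟨-, h⟩) <;> exact lt_irrefl _ h

lemma gap_lt_gap {a a' b : K} (ha' : a' ∈ X) (h : Between a a' b) : gap X a' b < gap X a b := by
  refine Finset.card_lt_card (Finset.ssubset_iff_of_subset ?_ |>.2 ⟨a', ?_, ?_⟩)
  · intro x hx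
    rw [Finset.mem_filter] at hx ⊢
    refine ⟨hx.1, ?_⟩
    rcases h with h | h <;> rcases hx.2 with h' | h'
    · exact Or.inl ⟨h.1.trans h'.1, h'.2⟩
    · exact (lt_asymm h.2 (h'.1.trans h'.2)).elim
    · exact (lt_asymm h.1 (h'.1.trans h'.2)).elim
    · exact Or.inr ⟨h'.1, h'.2.trans h.2⟩
  · exact Finset.mem_filter.2 ⟨ha', h⟩
  · rw [Finset.mem_filter]
    rintro ⟨-, ⟨h, -⟩ | ⟨-, h⟩⟩ <;> exact lt_irrefl _ h

/-- The gaps between `b` and the keys on one side of it are distinct. -/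
lemma sum_gap_le {g : ℕ → ℝ} (hg : ∀ k, 0 ≤ g k) (X : Finset K) (b : K) :
    ∑ a ∈ X.filter (· ≠ b), g (gap X a b) ≤ 2 * ∑ k ∈ Finset.range X.card, g k := by
  have side : ∀ S ⊆ X, (∀ a ∈ S, ∀ a' ∈ S, a ≠ a' → Between a a' b ∨ Between a' a b) →
      ∑ a ∈ S, g (gap X a b) ≤ ∑ k ∈ Finset.range X.card, g k := by
    intro S hS hb
    have hinj : Set.InjOn (fun a => gap X a b) S := by
      intro a ha a' ha' h
      by_contra hne
      rcases hb a ha a' ha' hne with h1 | h1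
      · exact (gap_lt_gap (hS ha') h1).ne' h
      · exact (gap_lt_gap (hS ha) h1).ne h
    rw [← Finset.sum_image (f := g) hinj]
    refine Finset.sum_le_sum_of_subset_of_nonneg ?_ fun k _ _ => hg k
    intro k hk
    obtain ⟨a, ha, rfl⟩ := Finset.mem_image.1 hk
    exact Finset.mem_range.2 (gap_lt_card (hS ha))
  have h1 := side (X.filter (· < b)) (Finset.filter_subset _ _) fun a ha a' ha' hne => by
    rw [Finset.mem_filter] at ha ha'
    rcases hne.lt_or_gt with h | h
    · exact Or.inl (Or.inl ⟨h, ha'.2⟩)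
    · exact Or.inr (Or.inl ⟨h, ha.2⟩)
  have h2 := side (X.filter (b < ·)) (Finset.filter_subset _ _) fun a ha a' ha' hne => by
    rw [Finset.mem_filter] at ha ha'
    rcases hne.lt_or_gt with h | h
    · exact Or.inr (Or.inr ⟨ha.2, h⟩)
    · exact Or.inl (Or.inr ⟨ha'.2, h⟩)
  have h3 : X.filter (· ≠ b) = X.filter (· < b) ∪ X.filter (b < ·) := by
    rw [← Finset.filter_or]
    exact Finset.filter_congr fun a _ => lt_or_lt_iff_ne.symm
  rw [h3, Finset.sum_union]
  · linarith
  · rw [Finset.disjoint_filter]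
    exact fun a _ h h' => lt_asymm h h'

lemma sum_inv_mul_add_le {N : ℕ} (hN : 1 ≤ N) (n : ℕ) :
    ∑ k ∈ Finset.range n, (N : ℝ) / ((k + 1) * (k + 1 + N)) ≤ 1 + Real.log N := by
  have hN' : (1 : ℝ) ≤ N := by exact_mod_cast hN
  have h1 : ∀ k ∈ Finset.range n, (N : ℝ) / ((k + 1) * (k + 1 + N)) =
      ((k : ℝ) + 1)⁻¹ - (((N + k : ℕ) : ℝ) + 1)⁻¹ := by
    intro k _
    have h2 : ((k : ℝ) + 1) ≠ 0 := by positivity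
    have h3 : ((k : ℝ) + 1 + N) ≠ 0 := by positivity
    have h4 : (((N + k : ℕ) : ℝ) + 1) = k + 1 + N := by push_cast; ring
    rw [h4]
    field_simp
    ring
  rw [Finset.sum_congr rfl h1, Finset.sum_sub_distrib]
  have h2 := Finset.sum_range_add (fun k : ℕ => ((k : ℝ) + 1)⁻¹) N n
  have h3 : ∑ k ∈ Finset.range n, ((k : ℝ) + 1)⁻¹ ≤ ∑ k ∈ Finset.range (N + n), ((k : ℝ) + 1)⁻¹ :=
    Finset.sum_le_sum_of_subset_of_nonneg (Finset.range_mono (by omega)) fun _ _ _ => by positivity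
  have h4 : ∑ k ∈ Finset.range N, ((k : ℝ) + 1)⁻¹ ≤ 1 + Real.log N := by
    have := harmonic_le_one_add_log N
    simpa [harmonic] using this
  linarith

lemma sum_inv_sq_le (n : ℕ) : ∑ k ∈ Finset.range n, 1 / ((k : ℝ) + 1) ^ 2 ≤ 2 := by
  have h : ∑ k ∈ Finset.range n, 1 / ((k : ℝ) + 1) ^ 2 ≤ 2 - 2 / ((n : ℝ) + 1) := by
    induction n with
    | zero => norm_num
    | succ n ih =>
      rw [Finset.sum_range_succ]
      have h1 : (0 : ℝ) ≤ n := n.cast_nonneg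
      have h2 : 1 / ((n : ℝ) + 1) ^ 2 + 2 / ((n : ℝ) + 1 + 1) ≤ 2 / ((n : ℝ) + 1) := by
        rw [div_add_div _ _ (by positivity) (by positivity),
          div_le_div_iff₀ (by positivity) (by positivity)]
        nlinarith [mul_nonneg h1 h1, mul_nonneg (mul_nonneg h1 h1) h1]
      push_cast
      linarith
  have : (0 : ℝ) ≤ 2 / ((n : ℝ) + 1) := by positivity
  linarith

/-- The product of the two gap lengths is compared with two summable expressions, one for each
variable. -/
lemma one_div_mul_le {r q N : ℝ} (hr : 0 < r) (hq : 1 ≤ q) (hN : 0 < N) :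
    1 / (r * q) ≤ 2 * (N / (r * (r + N))) + 1 / N * (1 / q ^ 2) := by
  have hq0 : 0 < q := by linarith
  rcases le_total r N with h | h
  · have h1 : 1 / (r * q) ≤ 1 / r := one_div_le_one_div_of_le hr (by nlinarith)
    have h2 : 1 / r ≤ 2 * (N / (r * (r + N))) := by
      rw [← mul_div_assoc, div_le_div_iff₀ hr (by positivity)]
      nlinarith
    have h3 : 0 ≤ 1 / N * (1 / q ^ 2) := by positivity
    linarith
  · have h1 : N / r ^ 2 ≤ 2 * (N / (r * (r + N))) := by
      rw [← mul_div_assoc, div_le_div_iff₀ (by positivity) (by positivity)]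
      nlinarith [mul_pos hN hr, mul_nonneg (mul_pos hN hr).le (sub_nonneg.2 h)]
    have h2 : 1 / (r * q) ≤ N / r ^ 2 + 1 / N * (1 / q ^ 2) := by
      have : N / r ^ 2 + 1 / N * (1 / q ^ 2) - 1 / (r * q) =
          ((N / r - 1 / q) ^ 2 + N / (r * q)) / N := by field_simp; ring
      have h3 : 0 ≤ ((N / r - 1 / q) ^ 2 + N / (r * q)) / N := by positivity
      linarith
    linarith

/-- The bound on the probability that `a` is a joint record for `b`. -/
def pairWeight (X Y : Finset K) (a b : K) : ℝ := 4 / ((gap X a b + 1) * (gap Y a b + 1))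

lemma sum_pairWeight_le_of_le (hY : Y.Nonempty) (hc : Y.card ≤ X.card) :
    ∑ b ∈ Y, ∑ a ∈ X.filter (· ≠ b), pairWeight X Y a b ≤ 48 * workBound X.card Y.card := by
  have hm : 1 ≤ Y.card := hY.card_pos
  rw [workBound_comm]
  refine le_trans ?_ (mul_le_mul_of_nonneg_left (le_workBound hc) (by norm_num))
  have hL := one_le_logb_div_add_one hm hc
  set m := Y.card
  set n := X.card
  set L := Real.logb 2 ((n : ℝ) / m + 1)
  have hm0 : (0 : ℝ) < m := by exact_mod_cast hm
  have hmn : (m : ℝ) ≤ n := by exact_mod_cast hc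
  have hnm : 1 ≤ (n : ℝ) / m := by rwa [one_le_div hm0]
  -- with this `N`, the first part of the bound sums to `O(log N)` for each of the `m` keys of `Y`,
  -- and the second one to `O(1 / N)` for each of the `n` keys of `X`
  set N := ⌈(n : ℝ) / m⌉₊
  have hN : 1 ≤ N := Nat.one_le_iff_ne_zero.2 (Nat.ceil_pos.2 (by linarith)).ne'
  have hN0 : (0 : ℝ) < N := by exact_mod_cast hN
  have hN1 : (n : ℝ) / m ≤ N := Nat.le_ceil _
  have hN2 : (N : ℝ) ≤ n / m + 1 := (Nat.ceil_lt_add_one (by linarith)).le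
  have hlog : Real.log N ≤ L := by
    have h1 : Real.log N ≤ Real.log ((n : ℝ) / m + 1) := Real.log_le_log hN0 hN2
    have h2 : Real.log ((n : ℝ) / m + 1) ≤ L := by
      have h3 : 0 ≤ Real.log ((n : ℝ) / m + 1) := Real.log_nonneg (by linarith)
      have h4 : Real.log 2 ≤ 1 := by linarith [Real.log_two_lt_d9]
      rw [show L = Real.log ((n : ℝ) / m + 1) / Real.log 2 from rfl,
        le_div_iff₀ (Real.log_pos one_lt_two)]
      nlinarith
    linarith
  have hnN : (n : ℝ) / N ≤ m := by
    rw [div_le_iff₀ hN0]; rw [div_le_iff₀ hm0] at hN1; linarith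
  have hpt : ∀ b ∈ Y, ∀ a ∈ X.filter (· ≠ b), pairWeight X Y a b ≤
      8 * ((N : ℝ) / ((gap X a b + 1) * (gap X a b + 1 + N))) +
        4 / (N : ℝ) * (1 / ((gap Y b a : ℝ) + 1) ^ 2) := by
    intro b _ a _
    have := one_div_mul_le (r := (gap X a b : ℝ) + 1) (q := (gap Y b a : ℝ) + 1) (N := N)
      (by positivity) (by linarith [(gap Y b a).cast_nonneg (α := ℝ)]) hN0
    rw [pairWeight, gap_comm Y a b]
    rw [show (4 : ℝ) / ((gap X a b + 1) * (gap Y b a + 1)) =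
      4 * (1 / ((gap X a b + 1) * (gap Y b a + 1))) by ring,
      show (4 : ℝ) / N = 4 * (1 / N) by ring]
    linarith
  have h1 : ∑ b ∈ Y, ∑ a ∈ X.filter (· ≠ b),
      8 * ((N : ℝ) / ((gap X a b + 1) * (gap X a b + 1 + N))) ≤ (m : ℝ) * (16 * (2 * L)) := by
    rw [show (m : ℝ) * (16 * (2 * L)) = Y.card • (16 * (2 * L)) by rw [nsmul_eq_mul]]
    refine Finset.sum_le_card_nsmul _ _ _ fun b _ => ?_
    rw [← Finset.mul_sum]
    have h2 := sum_gap_le (g := fun k => (N : ℝ) / ((k + 1) * (k + 1 + N)))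
      (fun k => by positivity) X b
    have h3 := sum_inv_mul_add_le hN X.card
    linarith
  have h2 : ∑ b ∈ Y, ∑ a ∈ X.filter (· ≠ b), 4 / (N : ℝ) * (1 / ((gap Y b a : ℝ) + 1) ^ 2) ≤
      16 * (m : ℝ) := by
    have h3 : ∑ b ∈ Y, ∑ a ∈ X.filter (· ≠ b), 4 / (N : ℝ) * (1 / ((gap Y b a : ℝ) + 1) ^ 2) =
        ∑ a ∈ X, ∑ b ∈ Y.filter (· ≠ a), 4 / (N : ℝ) * (1 / ((gap Y b a : ℝ) + 1) ^ 2) :=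
      Finset.sum_comm' fun b a => by
        simp only [Finset.mem_filter]
        exact ⟨fun h => ⟨⟨h.1, h.2.2.symm⟩, h.2.1⟩, fun h => ⟨h.1.1, h.2, h.1.2.symm⟩⟩
    rw [h3]
    have h4 : ∑ a ∈ X, ∑ b ∈ Y.filter (· ≠ a), 4 / (N : ℝ) * (1 / ((gap Y b a : ℝ) + 1) ^ 2) ≤
        X.card • (4 / (N : ℝ) * 4) := by
      refine Finset.sum_le_card_nsmul _ _ _ fun a _ => ?_
      rw [← Finset.mul_sum]
      have h5 := sum_gap_le (g := fun k => 1 / ((k : ℝ) + 1) ^ 2) (fun k => by positivity) Y a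
      have h6 := sum_inv_sq_le Y.card
      exact mul_le_mul_of_nonneg_left (by linarith) (by positivity)
    refine h4.trans ?_
    rw [nsmul_eq_mul]
    calc (n : ℝ) * (4 / N * 4) = 16 * (n / N) := by ring
      _ ≤ 16 * m := by linarith
  calc _ ≤ ∑ b ∈ Y, ∑ a ∈ X.filter (· ≠ b),
        (8 * ((N : ℝ) / ((gap X a b + 1) * (gap X a b + 1 + N))) +
          4 / (N : ℝ) * (1 / ((gap Y b a : ℝ) + 1) ^ 2)) :=
        Finset.sum_le_sum fun b hb => Finset.sum_le_sum fun a ha => hpt b hb a ha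
    _ ≤ (m : ℝ) * (16 * (2 * L)) + 16 * (m : ℝ) := by
        simp only [Finset.sum_add_distrib]
        exact add_le_add h1 h2
    _ ≤ 48 * ((m : ℝ) * L) := by nlinarith

lemma sum_pairWeight_le (X Y : Finset K) :
    ∑ b ∈ Y, ∑ a ∈ X.filter (· ≠ b), pairWeight X Y a b ≤ 48 * workBound X.card Y.card := by
  have hw := one_le_workBound X.card Y.card
  rcases Y.eq_empty_or_nonempty with rfl | hY
  · simp only [Finset.sum_empty]; linarith
  rcases X.eq_empty_or_nonempty with rfl | hX
  · simp only [Finset.filter_empty, Finset.sum_empty, Finset.sum_const_zero]; linarith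
  rcases le_total Y.card X.card with h | h
  · exact sum_pairWeight_le_of_le hY h
  · have h1 := sum_pairWeight_le_of_le hX h
    rw [workBound_comm]
    refine le_trans (le_of_eq ?_) h1
    rw [Finset.sum_comm' (s' := fun a => Y.filter (· ≠ a)) (t' := X)]
    · refine Finset.sum_congr rfl fun a _ => Finset.sum_congr rfl fun b _ => ?_
      rw [pairWeight, pairWeight, gap_comm X a b, gap_comm Y a b, mul_comm]
    · intro b a
      simp only [Finset.mem_filter]
      exact ⟨fun h => ⟨⟨h.1, h.2.2.symm⟩, h.2.1⟩, fun h => ⟨h.1.1, h.2, h.1.2.symm⟩⟩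

lemma min_le_workBound (a b : ℕ) : ((min a b : ℕ) : ℝ) ≤ workBound a b := by
  wlog h : a ≤ b
  · rw [workBound_comm, min_comm]; exact this _ _ (le_of_not_ge h)
  rw [min_eq_left h]
  rcases a.eq_zero_or_pos with rfl | ha
  · have := one_le_workBound 0 b; push_cast; linarith
  · refine le_trans ?_ (le_workBound h)
    have := one_le_logb_div_add_one ha h
    have h0 : (0 : ℝ) ≤ a := a.cast_nonneg
    nlinarith

/-- Up to a factor, the work bound is monotone. -/
lemma workBound_le_two_mul {a' a : ℕ} (b : ℕ) (h : a' ≤ a) :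
    workBound a' b ≤ 2 * workBound a b := by
  have hw := one_le_workBound a b
  refine max_le (by linarith) ?_
  rcases b.eq_zero_or_pos with rfl | hb
  · simp only [Nat.zero_le, min_eq_right, Nat.cast_zero, zero_mul]; linarith
  have hb0 : (0 : ℝ) < b := by exact_mod_cast hb
  rcases le_total b a' with h1 | h1
  · rw [min_eq_right h1, max_eq_left h1]
    have h2 : (b : ℝ) * Real.logb 2 ((a' : ℝ) / b + 1) ≤ b * Real.logb 2 ((a : ℝ) / b + 1) := by
      refine mul_le_mul_of_nonneg_left ?_ hb0.le
      refine Real.logb_le_logb_of_le one_lt_two (by positivity) ?_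
      gcongr
    have h3 := le_workBound (h1.trans h)
    rw [workBound_comm] at h3
    linarith
  rw [min_eq_left h1, max_eq_right h1]
  rcases a'.eq_zero_or_pos with rfl | ha
  · simp only [Nat.cast_zero, zero_mul]; linarith
  have ha0 : (0 : ℝ) < a' := by exact_mod_cast ha
  have haa : (a' : ℝ) ≤ a := by exact_mod_cast h
  rcases le_total a b with h2 | h2
  · have h3 := le_workBound h2
    have h4 : (a' : ℝ) * Real.logb 2 ((b : ℝ) / a' + 1) ≤ a * Real.logb 2 ((b : ℝ) / a + 1) := by
      -- Bernoulli's inequality with the exponent `a' / a ≤ 1`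
      have h5 := _root_.rpow_one_add_le_one_add_mul_self (s := (b : ℝ) / a') (p := (a' : ℝ) / a)
        (by linarith [div_pos hb0 ha0]) (by positivity) (div_le_one_of_le₀ haa (by linarith))
      have h6 : (a' : ℝ) / a * (b / a') = b / a := by field_simp
      rw [h6] at h5
      have h7 := Real.logb_le_logb_of_le one_lt_two (by positivity) h5
      rw [Real.logb_rpow_eq_mul_logb_of_pos (by positivity), add_comm, add_comm 1 ((b : ℝ) / a),
        div_mul_eq_mul_div, div_le_iff₀ (by linarith)] at h7
      linarith
    linarith
  · have h3 := min_le_workBound a b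
    rw [min_eq_right h2] at h3
    have h4 := logb_two_one_add_le (y := (b : ℝ) / a') (by positivity)
    rw [add_comm] at h4
    have h5 : (a' : ℝ) * (2 * (b / a')) = 2 * b := by field_simp
    have h6 := mul_le_mul_of_nonneg_left h4 ha0.le
    linarith

end Sums

end Treap

/-! ### Independent uniform priorities -/

namespace Treap

open MeasureTheory ProbabilityTheory Set

/-- A family of independent random variables that are uniform on `[0, 1]`. -/
structure IsUniformFamily {Ω : Type v} {ι : Type w} [MeasurableSpace Ω] (P : ι → Ω → ℝ)
    (μ : Measure Ω) : Prop where
  measurable : ∀ i, Measurable (P i)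
  uniform : ∀ i, pdf.IsUniform (P i) (Icc 0 1) μ
  indep : iIndepFun P μ

/-- The number of records of the sequence `f i`, `i` in the list, below the start value `x`: the
entries that are at most `x` and at most all earlier entries. -/
def recordCount {ι : Type w} (f : ι → ℝ) : ℝ → List ι → ℕ
  | _, [] => 0
  | x, i :: l => if f i ≤ x then recordCount f (f i) l + 1 else recordCount f x l

lemma recordCount_congr {ι : Type w} {f g : ι → ℝ} {l : List ι} (h : ∀ i ∈ l, f i = g i) (x : ℝ) :
    recordCount f x l = recordCount g x l := by
  induction l generalizing x with
  | nil => rfl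
  | cons i l ih =>
    have h' : ∀ i ∈ l, f i = g i := fun j hj => h j (List.mem_cons_of_mem _ hj)
    simp only [recordCount, h i List.mem_cons_self, ih h']

lemma recordCount_map {ι : Type w} {κ : Type u} (f : ι → ℝ) (ν : κ → ι) (l : List κ) (x : ℝ) :
    recordCount f x (l.map ν) = recordCount (f ∘ ν) x l := by
  induction l generalizing x with
  | nil => rfl
  | cons i l ih => simp only [List.map_cons, recordCount, ih, Function.comp_apply]

lemma measurable_recordCount {ι : Type w} {S : Type v} [MeasurableSpace S] {f : S → ι → ℝ}
    (hf : ∀ i, Measurable fun s => f s i) (l : List ι) {x : S → ℝ} (hx : Measurable x) :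
    Measurable fun s => recordCount (f s) (x s) l := by
  induction l generalizing x with
  | nil => exact measurable_const
  | cons i l ih =>
    exact Measurable.ite (measurableSet_le (hf i) hx) ((ih (hf i)).add_const 1) (ih hx)

lemma setLIntegral_Icc_ofReal {a b : ℝ} {f : ℝ → ℝ} (hab : a ≤ b) (hf : Continuous f)
    (h0 : ∀ s ∈ Icc a b, 0 ≤ f s) :
    ∫⁻ s in Icc a b, ENNReal.ofReal (f s) = ENNReal.ofReal (∫ s in a..b, f s) := by
  rw [← ofReal_integral_eq_lintegral_ofReal (hf.continuousOn.integrableOn_compact isCompact_Icc)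
    ((ae_restrict_iff' measurableSet_Icc).2 (ae_of_all _ h0)), integral_Icc_eq_integral_Ioc,
    intervalIntegral.integral_of_le hab]

namespace IsUniformFamily

variable {Ω : Type v} {ι : Type w} [MeasurableSpace Ω] {P : ι → Ω → ℝ} {μ : Measure Ω}

lemma map_eq (h : IsUniformFamily P μ) (i : ι) : μ.map (P i) = volume.restrict (Icc 0 1) := by
  rw [h.uniform i, ProbabilityTheory.cond]
  simp

lemma isProbabilityMeasure (h : IsUniformFamily P μ) : IsProbabilityMeasure μ :=
  h.indep.isProbabilityMeasure

lemma measurable_tuple (h : IsUniformFamily P μ) : Measurable fun ω i => P i ω :=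
  measurable_pi_lambda _ h.measurable

lemma measure_le (h : IsUniformFamily P μ) (i : ι) {s : ℝ} (hs : s ∈ Icc (0 : ℝ) 1) :
    μ {ω | s ≤ P i ω} = ENNReal.ofReal (1 - s) := by
  have h1 : {ω | s ≤ P i ω} = P i ⁻¹' Ici s := rfl
  rw [h1, ← Measure.map_apply (h.measurable i) measurableSet_Ici, h.map_eq,
    Measure.restrict_apply measurableSet_Ici, show Ici s ∩ Icc 0 1 = Icc s 1 from ?_,
    Real.volume_Icc]
  ext y
  simp only [mem_inter_iff, mem_Ici, mem_Icc]
  exact ⟨fun h => ⟨h.1, h.2.2⟩, fun h => ⟨h.1, hs.1.trans h.1, h.2⟩⟩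

lemma ae_le_one (h : IsUniformFamily P μ) (i : ι) : ∀ᵐ ω ∂μ, P i ω ≤ 1 := by
  have h1 : ∀ᵐ s ∂(μ.map (P i)), s ≤ 1 := by
    rw [h.map_eq]
    exact (ae_restrict_iff' measurableSet_Icc).2 (ae_of_all _ fun s hs => hs.2)
  exact ae_of_ae_map (h.measurable i).aemeasurable h1

open Classical in
/-- Conditioning on one of the variables: an expression in `P i` and in variables other than `P i`
is integrated over the values of `P i` last. -/
lemma lintegral_eq (h : IsUniformFamily P μ) {i : ι} {S : Finset ι} (hi : i ∉ S)
    {G : ℝ → (ι → ℝ) → ℝ≥0∞} (hG : Measurable (Function.uncurry G))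
    (hS : ∀ s f g, (∀ j ∈ S, f j = g j) → G s f = G s g) :
    ∫⁻ ω, G (P i ω) (fun j => P j ω) ∂μ =
      ∫⁻ s in Icc (0 : ℝ) 1, ∫⁻ ω, G s (fun j => P j ω) ∂μ := by
  have := h.isProbabilityMeasure
  let ext : (S → ℝ) → ι → ℝ := fun g j => if hj : j ∈ S then g ⟨j, hj⟩ else 0
  have hext : Measurable ext := by
    refine measurable_pi_lambda _ fun j => ?_
    by_cases hj : j ∈ S
    · simp only [ext, hj, dite_true]; exact measurable_pi_apply _
    · simp only [ext, hj, dite_false]; exact measurable_const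
  let T : Ω → S → ℝ := fun ω j => P j ω
  have hT : Measurable T := measurable_pi_lambda _ fun j => h.measurable j
  have hGext : ∀ s ω, G s (fun j => P j ω) = G s (ext (T ω)) := fun s ω =>
    hS s _ _ fun j hj => by simp [ext, T, hj]
  have hind : IndepFun (P i) T μ :=
    (h.indep.indepFun_finset {i} S (by simpa using hi) h.measurable).comp
      (φ := fun g : ({i} : Finset ι) → ℝ => g ⟨i, by simp⟩) (ψ := id)
      (measurable_pi_apply _) measurable_id
  have hmap := (indepFun_iff_map_prod_eq_prod_map_map (h.measurable i).aemeasurable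
    hT.aemeasurable).1 hind
  have hG' : Measurable fun z : ℝ × (S → ℝ) => G z.1 (ext z.2) :=
    hG.comp (measurable_fst.prodMk (hext.comp measurable_snd))
  have : IsProbabilityMeasure (μ.map T) := Measure.isProbabilityMeasure_map hT.aemeasurable
  simp only [hGext]
  calc ∫⁻ ω, G (P i ω) (ext (T ω)) ∂μ
      = ∫⁻ z, G z.1 (ext z.2) ∂(μ.map fun ω => (P i ω, T ω)) :=
        (lintegral_map hG' ((h.measurable i).prodMk hT)).symm
    _ = ∫⁻ s, ∫⁻ g, G s (ext g) ∂(μ.map T) ∂(μ.map (P i)) := by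
        rw [hmap, lintegral_prod _ hG'.aemeasurable]
    _ = _ := by
        rw [h.map_eq]
        refine lintegral_congr fun s => ?_
        exact lintegral_map (f := fun g => G s (ext g)) (hG'.comp measurable_prodMk_left) hT

lemma measure_forall_le (h : IsUniformFamily P μ) (U : Finset ι) {s : ℝ}
    (hs : s ∈ Icc (0 : ℝ) 1) : μ {ω | ∀ j ∈ U, s ≤ P j ω} = ENNReal.ofReal ((1 - s) ^ U.card) := by
  have h1 : {ω | ∀ j ∈ U, s ≤ P j ω} = ⋂ j ∈ U, P j ⁻¹' Ici s := by
    ext ω; simp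
  rw [h1, h.indep.measure_inter_preimage_eq_mul U (sets := fun _ => Ici s)
    (fun _ _ => measurableSet_Ici)]
  have h2 : ∀ j ∈ U, μ (P j ⁻¹' Ici s) = ENNReal.ofReal (1 - s) := fun j _ => h.measure_le j hs
  rw [Finset.prod_congr rfl h2, Finset.prod_const, ENNReal.ofReal_pow (by linarith [hs.2])]

open Classical in
/-- One variable is the least of `k + 1` with probability `∫ (1 - s) ^ k = 1 / (k + 1)`. -/
lemma measure_isLeast (h : IsUniformFamily P μ) {u : ι} {U : Finset ι} (hu : u ∉ U) :
    μ {ω | ∀ j ∈ U, P u ω ≤ P j ω} = ENNReal.ofReal (1 / (U.card + 1)) := by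
  have hm : MeasurableSet {z : ℝ × (ι → ℝ) | ∀ j ∈ U, z.1 ≤ z.2 j} := by
    have : {z : ℝ × (ι → ℝ) | ∀ j ∈ U, z.1 ≤ z.2 j} = ⋂ j ∈ U, {z | z.1 ≤ z.2 j} := by
      ext z; simp
    rw [this]
    exact Finset.measurableSet_biInter _ fun j _ =>
      measurableSet_le measurable_fst ((measurable_pi_apply j).comp measurable_snd)
  have hE : ∀ X : Ω → ℝ, Measurable X → MeasurableSet {ω | ∀ j ∈ U, X ω ≤ P j ω} := fun X hX =>
    (hX.prodMk h.measurable_tuple) hm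
  have h1 := h.lintegral_eq hu (G := fun s f => if ∀ j ∈ U, s ≤ f j then 1 else 0)
    (Measurable.ite hm measurable_const measurable_const) (by
      intro s f g hfg
      have : (∀ j ∈ U, s ≤ f j) ↔ ∀ j ∈ U, s ≤ g j :=
        forall₂_congr fun j hj => by rw [hfg j hj]
      simp only [this])
  have h2 : ∀ X : Ω → ℝ, Measurable X →
      ∫⁻ ω, (if ∀ j ∈ U, X ω ≤ P j ω then 1 else 0) ∂μ = μ {ω | ∀ j ∈ U, X ω ≤ P j ω} := by
    intro X hX
    rw [← lintegral_indicator_one (hE X hX)]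
    exact lintegral_congr fun ω => by simp [indicator_apply]
  rw [← h2 _ (h.measurable u), h1]
  have h3 : ∀ s ∈ Icc (0 : ℝ) 1, ∫⁻ ω, (if ∀ j ∈ U, s ≤ P j ω then 1 else 0) ∂μ =
      ENNReal.ofReal ((1 - s) ^ U.card) := fun s hs => by
    rw [h2 (fun _ => s) measurable_const]; exact h.measure_forall_le U hs
  rw [setLIntegral_congr_fun measurableSet_Icc h3, setLIntegral_Icc_ofReal zero_le_one (by fun_prop)
    fun s hs => pow_nonneg (by linarith [hs.2]) _]
  congr 1
  have := intervalIntegral.integral_comp_sub_left (a := 0) (b := 1) (fun s : ℝ => s ^ U.card) 1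
  rw [this]
  simp

/-- Each record doubles the integrand, but the chance of a record is the current minimum. -/
lemma lintegral_two_pow_recordCount_le (h : IsUniformFamily P μ) {l : List ι} (hl : l.Nodup)
    {x : ℝ} (hx : x ∈ Icc (0 : ℝ) 1) :
    ∫⁻ ω, 2 ^ recordCount (fun i => P i ω) x l ∂μ ≤ ENNReal.ofReal (1 + l.length * x) := by
  have := h.isProbabilityMeasure
  induction l generalizing x with
  | nil => simp [recordCount]
  | cons i l ih =>
    rw [List.nodup_cons] at hl
    classical
    have hmeas : ∀ {y : ℝ × (ι → ℝ) → ℝ}, Measurable y →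
        Measurable fun z => (2 : ℝ≥0∞) ^ recordCount z.2 (y z) l := fun hy =>
      (measurable_from_nat (f := fun k => (2 : ℝ≥0∞) ^ k)).comp
        (measurable_recordCount (fun i => (measurable_pi_apply i).comp measurable_snd) l hy)
    have h1 := h.lintegral_eq (i := i) (S := l.toFinset) (by simpa using hl.1)
      (G := fun s f => if s ≤ x then 2 ^ recordCount f s l * 2 else 2 ^ recordCount f x l)
      (Measurable.ite (measurableSet_le measurable_fst measurable_const)
        ((hmeas measurable_fst).mul_const 2) (hmeas measurable_const)) (by
        intro s f g hfg
        have hfg' : ∀ j ∈ l, f j = g j := fun j hj => hfg j (List.mem_toFinset.2 hj)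
        simp only [recordCount_congr hfg'])
    have h2 : ∀ ω, (2 : ℝ≥0∞) ^ recordCount (fun i => P i ω) x (i :: l) =
        if P i ω ≤ x then 2 ^ recordCount (fun i => P i ω) (P i ω) l * 2
        else 2 ^ recordCount (fun i => P i ω) x l := by
      intro ω
      simp only [recordCount]
      split_ifs
      · rw [pow_succ]
      · rfl
    simp only [h2]
    rw [h1]
    set n : ℝ := (l.length : ℝ)
    have hn : 0 ≤ n := Nat.cast_nonneg _
    have hx0 := hx.1
    have hx1 := hx.2
    have hsub : Icc (0 : ℝ) 1 ⊆ Icc 0 x ∪ Ioc x 1 := fun s hs => by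
      rcases le_or_gt s x with h | h
      · exact Or.inl ⟨hs.1, h⟩
      · exact Or.inr ⟨h, hs.2⟩
    refine (lintegral_mono_set hsub).trans ((lintegral_union_le _ _ _).trans ?_)
    have h3 : ∫⁻ s in Icc 0 x, ∫⁻ ω, (if s ≤ x then 2 ^ recordCount (fun i => P i ω) s l * 2
        else 2 ^ recordCount (fun i => P i ω) x l) ∂μ ≤ ENNReal.ofReal (2 * x + n * x ^ 2) := by
      have h4 : ∀ s ∈ Icc 0 x, ∫⁻ ω, (if s ≤ x then 2 ^ recordCount (fun i => P i ω) s l * 2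
          else 2 ^ recordCount (fun i => P i ω) x l) ∂μ ≤ ENNReal.ofReal ((1 + n * s) * 2) := by
        intro s hs
        simp only [if_pos hs.2]
        rw [lintegral_mul_const' _ _ ENNReal.ofNat_ne_top, ENNReal.ofReal_mul' (by norm_num)]
        gcongr
        · exact ih hl.2 ⟨hs.1, hs.2.trans hx1⟩
        · simp
      refine (setLIntegral_mono' measurableSet_Icc h4).trans ?_
      rw [setLIntegral_Icc_ofReal hx0 (by fun_prop) fun s hs => by have := hs.1; positivity]
      refine ENNReal.ofReal_le_ofReal (le_of_eq ?_)
      have h6 : IntervalIntegrable (fun s => n * s) volume 0 x :=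
        Continuous.intervalIntegrable (by fun_prop) _ _
      rw [intervalIntegral.integral_mul_const, intervalIntegral.integral_add (by simp) h6,
        intervalIntegral.integral_const_mul, integral_id, intervalIntegral.integral_const,
        smul_eq_mul]
      ring
    have h5 : ∫⁻ s in Ioc x 1, ∫⁻ ω, (if s ≤ x then 2 ^ recordCount (fun i => P i ω) s l * 2
        else 2 ^ recordCount (fun i => P i ω) x l) ∂μ ≤
        ENNReal.ofReal ((1 + n * x) * (1 - x)) := by
      have h4 : ∀ s ∈ Ioc x 1, ∫⁻ ω, (if s ≤ x then 2 ^ recordCount (fun i => P i ω) s l * 2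
          else 2 ^ recordCount (fun i => P i ω) x l) ∂μ ≤ ENNReal.ofReal (1 + n * x) := by
        intro s hs
        simp only [if_neg (not_le.2 hs.1)]
        exact ih hl.2 hx
      refine (setLIntegral_mono' measurableSet_Ioc h4).trans ?_
      rw [setLIntegral_const, Real.volume_Ioc, ENNReal.ofReal_mul (by positivity)]
    refine (add_le_add h3 h5).trans ?_
    rw [← ENNReal.ofReal_add (by positivity) (mul_nonneg (by positivity) (by linarith))]
    refine ENNReal.ofReal_le_ofReal (le_of_eq ?_)
    simp only [List.length_cons]
    push_cast
    ring

end IsUniformFamily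

end Treap

/-! ### The expected work on treaps -/

namespace Treap

open MeasureTheory ProbabilityTheory Set

lemma exists_disjoint_subsets {ι : Type w} (U V : Finset ι) :
    ∃ U' ⊆ U, ∃ V' ⊆ V, Disjoint U' V' ∧ U.card + 1 ≤ 2 * (U'.card + 1) ∧
      V.card + 1 ≤ 2 * (V'.card + 1) := by
  classical
  obtain ⟨W, hW, hc⟩ := Finset.exists_subset_card_eq (s := U ∩ V) (n := (U ∩ V).card / 2)
    (Nat.div_le_self _ _)
  have hU : W ⊆ U := hW.trans Finset.inter_subset_left
  have hV : W ⊆ V := hW.trans Finset.inter_subset_right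
  have h1 : (U \ ((U ∩ V) \ W)).card + ((U ∩ V) \ W).card = U.card :=
    Finset.card_sdiff_add_card_eq_card (Finset.sdiff_subset.trans Finset.inter_subset_left)
  have h2 : ((U ∩ V) \ W).card + W.card = (U ∩ V).card := Finset.card_sdiff_add_card_eq_card hW
  have h3 : (V \ W).card + W.card = V.card := Finset.card_sdiff_add_card_eq_card hV
  have h4 := Finset.card_le_card (Finset.inter_subset_left (s₁ := U) (s₂ := V))
  have h5 := Finset.card_le_card (Finset.inter_subset_right (s₁ := U) (s₂ := V))
  refine ⟨U \ ((U ∩ V) \ W), Finset.sdiff_subset, V \ W, Finset.sdiff_subset, ?_, by omega,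
    by omega⟩
  rw [Finset.disjoint_left]
  intro x hx hx'
  simp only [Finset.mem_sdiff, Finset.mem_inter] at hx hx'
  tauto

namespace IsUniformFamily

variable {Ω : Type v} {ι : Type w} [MeasurableSpace Ω] {P : ι → Ω → ℝ} {μ : Measure Ω}

lemma measurableSet_isLeast (h : IsUniformFamily P μ) (u : ι) (U : Finset ι) :
    MeasurableSet {ω | ∀ j ∈ U, P u ω ≤ P j ω} := by
  have : {ω | ∀ j ∈ U, P u ω ≤ P j ω} = ⋂ j ∈ U, {ω | P u ω ≤ P j ω} := by ext ω; simp
  rw [this]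
  exact Finset.measurableSet_biInter _ fun j _ =>
    measurableSet_le (h.measurable u) (h.measurable j)

lemma measure_isLeast_inter_of_disjoint (h : IsUniformFamily P μ) {u v : ι} {U V : Finset ι}
    (huv : u ≠ v) (huU : u ∉ U) (huV : u ∉ V) (hvU : v ∉ U) (hvV : v ∉ V) (hUV : Disjoint U V) :
    μ ({ω | ∀ j ∈ U, P u ω ≤ P j ω} ∩ {ω | ∀ j ∈ V, P v ω ≤ P j ω}) =
      ENNReal.ofReal (1 / (U.card + 1)) * ENNReal.ofReal (1 / (V.card + 1)) := by
  classical
  have hd : Disjoint (insert u U) (insert v V) := by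
    rw [Finset.disjoint_insert_left, Finset.disjoint_insert_right, Finset.mem_insert]
    exact ⟨by tauto, hvU, hUV⟩
  have hind := h.indep.indepFun_finset _ _ hd h.measurable
  have key : ∀ (k : ι) (W : Finset ι), ∃ S : Set (↥(insert k W) → ℝ), MeasurableSet S ∧
      {ω | ∀ j ∈ W, P k ω ≤ P j ω} = (fun ω (i : ↥(insert k W)) => P i ω) ⁻¹' S := by
    intro k W
    refine ⟨⋂ j : ↥(insert k W), {f | f ⟨k, Finset.mem_insert_self _ _⟩ ≤ f j},
      MeasurableSet.iInter fun j =>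
        measurableSet_le (measurable_pi_apply _) (measurable_pi_apply _), ?_⟩
    ext ω
    simp
  obtain ⟨S, hS, hS'⟩ := key u U
  obtain ⟨T, hT, hT'⟩ := key v V
  rw [← h.measure_isLeast huU, ← h.measure_isLeast hvV, hS', hT']
  exact hind.measure_inter_preimage_eq_mul _ _ hS hT

/-- The two events may share variables; halving the shared ones makes them independent at the price
of a factor `4`. -/
lemma measure_isLeast_inter_le (h : IsUniformFamily P μ) {u v : ι} {U V : Finset ι}
    (huv : u ≠ v) (huU : u ∉ U) (huV : u ∉ V) (hvU : v ∉ U) (hvV : v ∉ V) :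
    μ ({ω | ∀ j ∈ U, P u ω ≤ P j ω} ∩ {ω | ∀ j ∈ V, P v ω ≤ P j ω}) ≤
      ENNReal.ofReal (4 / ((U.card + 1) * (V.card + 1))) := by
  obtain ⟨U', hU, V', hV, hd, h1, h2⟩ := exists_disjoint_subsets U V
  have h3 := h.measure_isLeast_inter_of_disjoint huv (fun h => huU (hU h)) (fun h => huV (hV h))
    (fun h => hvU (hU h)) (fun h => hvV (hV h)) hd
  have h4 : ∀ (k : ι) {W' W : Finset ι}, W' ⊆ W →
      {ω | ∀ j ∈ W, P k ω ≤ P j ω} ⊆ {ω | ∀ j ∈ W', P k ω ≤ P j ω} :=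
    fun k W' W hW ω hω j hj => hω j (hW hj)
  refine (measure_mono (inter_subset_inter (h4 u hU) (h4 v hV))).trans (h3.le.trans ?_)
  rw [← ENNReal.ofReal_mul (by positivity)]
  refine ENNReal.ofReal_le_ofReal ?_
  have h1' : (U.card : ℝ) + 1 ≤ 2 * (U'.card + 1) := by exact_mod_cast h1
  have h2' : (V.card : ℝ) + 1 ≤ 2 * (V'.card + 1) := by exact_mod_cast h2
  rw [div_mul_div_comm, div_le_div_iff₀ (by positivity) (by positivity)]
  have := mul_le_mul h1' h2' (by positivity) (by positivity)
  linarith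

variable {K : Type u} [LinearOrder K]

open Classical in
/-- The event that `a` is a joint record for `b`. -/
def jointEvent (P : ι → Ω → ℝ) (X Y : Finset K) (ν ν' : K → ι) (a b : K) : Set Ω :=
  {ω | ∀ j ∈ (X.filter fun x => Between a x b).image ν, P (ν a) ω ≤ P j ω} ∩
    {ω | ∀ j ∈ (Y.filter fun x => Between a x b).image ν', P (ν' b) ω ≤ P j ω}

lemma measurableSet_jointEvent (h : IsUniformFamily P μ) (X Y : Finset K) (ν ν' : K → ι)
    (a b : K) : MeasurableSet (jointEvent P X Y ν ν' a b) :=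
  (h.measurableSet_isLeast _ _).inter (h.measurableSet_isLeast _ _)

lemma measurable_indicator_jointEvent (h : IsUniformFamily P μ) (X Y : Finset K) (ν ν' : K → ι)
    (a b : K) : Measurable ((jointEvent P X Y ν ν' a b).indicator (1 : Ω → ℝ≥0∞)) :=
  measurable_one.indicator (h.measurableSet_jointEvent X Y ν ν' a b)

omit [MeasurableSpace Ω] in
lemma jointCount_eq_sum (P : ι → Ω → ℝ) (X Y : Finset K) (ν ν' : K → ι) (ω : Ω) :
    (jointCount X (fun k => P (ν k) ω) Y (fun k => P (ν' k) ω) : ℝ≥0∞) =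
      ∑ b ∈ Y, ∑ a ∈ X.filter (· ≠ b), (jointEvent P X Y ν ν' a b).indicator 1 ω := by
  classical
  rw [jointCount, Nat.cast_sum]
  refine Finset.sum_congr rfl fun b _ => ?_
  have : jointRecords X (fun k => P (ν k) ω) Y (fun k => P (ν' k) ω) b =
      (X.filter (· ≠ b)).filter fun a => ω ∈ jointEvent P X Y ν ν' a b := by
    ext a
    simp only [mem_jointRecords, mem_records, Finset.mem_filter, jointEvent, mem_inter_iff,
      mem_ofPred_eq, Finset.forall_mem_image, and_imp]
    tauto
  rw [this, Finset.card_filter]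
  push_cast
  exact Finset.sum_congr rfl fun a _ => by simp [indicator_apply]

lemma measurable_jointCount (h : IsUniformFamily P μ) (X Y : Finset K) (ν ν' : K → ι) :
    Measurable fun ω =>
      (jointCount X (fun k => P (ν k) ω) Y (fun k => P (ν' k) ω) : ℝ≥0∞) := by
  simp only [jointCount_eq_sum]
  exact Finset.measurable_sum _ fun b _ => Finset.measurable_sum _ fun a _ =>
    h.measurable_indicator_jointEvent X Y ν ν' a b

lemma measure_jointEvent_le (h : IsUniformFamily P μ) {X Y : Finset K} {ν ν' : K → ι}
    (hν : InjOn ν X) (hν' : InjOn ν' Y) (hc : ∀ x ∈ X, ∀ y ∈ Y, ν x = ν' y → x = y) {a b : K}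
    (ha : a ∈ X) (hb : b ∈ Y) (hab : a ≠ b) :
    μ (jointEvent P X Y ν ν' a b) ≤ ENNReal.ofReal (pairWeight X Y a b) := by
  classical
  have irl : ∀ x b : K, ¬ Between x x b := by
    rintro x b (⟨h, -⟩ | ⟨-, h⟩) <;> exact lt_irrefl _ h
  have irr : ∀ a x : K, ¬ Between a x x := by
    rintro a x (⟨-, h⟩ | ⟨h, -⟩) <;> exact lt_irrefl _ h
  have hU : ((X.filter fun x => Between a x b).image ν).card = gap X a b :=
    Finset.card_image_of_injOn (hν.mono fun _ hx => (Finset.mem_filter.1 hx).1)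
  have hV : ((Y.filter fun x => Between a x b).image ν').card = gap Y a b :=
    Finset.card_image_of_injOn (hν'.mono fun _ hx => (Finset.mem_filter.1 hx).1)
  rw [pairWeight, ← hU, ← hV]
  refine h.measure_isLeast_inter_le (fun h => hab (hc a ha b hb h)) ?_ ?_ ?_ ?_ <;>
    simp only [Finset.mem_image, Finset.mem_filter, not_exists, not_and, and_imp]
  · intro x hx hbt hxa
    exact irl a b (hν hx ha hxa ▸ hbt)
  · intro y hy hbt hya
    exact irl y b ((hc a ha y hy hya.symm) ▸ hbt)
  · intro x hx hbt hxb
    exact irr a b ((hc x hx b hb hxb) ▸ hbt)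
  · intro y hy hbt hyb
    exact irr a b ((hν' hy hb hyb) ▸ hbt)

/-- The expected number of joint records. -/
lemma lintegral_jointCount_le (h : IsUniformFamily P μ) {X Y : Finset K} {ν ν' : K → ι}
    (hν : InjOn ν X) (hν' : InjOn ν' Y) (hc : ∀ x ∈ X, ∀ y ∈ Y, ν x = ν' y → x = y) :
    ∫⁻ ω, (jointCount X (fun k => P (ν k) ω) Y (fun k => P (ν' k) ω) : ℝ≥0∞) ∂μ ≤
      ENNReal.ofReal (48 * workBound X.card Y.card) := by
  simp only [jointCount_eq_sum]
  rw [lintegral_finsetSum _ fun b _ => Finset.measurable_sum _ fun a _ =>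
    h.measurable_indicator_jointEvent X Y ν ν' a b]
  have h3 : ∀ b ∈ Y, ∫⁻ ω, ∑ a ∈ X.filter (· ≠ b), (jointEvent P X Y ν ν' a b).indicator 1 ω ∂μ ≤
      ENNReal.ofReal (∑ a ∈ X.filter (· ≠ b), pairWeight X Y a b) := by
    intro b hb
    rw [lintegral_finsetSum _ fun a _ => h.measurable_indicator_jointEvent X Y ν ν' a b,
      ENNReal.ofReal_sum_of_nonneg fun a _ => by unfold pairWeight; positivity]
    refine Finset.sum_le_sum fun a ha => ?_
    rw [lintegral_indicator_one (h.measurableSet_jointEvent X Y ν ν' a b)]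
    obtain ⟨ha, hab⟩ := Finset.mem_filter.1 ha
    exact h.measure_jointEvent_le hν hν' hc ha hb hab
  refine (Finset.sum_le_sum h3).trans ?_
  rw [← ENNReal.ofReal_sum_of_nonneg fun b _ => Finset.sum_nonneg
    fun a _ => by unfold pairWeight; positivity]
  exact ENNReal.ofReal_le_ofReal (sum_pairWeight_le X Y)

end IsUniformFamily

/-- The node that holds a key of `joinKeys A B op`. -/
def joinNode {K : Type u} {ι : Type w} (ν₁ ν₂ : K → ι) : SetOp → K → ι
  | .intersect => ν₂
  | _ => ν₁

section

variable {K : Type u} [LinearOrder K] {Ω : Type v} {ι : Type w} [MeasurableSpace Ω]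
  {P : ι → Ω → ℝ} {μ : Measure Ω} {A B : Finset K} {ν₁ ν₂ : K → ι}
  {T₁ T₂ : Ω → BinaryTree (K × ℝ)}

omit [LinearOrder K] [MeasurableSpace Ω] in
lemma joinPriority_eq (op : SetOp) (ω : Ω) :
    joinPriority (fun k => P (ν₁ k) ω) (fun k => P (ν₂ k) ω) op =
      fun k => P (joinNode ν₁ ν₂ op k) ω := by
  cases op <;> rfl

lemma joinNode_injOn (op : SetOp) (h₁ : InjOn ν₁ A) (h₂ : InjOn ν₂ B) :
    InjOn (joinNode ν₁ ν₂ op) (joinKeys A B op) := by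
  cases op
  · exact h₁.mono (by simp [joinKeys])
  · exact h₂.mono (by simp [joinKeys])
  · exact h₁.mono (by simp [joinKeys])

lemma eq_of_joinNode_eq (op : SetOp) (h₂ : InjOn ν₂ B)
    (hc : ∀ a ∈ A, ∀ b ∈ B, ν₁ a = ν₂ b → a = b) :
    ∀ a ∈ joinKeys A B op, ∀ b ∈ B, joinNode ν₁ ν₂ op a = ν₂ b → a = b := by
  intro a ha b hb hab
  cases op
  · exact hc a (joinKeys_subset _ ha) b hb hab
  · exact h₂ (Finset.mem_inter.1 ha).2 hb hab
  · exact hc a (joinKeys_subset _ ha) b hb hab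

lemma lintegral_work_le (op : SetOp) (h : IsUniformFamily P μ) (hν₁ : InjOn ν₁ A)
    (hν₂ : InjOn ν₂ B) (hc : ∀ a ∈ A, ∀ b ∈ B, ν₁ a = ν₂ b → a = b)
    (hT₁ : ∀ ω, IsTreapOn A (fun k => P (ν₁ k) ω) (T₁ ω))
    (hT₂ : ∀ ω, IsTreapOn B (fun k => P (ν₂ k) ω) (T₂ ω)) :
    ∫⁻ ω, ((op.run Prod.fst join (T₁ ω) (T₂ ω)).work : ℝ≥0∞) ∂μ ≤
      ENNReal.ofReal (2902 * workBound A.card B.card) := by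
  have := h.isProbabilityMeasure
  set A' := joinKeys A B op
  set ν := joinNode ν₁ ν₂ op
  set w := workBound A.card B.card
  have hw : 1 ≤ w := one_le_workBound _ _
  let N₁ : Ω → ℝ≥0∞ := fun ω =>
    (jointCount A (fun k => P (ν₁ k) ω) B (fun k => P (ν₂ k) ω) : ℝ≥0∞)
  let N₂ : Ω → ℝ≥0∞ := fun ω =>
    (jointCount A' (fun k => P (ν k) ω) B (fun k => P (ν₂ k) ω) : ℝ≥0∞)
  have h1 : ∫⁻ ω, N₁ ω ∂μ ≤ ENNReal.ofReal (48 * w) := h.lintegral_jointCount_le hν₁ hν₂ hc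
  have h2 : ∫⁻ ω, N₂ ω ∂μ ≤ ENNReal.ofReal (96 * w) := by
    refine (h.lintegral_jointCount_le (joinNode_injOn op hν₁ hν₂) hν₂
      (eq_of_joinNode_eq op hν₂ hc)).trans (ENNReal.ofReal_le_ofReal ?_)
    linarith [workBound_le_two_mul B.card (Finset.card_le_card (joinKeys_subset (A := A)
      (B := B) op))]
  have h3 : ((A ∩ B).card : ℝ) ≤ w := by
    refine le_trans ?_ (min_le_workBound _ _)
    exact_mod_cast le_min (Finset.card_le_card Finset.inter_subset_left)
      (Finset.card_le_card Finset.inter_subset_right)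
  have hpt : ∀ ω, ((op.run Prod.fst join (T₁ ω) (T₂ ω)).work : ℝ≥0∞) ≤
      20 * (N₁ ω + N₂ ω + (A ∩ B).card) + 2 := by
    intro ω
    have := run_work_le op (hT₁ ω) (hT₂ ω)
    rw [joinPriority_eq] at this
    simp only [N₁, N₂]
    exact_mod_cast this
  refine (lintegral_mono hpt).trans ?_
  rw [lintegral_add_right _ measurable_const, lintegral_const_mul' _ _ ENNReal.ofNat_ne_top,
    lintegral_add_right _ measurable_const,
    lintegral_add_left (h.measurable_jointCount A B ν₁ ν₂), lintegral_const, lintegral_const,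
    measure_univ, mul_one, mul_one]
  have h4 : ((A ∩ B).card : ℝ≥0∞) ≤ ENNReal.ofReal w := by
    rw [← ENNReal.ofReal_natCast]; exact ENNReal.ofReal_le_ofReal h3
  calc 20 * (∫⁻ ω, N₁ ω ∂μ + ∫⁻ ω, N₂ ω ∂μ + ((A ∩ B).card : ℝ≥0∞)) + 2
      ≤ 20 * (ENNReal.ofReal (48 * w) + ENNReal.ofReal (96 * w) + ENNReal.ofReal w) + 2 := by
        gcongr
    _ = ENNReal.ofReal (20 * (48 * w + 96 * w + w) + 2) := by
        rw [ENNReal.ofReal_add (by positivity) (by norm_num),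
          ENNReal.ofReal_mul (p := 20) (by norm_num),
          ENNReal.ofReal_add (by positivity) (by positivity),
          ENNReal.ofReal_add (by positivity) (by positivity)]
        simp
    _ ≤ ENNReal.ofReal (2902 * w) := ENNReal.ofReal_le_ofReal (by linarith)

end

end Treap

/-! ### The expected span on treaps -/

namespace Treap

section Records

variable {K : Type u} [LinearOrder K] {X : Finset K} {p : K → ℝ}

/-- The keys of `X` below `a`, closest first. -/
def below (X : Finset K) (a : K) : List K := (X.filter (· < a)).sort (· ≥ ·)

/-- The keys of `X` above `a`, closest first. -/
def above (X : Finset K) (a : K) : List K := (X.filter (a < ·)).sort (· ≤ ·)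

lemma mem_below {a x : K} : x ∈ below X a ↔ x ∈ X ∧ x < a := by simp [below]

lemma mem_above {a x : K} : x ∈ above X a ↔ x ∈ X ∧ a < x := by simp [above]

/-- If the list enumerates the keys from one side, closest first, then the members of `S` are among
the records of the sequence of their priorities. -/
lemma card_filter_le_recordCount {R : K → K → Prop} {l : List K} (hl : l.Pairwise R)
    {S : Finset K} (hS : ∀ c ∈ S, c ∈ l ∧ ∀ z ∈ l, R z c → p c ≤ p z) {x : ℝ}
    (hx : ∀ c ∈ S, p c ≤ x) : S.card ≤ recordCount p x l := by
  induction l generalizing S x with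
  | nil =>
    have : S = ∅ := Finset.eq_empty_of_forall_notMem fun c hc => by simpa using (hS c hc).1
    simp [this]
  | cons y l ih =>
    rw [List.pairwise_cons] at hl
    have h1 : ∀ c ∈ S, c ≠ y → c ∈ l := fun c hc hcy =>
      (List.mem_cons.1 (hS c hc).1).resolve_left hcy
    by_cases hyx : p y ≤ x
    · rw [recordCount, if_pos hyx]
      have h2 := ih hl.2 (S := S.erase y) (x := p y)
        (fun c hc => ⟨h1 c (Finset.mem_of_mem_erase hc) (Finset.ne_of_mem_erase hc),
          fun z hz => (hS c (Finset.mem_of_mem_erase hc)).2 z (List.mem_cons_of_mem _ hz)⟩)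
        (fun c hc => (hS c (Finset.mem_of_mem_erase hc)).2 y List.mem_cons_self
          (hl.1 c (h1 c (Finset.mem_of_mem_erase hc) (Finset.ne_of_mem_erase hc))))
      have h3 := Finset.pred_card_le_card_erase (s := S) (a := y)
      omega
    · rw [recordCount, if_neg hyx]
      refine ih hl.2 (fun c hc => ⟨h1 c hc ?_, fun z hz =>
        (hS c hc).2 z (List.mem_cons_of_mem _ hz)⟩) hx
      rintro rfl
      exact hyx (hx c hc)

lemma card_records_lt_le (hp : ∀ x ∈ X, p x ≤ 1) (a : K) :
    ((records X p a).filter (· < a)).card ≤ recordCount p 1 (below X a) := by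
  refine card_filter_le_recordCount (R := (· ≥ ·)) (Finset.pairwise_sort _ _) (fun c hc => ?_)
    fun c hc => hp c (mem_records.1 (Finset.mem_filter.1 hc).1).1
  obtain ⟨h1, h2⟩ := Finset.mem_filter.1 hc
  obtain ⟨h3, -, h4⟩ := mem_records.1 h1
  refine ⟨mem_below.2 ⟨h3, h2⟩, fun z hz hzc => ?_⟩
  obtain ⟨h5, h6⟩ := mem_below.1 hz
  rcases (show c ≤ z from hzc).eq_or_lt with rfl | h
  · exact le_rfl
  · exact h4 z h5 (Or.inl ⟨h, h6⟩)

lemma card_records_gt_le (hp : ∀ x ∈ X, p x ≤ 1) (a : K) :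
    ((records X p a).filter (a < ·)).card ≤ recordCount p 1 (above X a) := by
  refine card_filter_le_recordCount (R := (· ≤ ·)) (Finset.pairwise_sort _ _) (fun c hc => ?_)
    fun c hc => hp c (mem_records.1 (Finset.mem_filter.1 hc).1).1
  obtain ⟨h1, h2⟩ := Finset.mem_filter.1 hc
  obtain ⟨h3, -, h4⟩ := mem_records.1 h1
  refine ⟨mem_above.2 ⟨h3, h2⟩, fun z hz hzc => ?_⟩
  obtain ⟨h5, h6⟩ := mem_above.1 hz
  rcases (show z ≤ c from hzc).eq_or_lt with rfl | h
  · exact le_rfl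
  · exact h4 z h5 (Or.inr ⟨h6, h⟩)

/-- The records below `b` are the closest key below `b` and records for that key. -/
lemma card_records_lt_le_succ {M : ℕ}
    (hM : ∀ a ∈ X, ((records X p a).filter (· < a)).card ≤ M) (b : K) :
    ((records X p b).filter (· < b)).card ≤ M + 1 := by
  rcases (X.filter (· < b)).eq_empty_or_nonempty with h | h
  · have : (records X p b).filter (· < b) = ∅ := by
      refine Finset.subset_empty.1 (h ▸ ?_)
      exact Finset.filter_subset_filter _ fun x hx => (mem_records.1 hx).1
    simp [this]
  · obtain ⟨ha, hab⟩ := Finset.mem_filter.1 (Finset.max'_mem _ h)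
    set a := (X.filter (· < b)).max' h
    refine (Finset.card_le_card (t := insert a ((records X p a).filter (· < a))) ?_).trans
      ((Finset.card_insert_le _ _).trans (Nat.succ_le_succ (hM a ha)))
    intro c hc
    obtain ⟨h1, h2⟩ := Finset.mem_filter.1 hc
    obtain ⟨h3, -, h4⟩ := mem_records.1 h1
    have h5 : c ≤ a := Finset.le_max' _ _ (Finset.mem_filter.2 ⟨h3, h2⟩)
    rcases h5.eq_or_lt with h6 | h6
    · exact Finset.mem_insert.2 (Or.inl h6)
    · refine Finset.mem_insert_of_mem (Finset.mem_filter.2 ⟨mem_records.2 ⟨h3, h6.ne,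
        fun x hx hb => ?_⟩, h6⟩)
      rcases hb with h7 | h7
      · exact h4 x hx (Or.inl ⟨h7.1, h7.2.trans hab⟩)
      · exact (lt_asymm h6 (h7.1.trans h7.2)).elim

lemma card_records_gt_le_succ {M : ℕ}
    (hM : ∀ a ∈ X, ((records X p a).filter (a < ·)).card ≤ M) (b : K) :
    ((records X p b).filter (b < ·)).card ≤ M + 1 := by
  rcases (X.filter (b < ·)).eq_empty_or_nonempty with h | h
  · have : (records X p b).filter (b < ·) = ∅ := by
      refine Finset.subset_empty.1 (h ▸ ?_)
      exact Finset.filter_subset_filter _ fun x hx => (mem_records.1 hx).1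
    simp [this]
  · obtain ⟨ha, hab⟩ := Finset.mem_filter.1 (Finset.min'_mem _ h)
    set a := (X.filter (b < ·)).min' h
    refine (Finset.card_le_card (t := insert a ((records X p a).filter (a < ·))) ?_).trans
      ((Finset.card_insert_le _ _).trans (Nat.succ_le_succ (hM a ha)))
    intro c hc
    obtain ⟨h1, h2⟩ := Finset.mem_filter.1 hc
    obtain ⟨h3, -, h4⟩ := mem_records.1 h1
    have h5 : a ≤ c := Finset.min'_le _ _ (Finset.mem_filter.2 ⟨h3, h2⟩)
    rcases h5.eq_or_lt with h6 | h6
    · exact Finset.mem_insert.2 (Or.inl h6.symm)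
    · refine Finset.mem_insert_of_mem (Finset.mem_filter.2 ⟨mem_records.2 ⟨h3, h6.ne',
        fun x hx hb => ?_⟩, h6⟩)
      rcases hb with h7 | h7
      · exact (lt_asymm h6 (h7.1.trans h7.2)).elim
      · exact h4 x hx (Or.inr ⟨hab.trans h7.1, h7.2⟩)

/-- The sum of `2 ^ k` over the numbers `k` of records on either side of the keys, which bounds the
largest such `2 ^ k` and has a small expectation. -/
def recordWeight (X : Finset K) (p : K → ℝ) : ℕ :=
  ∑ a ∈ X, (2 ^ recordCount p 1 (below X a) + 2 ^ recordCount p 1 (above X a))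

lemma logb_two_sq_le {x : ℝ} (hx : 1 ≤ x) : Real.logb 2 x ^ 2 ≤ 16 * x := by
  have h0 : 0 ≤ x := by linarith
  have h1 : Real.log x ≤ 2 * √x := by
    have := Real.log_le_sub_one_of_pos (Real.sqrt_pos.2 (show 0 < x by linarith))
    rw [Real.log_sqrt h0] at this
    linarith
  have h2 : Real.logb 2 x ≤ 4 * √x := by
    rw [Real.logb, div_le_iff₀ (Real.log_pos one_lt_two)]
    nlinarith [two_mul_log_two_gt, Real.sqrt_nonneg x]
  have h3 : 0 ≤ Real.logb 2 x := Real.logb_nonneg one_lt_two hx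
  calc Real.logb 2 x ^ 2 ≤ (4 * √x) ^ 2 := pow_le_pow_left₀ h3 h2 2
    _ = 16 * x := by rw [mul_pow, Real.sq_sqrt h0]; norm_num

lemma one_le_logb_succ {n : ℕ} (hn : 1 ≤ n) : 1 ≤ Real.logb 2 ((n : ℝ) + 1) := by
  have : (1 : ℝ) ≤ n := by exact_mod_cast hn
  rw [Real.le_logb_iff_rpow_le one_lt_two (by positivity), Real.rpow_one]
  linarith

/-- All numbers of records are logarithmic, up to a factor that is controlled by the record
weight. -/
lemma exists_card_records_le (hp : ∀ x ∈ X, p x ≤ 1) {n : ℕ} (hn : 1 ≤ n) :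
    ∃ M : ℕ, (∀ b, (records X p b).card ≤ M) ∧ (M : ℝ) ^ 2 ≤
      200 * Real.logb 2 ((n : ℝ) + 1) ^ 2 * (1 + recordWeight X p / ((n : ℝ) + 1) ^ 2) := by
  rcases X.eq_empty_or_nonempty with rfl | hX
  · refine ⟨0, fun b => by simp [records], ?_⟩
    norm_num
    positivity
  let k : K → ℕ := fun a => max (recordCount p 1 (below X a)) (recordCount p 1 (above X a))
  obtain ⟨a₀, ha₀, hk⟩ := Finset.exists_mem_eq_sup X hX k
  have hle : ∀ a ∈ X, k a ≤ k a₀ := fun a ha => hk ▸ Finset.le_sup ha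
  refine ⟨2 * (k a₀ + 1), fun b => ?_, ?_⟩
  · have h1 := card_records_lt_le_succ (X := X) (p := p) (M := k a₀) (fun a ha =>
      (card_records_lt_le hp a).trans ((le_max_left _ _).trans (hle a ha))) b
    have h2 := card_records_gt_le_succ (X := X) (p := p) (M := k a₀) (fun a ha =>
      (card_records_gt_le hp a).trans ((le_max_right _ _).trans (hle a ha))) b
    have h3 : records X p b ⊆
        (records X p b).filter (· < b) ∪ (records X p b).filter (b < ·) := by
      intro c hc
      rw [← Finset.filter_or]
      exact Finset.mem_filter.2 ⟨hc, lt_or_gt_of_ne (mem_records.1 hc).2.1⟩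
    have h4 := (Finset.card_le_card h3).trans (Finset.card_union_le _ _)
    omega
  · have h1 : 2 ^ k a₀ ≤ recordWeight X p := by
      refine le_trans ?_ (Finset.single_le_sum (f := fun a =>
        2 ^ recordCount p 1 (below X a) + 2 ^ recordCount p 1 (above X a))
        (fun _ _ => Nat.zero_le _) ha₀)
      rcases max_cases (recordCount p 1 (below X a₀)) (recordCount p 1 (above X a₀)) with h | h
      · simp only [k, h.1, Nat.le_add_right]
      · simp only [k, h.1, Nat.le_add_left]
    have h1' : (2 : ℝ) ^ k a₀ ≤ recordWeight X p := by exact_mod_cast h1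
    set L := Real.logb 2 ((n : ℝ) + 1)
    have hL : 1 ≤ L := one_le_logb_succ hn
    set z : ℝ := recordWeight X p / ((n : ℝ) + 1) ^ 2
    have hz : 0 ≤ z := by positivity
    have h2 : (k a₀ : ℝ) ≤ Real.logb 2 (1 + z) + 2 * L := by
      have h3 : (2 : ℝ) ^ k a₀ ≤ (1 + z) * ((n : ℝ) + 1) ^ 2 := by
        have : z * ((n : ℝ) + 1) ^ 2 = recordWeight X p := by
          simp only [z]; field_simp
        nlinarith [sq_nonneg ((n : ℝ) + 1)]
      have h4 := Real.logb_le_logb_of_le one_lt_two (by positivity) h3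
      rw [Real.logb_pow, Real.logb_self_eq_one one_lt_two, mul_one,
        Real.logb_mul (by positivity) (by positivity), Real.logb_pow, Nat.cast_ofNat] at h4
      exact h4
    have h3 := logb_two_sq_le (x := 1 + z) (by linarith)
    have h5 : 0 ≤ Real.logb 2 (1 + z) := Real.logb_nonneg one_lt_two (by linarith)
    set l := Real.logb 2 (1 + z)
    have h6 : ((2 * (k a₀ + 1) : ℕ) : ℝ) ≤ 6 * L + 2 * l := by push_cast; linarith
    have h7 := pow_le_pow_left₀ (Nat.cast_nonneg _) h6 2
    have h8 : 1 + z ≤ L ^ 2 * (1 + z) :=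
      le_mul_of_one_le_left (by linarith) (one_le_pow₀ hL)
    nlinarith [sq_nonneg (6 * L - 2 * l), mul_nonneg (sq_nonneg L) hz]

end Records

open MeasureTheory ProbabilityTheory Set

section

variable {K : Type u} [LinearOrder K] {Ω : Type v} {ι : Type w} [MeasurableSpace Ω]
  {P : ι → Ω → ℝ} {μ : Measure Ω} {A B : Finset K} {ν₁ ν₂ : K → ι}
  {T₁ T₂ : Ω → BinaryTree (K × ℝ)}

/-- The record weight of random priorities in proportion to the square of `n + 1`. -/
def relativeWeight (P : ι → Ω → ℝ) (X : Finset K) (ν : K → ι) (n : ℕ) (ω : Ω) : ℝ :=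
  recordWeight X (fun k => P (ν k) ω) / ((n : ℝ) + 1) ^ 2

omit [MeasurableSpace Ω] in
lemma relativeWeight_nonneg (X : Finset K) (ν : K → ι) (n : ℕ) (ω : Ω) :
    0 ≤ relativeWeight P X ν n ω := by unfold relativeWeight; positivity

lemma IsUniformFamily.measurable_relativeWeight (h : IsUniformFamily P μ) (X : Finset K)
    (ν : K → ι) (n : ℕ) : Measurable (relativeWeight P X ν n) := by
  have h1 : ∀ l : List K, Measurable fun ω => 2 ^ recordCount (fun k => P (ν k) ω) 1 l := fun l =>
    (measurable_from_nat (f := fun k => 2 ^ k)).comp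
      (measurable_recordCount (fun k => h.measurable (ν k)) l measurable_const)
  refine Measurable.div_const ((measurable_from_nat (f := fun k : ℕ => (k : ℝ))).comp ?_) _
  exact Finset.measurable_sum _ fun a _ => (h1 _).add (h1 _)

/-- On average, `2 ^ k` is at most `n + 1` for each of the `2 n` numbers `k` of records. -/
lemma IsUniformFamily.lintegral_relativeWeight_le (h : IsUniformFamily P μ) {X : Finset K}
    {ν : K → ι} (hν : InjOn ν X) {n : ℕ} (hn : X.card ≤ n) :
    ∫⁻ ω, ENNReal.ofReal (relativeWeight P X ν n ω) ∂μ ≤ 2 := by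
  have h1 : ∀ l : List K, l.Nodup → (∀ x ∈ l, x ∈ X) →
      (Measurable fun ω => (2 : ℝ≥0∞) ^ recordCount (fun k => P (ν k) ω) 1 l) ∧
      ∫⁻ ω, (2 : ℝ≥0∞) ^ recordCount (fun k => P (ν k) ω) 1 l ∂μ ≤ n + 1 := by
    intro l hl hlX
    refine ⟨(measurable_from_nat (f := fun k => (2 : ℝ≥0∞) ^ k)).comp
      (measurable_recordCount (fun k => h.measurable (ν k)) l measurable_const), ?_⟩
    have h2 := h.lintegral_two_pow_recordCount_le (l := l.map ν)
      (hl.map_on fun x hx y hy hxy => hν (hlX x hx) (hlX y hy) hxy) (right_mem_Icc.2 zero_le_one)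
    simp only [recordCount_map] at h2
    refine h2.trans ?_
    have h3 : l.length ≤ n := by
      rw [← List.toFinset_card_of_nodup hl]
      exact (Finset.card_le_card fun x hx => hlX x (List.mem_toFinset.1 hx)).trans hn
    have h4 : (1 : ℝ) + ((l.map ν).length : ℝ) * 1 ≤ ((n + 1 : ℕ) : ℝ) := by
      rw [List.length_map]; push_cast; linarith [(Nat.cast_le (α := ℝ)).2 h3]
    refine (ENNReal.ofReal_le_ofReal h4).trans (le_of_eq ?_)
    rw [ENNReal.ofReal_natCast]
    push_cast
    rfl
  have hb : ∀ a, (below X a).Nodup ∧ ∀ x ∈ below X a, x ∈ X := fun a =>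
    ⟨Finset.sort_nodup _ _, fun x hx => (mem_below.1 hx).1⟩
  have ha : ∀ a, (above X a).Nodup ∧ ∀ x ∈ above X a, x ∈ X := fun a =>
    ⟨Finset.sort_nodup _ _, fun x hx => (mem_above.1 hx).1⟩
  have h2 : ∫⁻ ω, (recordWeight X (fun k => P (ν k) ω) : ℝ≥0∞) ∂μ ≤ 2 * (n + 1) ^ 2 := by
    simp only [recordWeight, Nat.cast_sum, Nat.cast_add, Nat.cast_pow, Nat.cast_ofNat]
    have hm : ∀ a, Measurable fun ω =>
        (2 : ℝ≥0∞) ^ recordCount (fun k => P (ν k) ω) 1 (below X a) +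
          2 ^ recordCount (fun k => P (ν k) ω) 1 (above X a) := fun a =>
      (h1 _ (hb a).1 (hb a).2).1.add (h1 _ (ha a).1 (ha a).2).1
    rw [lintegral_finsetSum _ fun a _ => hm a]
    calc _ ≤ ∑ a ∈ X, ((n + 1 : ℝ≥0∞) + (n + 1)) := Finset.sum_le_sum fun a _ => by
          rw [lintegral_add_left (h1 _ (hb a).1 (hb a).2).1]
          exact add_le_add (h1 _ (hb a).1 (hb a).2).2 (h1 _ (ha a).1 (ha a).2).2
      _ = X.card * (2 * (n + 1)) := by rw [Finset.sum_const, nsmul_eq_mul]; ring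
      _ ≤ (n + 1) * (2 * (n + 1)) := by
          gcongr
          exact (Nat.cast_le.2 hn).trans le_self_add
      _ = 2 * (n + 1) ^ 2 := by ring
  have h3 : ∀ ω, ENNReal.ofReal (relativeWeight P X ν n ω) =
      recordWeight X (fun k => P (ν k) ω) * ((n + 1 : ℝ≥0∞) ^ 2)⁻¹ := by
    intro ω
    rw [relativeWeight, ENNReal.ofReal_div_of_pos (by positivity), ENNReal.ofReal_natCast,
      div_eq_mul_inv]
    congr 2
    rw [ENNReal.ofReal_pow (by positivity), ENNReal.ofReal_add (by positivity) zero_le_one,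
      ENNReal.ofReal_natCast, ENNReal.ofReal_one]
  simp only [h3]
  have h4 : ((n + 1 : ℝ≥0∞) ^ 2) ≠ 0 := by positivity
  have h5 : ((n + 1 : ℝ≥0∞) ^ 2) ≠ ⊤ := by
    exact_mod_cast ENNReal.natCast_ne_top ((n + 1) ^ 2)
  rw [lintegral_mul_const' _ _ (ENNReal.inv_ne_top.2 h4), ← div_eq_mul_inv]
  exact ENNReal.div_le_of_le_mul h2

omit [MeasurableSpace Ω] in
/-- The span of a set operation is the product of two logarithmic quantities, up to factors with
bounded expectations. -/
lemma run_span_le_relativeWeight (op : SetOp) {ω : Ω} (hA : A.Nonempty) (hB : B.Nonempty)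
    (hp₁ : ∀ a ∈ A, P (ν₁ a) ω ≤ 1) (hp₂ : ∀ b ∈ B, P (ν₂ b) ω ≤ 1)
    (hT₁ : IsTreapOn A (fun k => P (ν₁ k) ω) (T₁ ω))
    (hT₂ : IsTreapOn B (fun k => P (ν₂ k) ω) (T₂ ω)) :
    ((op.run Prod.fst join (T₁ ω) (T₂ ω)).span : ℝ) ≤
      6000 * spanBound A.card B.card * (1 + relativeWeight P A ν₁ A.card ω +
        relativeWeight P (joinKeys A B op) (joinNode ν₁ ν₂ op) A.card ω +
        relativeWeight P B ν₂ B.card ω) + 2 := by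
  have hp : ∀ a ∈ joinKeys A B op, P (joinNode ν₁ ν₂ op a) ω ≤ 1 := by
    intro a ha
    cases op
    · exact hp₁ a (joinKeys_subset _ ha)
    · exact hp₂ a (Finset.mem_inter.1 ha).2
    · exact hp₁ a (joinKeys_subset _ ha)
  obtain ⟨M₁, h1, h1'⟩ := exists_card_records_le hp₁ hA.card_pos
  obtain ⟨M₂, h2, h2'⟩ := exists_card_records_le hp hA.card_pos
  obtain ⟨M₃, h3, h3'⟩ := exists_card_records_le hp₂ hB.card_pos
  have hspan := run_span_le op hT₁ hT₂ (M₁ := M₁) (M₂ := M₂) (fun b _ => h1 b)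
    (fun b _ => by rw [joinPriority_eq]; exact h2 b)
  have hheight := hT₂.height_le fun b _ => h3 b
  have hspan' : ((op.run Prod.fst join (T₁ ω) (T₂ ω)).span : ℝ) ≤
      (6 * M₁ + 9 * M₂ + 11) * (M₃ + 1) + 2 := by
    exact_mod_cast hspan.trans (Nat.add_le_add_right (Nat.mul_le_mul_left _ hheight) 2)
  refine hspan'.trans (add_le_add_left ?_ 2)
  have hLA := one_le_logb_succ hA.card_pos
  have hLB := one_le_logb_succ hB.card_pos
  change (M₁ : ℝ) ^ 2 ≤ _ * (1 + relativeWeight P A ν₁ A.card ω) at h1'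
  change (M₂ : ℝ) ^ 2 ≤ _ * (1 + relativeWeight P (joinKeys A B op) (joinNode ν₁ ν₂ op)
    A.card ω) at h2'
  change (M₃ : ℝ) ^ 2 ≤ _ * (1 + relativeWeight P B ν₂ B.card ω) at h3'
  have hs : Real.logb 2 ((A.card : ℝ) + 1) * Real.logb 2 ((B.card : ℝ) + 1) ≤
    spanBound A.card B.card := le_max_right _ _
  have z1 := relativeWeight_nonneg (P := P) A ν₁ A.card ω
  have z2 := relativeWeight_nonneg (P := P) (joinKeys A B op) (joinNode ν₁ ν₂ op) A.card ω
  have z3 := relativeWeight_nonneg (P := P) B ν₂ B.card ω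
  generalize relativeWeight P A ν₁ A.card ω = a at *
  generalize relativeWeight P (joinKeys A B op) (joinNode ν₁ ν₂ op) A.card ω = b at *
  generalize relativeWeight P B ν₂ B.card ω = c at *
  generalize Real.logb 2 ((A.card : ℝ) + 1) = x at *
  generalize Real.logb 2 ((B.card : ℝ) + 1) = y at *
  have e0 : 1 ≤ x ^ 2 := by nlinarith
  have e0' : 1 ≤ y ^ 2 := by nlinarith
  -- both factors are estimated by their squares, which are linear in the relative weights
  have e1 : (6 * (M₁ : ℝ) + 9 * M₂ + 11) ^ 2 ≤ 71000 * x ^ 2 * (1 + a + b + c) := by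
    have : (6 * (M₁ : ℝ) + 9 * M₂ + 11) ^ 2 ≤
        3 * (36 * (M₁ : ℝ) ^ 2 + 81 * (M₂ : ℝ) ^ 2 + 121) := by
      nlinarith [sq_nonneg (6 * (M₁ : ℝ) - 9 * M₂), sq_nonneg (6 * (M₁ : ℝ) - 11),
        sq_nonneg (9 * (M₂ : ℝ) - 11)]
    have := mul_nonneg (sq_nonneg x) z1
    have := mul_nonneg (sq_nonneg x) z2
    have := mul_nonneg (sq_nonneg x) z3
    nlinarith
  have e2 : ((M₃ : ℝ) + 1) ^ 2 ≤ 402 * y ^ 2 * (1 + a + b + c) := by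
    have : ((M₃ : ℝ) + 1) ^ 2 ≤ 2 * (M₃ : ℝ) ^ 2 + 2 := by nlinarith [sq_nonneg ((M₃ : ℝ) - 1)]
    have := mul_nonneg (sq_nonneg y) z1
    have := mul_nonneg (sq_nonneg y) z2
    have := mul_nonneg (sq_nonneg y) z3
    nlinarith
  have e3 : (6 * (M₁ : ℝ) + 9 * M₂ + 11) * (M₃ + 1) ≤ 6000 * (x * y) * (1 + a + b + c) := by
    refine (pow_le_pow_iff_left₀ (by positivity) (by positivity) two_ne_zero).1 ?_
    rw [mul_pow]
    refine (mul_le_mul e1 e2 (sq_nonneg _) (by positivity)).trans ?_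
    have : 0 ≤ (x * y * (1 + a + b + c)) ^ 2 := sq_nonneg _
    nlinarith
  refine e3.trans ?_
  gcongr

lemma lintegral_span_le (op : SetOp) (h : IsUniformFamily P μ) (hν₁ : InjOn ν₁ A)
    (hν₂ : InjOn ν₂ B)
    (hT₁ : ∀ ω, IsTreapOn A (fun k => P (ν₁ k) ω) (T₁ ω))
    (hT₂ : ∀ ω, IsTreapOn B (fun k => P (ν₂ k) ω) (T₂ ω)) :
    ∫⁻ ω, ((op.run Prod.fst join (T₁ ω) (T₂ ω)).span : ℝ≥0∞) ∂μ ≤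
      ENNReal.ofReal (42002 * spanBound A.card B.card) := by
  have := h.isProbabilityMeasure
  have hs1 : 1 ≤ spanBound A.card B.card := le_max_left _ _
  have triv : (∀ ω, (op.run Prod.fst join (T₁ ω) (T₂ ω)).span ≤ 2) →
      ∫⁻ ω, ((op.run Prod.fst join (T₁ ω) (T₂ ω)).span : ℝ≥0∞) ∂μ ≤
        ENNReal.ofReal (42002 * spanBound A.card B.card) := by
    intro h2
    have h3 : ∀ ω, ((op.run Prod.fst join (T₁ ω) (T₂ ω)).span : ℝ≥0∞) ≤ 2 := fun ω => by
      exact_mod_cast h2 ω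
    refine (lintegral_mono h3).trans ?_
    rw [lintegral_const, measure_univ, mul_one, ← ENNReal.ofReal_ofNat]
    exact ENNReal.ofReal_le_ofReal (by linarith)
  rcases A.eq_empty_or_nonempty with rfl | hA
  · refine triv fun ω => ?_
    have : T₁ ω = nil := by
      by_contra hne
      cases hT : T₁ ω with
      | nil => exact hne hT
      | node e l r => exact absurd (hT ▸ hT₁ ω).node.1 (Finset.notMem_empty _)
    rw [this, (run_nil_left op _).2]
    norm_num
  rcases B.eq_empty_or_nonempty with rfl | hB
  · refine triv fun ω => ?_
    have : T₂ ω = nil := by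
      by_contra hne
      cases hT : T₂ ω with
      | nil => exact hne hT
      | node e l r => exact absurd (hT ▸ hT₂ ω).node.1 (Finset.notMem_empty _)
    rw [this]
    exact (run_nil_right op _).2
  set s := spanBound A.card B.card
  have m1 := (h.measurable_relativeWeight A ν₁ A.card).ennreal_ofReal
  have m2 := (h.measurable_relativeWeight (joinKeys A B op) (joinNode ν₁ ν₂ op)
    A.card).ennreal_ofReal
  have i1 := h.lintegral_relativeWeight_le hν₁ (le_refl A.card)
  have i2 := h.lintegral_relativeWeight_le (joinNode_injOn op hν₁ hν₂)
    (Finset.card_le_card (joinKeys_subset (A := A) (B := B) op))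
  have i3 := h.lintegral_relativeWeight_le hν₂ (le_refl B.card)
  have hae₁ : ∀ᵐ ω ∂μ, ∀ a ∈ A, P (ν₁ a) ω ≤ 1 :=
    (Filter.eventually_all_finset A).2 fun a _ => h.ae_le_one (ν₁ a)
  have hae₂ : ∀ᵐ ω ∂μ, ∀ b ∈ B, P (ν₂ b) ω ≤ 1 :=
    (Filter.eventually_all_finset B).2 fun b _ => h.ae_le_one (ν₂ b)
  have hpt : ∀ᵐ ω ∂μ, ((op.run Prod.fst join (T₁ ω) (T₂ ω)).span : ℝ≥0∞) ≤
      ENNReal.ofReal (6000 * s) * (1 + ENNReal.ofReal (relativeWeight P A ν₁ A.card ω) +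
        ENNReal.ofReal (relativeWeight P (joinKeys A B op) (joinNode ν₁ ν₂ op) A.card ω) +
        ENNReal.ofReal (relativeWeight P B ν₂ B.card ω)) + 2 := by
    filter_upwards [hae₁, hae₂] with ω h1 h2
    have h3 := run_span_le_relativeWeight op hA hB h1 h2 (hT₁ ω) (hT₂ ω)
    have z1 := relativeWeight_nonneg (P := P) A ν₁ A.card ω
    have z2 := relativeWeight_nonneg (P := P) (joinKeys A B op) (joinNode ν₁ ν₂ op) A.card ω
    have z3 := relativeWeight_nonneg (P := P) B ν₂ B.card ω
    rw [← ENNReal.ofReal_natCast, ← ENNReal.ofReal_one, ← ENNReal.ofReal_add zero_le_one z1,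
      ← ENNReal.ofReal_add (by positivity) z2, ← ENNReal.ofReal_add (by positivity) z3,
      ← ENNReal.ofReal_mul (by positivity), ← ENNReal.ofReal_ofNat 2,
      ← ENNReal.ofReal_add (by positivity) (by norm_num)]
    exact ENNReal.ofReal_le_ofReal h3
  refine (lintegral_mono_ae hpt).trans ?_
  have m1' : Measurable fun ω => 1 + ENNReal.ofReal (relativeWeight P A ν₁ A.card ω) :=
    measurable_const.add m1
  have m2' : Measurable fun ω => 1 + ENNReal.ofReal (relativeWeight P A ν₁ A.card ω) +
      ENNReal.ofReal (relativeWeight P (joinKeys A B op) (joinNode ν₁ ν₂ op) A.card ω) :=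
    m1'.add m2
  rw [lintegral_add_right _ measurable_const, lintegral_const_mul' _ _ ENNReal.ofReal_ne_top,
    lintegral_add_left m2', lintegral_add_left m1', lintegral_add_left measurable_const,
    lintegral_const, lintegral_const, measure_univ, mul_one, mul_one]
  calc _ ≤ ENNReal.ofReal (6000 * s) * (1 + 2 + 2 + 2) + 2 := by gcongr
    _ = ENNReal.ofReal (6000 * s * 7 + 2) := by
        rw [ENNReal.ofReal_add (by positivity) (by norm_num),
          ENNReal.ofReal_mul (q := 7) (by positivity)]
        norm_num
    _ ≤ ENNReal.ofReal (42002 * s) := ENNReal.ofReal_le_ofReal (by linarith)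

end

end Treap

/-! ### The bounds for join schemes -/

lemma one_le_spanBound (a b : ℕ) : 1 ≤ spanBound a b := le_max_left _ _

/-- The common factor in the bounds on work and span. -/
def costFactor (δ c : ℝ) : ℝ :=
  max (workFactor δ c) (10 * IsJoinScheme.callFactor δ c * δ⁻¹ + 2)

lemma IsJoinScheme.run_cost_le {E : Type u} {K : Type v} [LinearOrder K]
    {join : BinaryTree E → E → BinaryTree E → Cost (BinaryTree E)} {Bal : BinaryTree E → Prop}
    {rk : BinaryTree E → ℝ} {δ c : ℝ} (h : IsJoinScheme join Bal rk δ c) (key : E → K)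
    (op : SetOp) {t₁ t₂ : BinaryTree E} (h₁ : Bal t₁) (h₂ : Bal t₂) :
    ((op.run key join t₁ t₂).work : ℝ) ≤
        costFactor δ c * workBound t₁.numNodes t₂.numNodes ∧
      ((op.run key join t₁ t₂).span : ℝ) ≤
        costFactor δ c * spanBound t₁.numNodes t₂.numNodes :=
  ⟨(h.run_work_le key op h₁ h₂).trans (mul_le_mul_of_nonneg_right (le_max_left _ _)
      (zero_le_one.trans (one_le_workBound _ _))),
    (h.run_span_le key op h₁ h₂).trans (mul_le_mul_of_nonneg_right (le_max_right _ _)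
      (zero_le_one.trans (one_le_spanBound _ _)))⟩

end JoinTree

end

theorem mainTheorem1 :
    -- AVL trees
    (∃ C : ℝ, ∀ (K : Type u) [LinearOrder K] (op : JoinTree.SetOp) (T₁ T₂ : BinaryTree K),
      JoinTree.IsBST id T₁ → JoinTree.IsBST id T₂ →
      JoinTree.AVL.Balanced T₁ → JoinTree.AVL.Balanced T₂ →
      ((op.run id JoinTree.AVL.join T₁ T₂).work : ℝ) ≤
          C * JoinTree.workBound T₁.numNodes T₂.numNodes ∧
        ((op.run id JoinTree.AVL.join T₁ T₂).span : ℝ) ≤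
          C * JoinTree.spanBound T₁.numNodes T₂.numNodes) ∧
    -- red-black trees
    (∃ C : ℝ, ∀ (K : Type u) [LinearOrder K] (op : JoinTree.SetOp)
        (T₁ T₂ : BinaryTree (K × JoinTree.RB.Color)),
      JoinTree.IsBST Prod.fst T₁ → JoinTree.IsBST Prod.fst T₂ →
      JoinTree.RB.Balanced T₁ → JoinTree.RB.Balanced T₂ →
      ((op.run Prod.fst JoinTree.RB.join T₁ T₂).work : ℝ) ≤
          C * JoinTree.workBound T₁.numNodes T₂.numNodes ∧
        ((op.run Prod.fst JoinTree.RB.join T₁ T₂).span : ℝ) ≤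
          C * JoinTree.spanBound T₁.numNodes T₂.numNodes) ∧
    -- weight-balanced trees
    (∀ α : ℝ, 2 / 11 < α → α ≤ 1 - 1 / Real.sqrt 2 →
      ∃ C : ℝ, ∀ (K : Type u) [LinearOrder K] (op : JoinTree.SetOp) (T₁ T₂ : BinaryTree K),
      JoinTree.IsBST id T₁ → JoinTree.IsBST id T₂ →
      JoinTree.WB.Balanced α T₁ → JoinTree.WB.Balanced α T₂ →
      ((op.run id (JoinTree.WB.join α) T₁ T₂).work : ℝ) ≤
          C * JoinTree.workBound T₁.numNodes T₂.numNodes ∧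
        ((op.run id (JoinTree.WB.join α) T₁ T₂).span : ℝ) ≤
          C * JoinTree.spanBound T₁.numNodes T₂.numNodes) ∧
    -- treaps: every node `i : ι` has its own uniformly random priority `P i`; the key `k` sits in
    -- the node `ν₁ k` of `T₁` and in the node `ν₂ k` of `T₂`, which may be one shared node
    (∃ C : ℝ, ∀ (K : Type u) [LinearOrder K] (op : JoinTree.SetOp)
        (Ω : Type v) [MeasurableSpace Ω] (μ : MeasureTheory.Measure Ω)
        [MeasureTheory.IsProbabilityMeasure μ]
        (ι : Type w) (P : ι → Ω → ℝ) (A B : Finset K) (ν₁ ν₂ : K → ι)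
        (T₁ T₂ : Ω → BinaryTree (K × ℝ)),
      (∀ i, Measurable (P i)) →
      (∀ i, MeasureTheory.pdf.IsUniform (P i) (Set.Icc 0 1) μ) →
      ProbabilityTheory.iIndepFun P μ →
      Set.InjOn ν₁ A → Set.InjOn ν₂ B →
      (∀ a ∈ A, ∀ b ∈ B, ν₁ a = ν₂ b → a = b) →
      (∀ ω, JoinTree.Treap.IsTreapOn A (fun k => P (ν₁ k) ω) (T₁ ω)) →
      (∀ ω, JoinTree.Treap.IsTreapOn B (fun k => P (ν₂ k) ω) (T₂ ω)) →
      ∫⁻ ω, ((op.run Prod.fst JoinTree.Treap.join (T₁ ω) (T₂ ω)).work : ℝ≥0∞) ∂μ ≤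
          ENNReal.ofReal (C * JoinTree.workBound A.card B.card) ∧
        ∫⁻ ω, ((op.run Prod.fst JoinTree.Treap.join (T₁ ω) (T₂ ω)).span : ℝ≥0∞) ∂μ ≤
          ENNReal.ofReal (C * JoinTree.spanBound A.card B.card)) := by
  refine ⟨⟨JoinTree.costFactor (1 / 2) 10, fun K _ op T₁ T₂ _ _ h₁ h₂ =>
      JoinTree.AVL.isJoinScheme.run_cost_le id op h₁ h₂⟩,
    ⟨JoinTree.costFactor (1 / 2) 12, fun K _ op T₁ T₂ _ _ h₁ h₂ =>
      JoinTree.RB.isJoinScheme.run_cost_le Prod.fst op h₁ h₂⟩,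
    fun α h1 h2 => ⟨JoinTree.costFactor (JoinTree.WB.drop α) (JoinTree.WB.joinFactor α),
      fun K _ op T₁ T₂ _ _ h₁ h₂ => (JoinTree.WB.isJoinScheme
        (JoinTree.WB.admissible h1 h2)).run_cost_le id op h₁ h₂⟩,
    ⟨42002, fun K _ op Ω _ μ _ ι P A B ν₁ ν₂ T₁ T₂ hm hu hi hν₁ hν₂ hc hT₁ hT₂ => ?_⟩⟩
  have h : JoinTree.Treap.IsUniformFamily P μ := ⟨hm, hu, hi⟩
  refine ⟨(JoinTree.Treap.lintegral_work_le op h hν₁ hν₂ hc hT₁ hT₂).trans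
    (ENNReal.ofReal_le_ofReal ?_), JoinTree.Treap.lintegral_span_le op h hν₁ hν₂ hT₁ hT₂⟩
  linarith [JoinTree.one_le_workBound A.card B.card]
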